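/- Let $d\ge 1$ and let $e=(\mathbf e_1,\dots,\mathbf e_{q_1})$ and $f=(\mathbf f_1,\dots,\mathbf f_{q_2})$ be two disjoint sequences of nonzero vectors in $\mathbb N^d$ (no $\mathbf e_i$ equals an $\mathbf f_j$) such that $\sum_i\mathbf e_i=\sum_j\mathbf f_j$. For $\mathbf n\in\mathbb N^d$ and $\mathbf x\in\mathbb R^d$ put $$\mathcal Q_{e,f}(\mathbf n)=\frac{(\mathbf e_1\cdot\mathbf n)!\cdots(\mathbf e_{q_1}\cdot\mathbf n)!}{(\mathbf f_1\cdot\mathbf n)!\cdots(\mathbf f_{q_2}\cdot\mathbf n)!},\qquad \Delta_{e,f}(\mathbf x)=\sum_{i=1}^{q_1}\lfloor\mathbf e_i\cdot\mathbf x\rfloor-\sum_{j=1}^{q_2}\lfloor\mathbf f_j\cdot\mathbf x\rfloor,$$ and let $\mathcal D_{e,f}$ be the set of all $\mathbf x\in[0,1)^d$ such that $\mathbf c\cdot\mathbf x\ge 1$ for some $\mathbf c\in\{\mathbf e_1,\dots,\mathbf e_{q_1},\mathbf f_1,\dots,\mathbf f_{q_2}\}$. With $H_m=\sum_{i=1}^m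 1/i$, define the formal power series in $\mathbf z=(z_1,\dots,z_d)$ $$F_{e,f}(\mathbf z)=\sum_{\mathbf n\in\mathbb N^d}\mathcal Q_{e,f}(\mathbf n)\,\mathbf z^{\mathbf n},\qquad G_{e,f,k}(\mathbf z)=\sum_{\mathbf n\in\mathbb N^d}\mathcal Q_{e,f}(\mathbf n)\Big(\sum_{i=1}^{q_1}\mathbf e_i^{(k)}H_{\mathbf e_i\cdot\mathbf n}-\sum_{j=1}^{q_2}\mathbf f_j^{(k)}H_{\mathbf f_j\cdot\mathbf n}\Big)\mathbf z^{\mathbf n},$$ where $\mathbf v^{(k)}$ is the $k$-th coordinate of $\mathbf v$, and the canonical coordinates $q_{e,f,k}(\mathbf z)=z_k\exp\big(G_{e,f,k}(\mathbf z)/F_{e,f}(\mathbf z)\big)$ for $k=1,\dots,d$. Then $\mathcal Q_{e,f}(\mathbf n)\in\mathbb Z$ for all $\mathbf n\in\mathbb N^d$ if and only if $\Delta_{e,f}\ge 0$ on $[0,1]^d$. Suppose that this is the case. Then the following dichotomy holds. (i) If $\Delta_{e,f}(\mathbf x)\ge 1$ for all $\mathbf x\in\mathcal D_{e,f}$, then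 $q_{e,f,k}(\mathbf z)\in z_k\mathbb Z[[\mathbf z]]$ for all $k\in\{1,\dots,d\}$. (ii) If $\Delta_{e,f}(\mathbf x)=0$ for some $\mathbf x\in\mathcal D_{e,f}$, then there exists $k\in\{1,\dots,d\}$ such that $q_{e,f,k}(\mathbf z)\in z_k\mathbb Z_p[[\mathbf z]]$ for only finitely many primes $p$. Moreover, the map $\mathbf z\mapsto(q_{e,f,1}(\mathbf z),\dots,q_{e,f,d}(\mathbf z))$ has a compositional inverse $\mathbf q\mapsto(z_{e,f,1}(\mathbf q),\dots,z_{e,f,d}(\mathbf q))$ in formal power series without constant term (the mirror maps), and the same dichotomy holds for it: in case (i), $z_{e,f,k}(\mathbf q)\in q_k\mathbb Z[[\mathbf q]]$ for all $k$; in case (ii), there exists $k$ such that $z_{e,f,k}(\mathbf q)\in q_k\mathbb Z_p[[\mathbf q]]$ for only finitely many primes $p$. -/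

import Mathlib

/-!
Factorial ratios of linear forms, their Landau function, the associated canonical coordinates
and mirror maps.
A finite sequence of `q` vectors in `ℕ^d` is a function `Fin q → Fin d → ℕ`.
-/

noncomputable section

namespace FactorialRatio

open scoped Nat

/-- The dot product `c · x` of a vector `c ∈ ℕ^d` with a real vector `x`. -/
def dotReal {d : ℕ} (c : Fin d → ℕ) (x : Fin d → ℝ) : ℝ :=
  ∑ k, (c k : ℝ) * x k

/-- The ratio of factorials
`Q_{e,f}(n) = (e₁ · n)! ⋯ (e_{q₁} · n)! / ((f₁ · n)! ⋯ (f_{q₂} · n)!)`. -/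
def Q {d q₁ q₂ : ℕ} (e : Fin q₁ → Fin d → ℕ) (f : Fin q₂ → Fin d → ℕ) (n : Fin d → ℕ) : ℚ :=
  (∏ i, ((e i ⬝ᵥ n)! : ℚ)) / ∏ j, ((f j ⬝ᵥ n)! : ℚ)

/-- The Landau function `Δ_{e,f}(x) = ∑ᵢ ⌊eᵢ · x⌋ - ∑ⱼ ⌊fⱼ · x⌋`. -/
def landau {d q₁ q₂ : ℕ} (e : Fin q₁ → Fin d → ℕ) (f : Fin q₂ → Fin d → ℕ)
    (x : Fin d → ℝ) : ℤ :=
  ∑ i, ⌊dotReal (e i) x⌋ - ∑ j, ⌊dotReal (f j) x⌋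

/-- The set `D_{e,f}` of all `x ∈ [0,1)^d` such that `c · x ≥ 1` for some term `c` of `e` or of
`f`. -/
def D {d q₁ q₂ : ℕ} (e : Fin q₁ → Fin d → ℕ) (f : Fin q₂ → Fin d → ℕ) : Set (Fin d → ℝ) :=
  {x | (∀ k, 0 ≤ x k ∧ x k < 1) ∧
    ((∃ i, 1 ≤ dotReal (e i) x) ∨ ∃ j, 1 ≤ dotReal (f j) x)}

/-- The formal power series `F_{e,f}(z) = ∑ₙ Q_{e,f}(n) zⁿ`. -/
def F {d q₁ q₂ : ℕ} (e : Fin q₁ → Fin d → ℕ) (f : Fin q₂ → Fin d → ℕ) :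
    MvPowerSeries (Fin d) ℚ :=
  fun n => Q e f n

/-- The formal power series
`G_{e,f,k}(z) = ∑ₙ Q_{e,f}(n) (∑ᵢ eᵢ⁽ᵏ⁾ H_{eᵢ · n} - ∑ⱼ fⱼ⁽ᵏ⁾ H_{fⱼ · n}) zⁿ`,
where `H_m` is the `m`-th harmonic number. -/
def G {d q₁ q₂ : ℕ} (e : Fin q₁ → Fin d → ℕ) (f : Fin q₂ → Fin d → ℕ) (k : Fin d) :
    MvPowerSeries (Fin d) ℚ :=
  fun n => Q e f n *
    (∑ i, (e i k : ℚ) * harmonic (e i ⬝ᵥ ⇑n) - ∑ j, (f j k : ℚ) * harmonic (f j ⬝ᵥ ⇑n))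

/-- The canonical coordinate `q_{e,f,k}(z) = z_k exp(G_{e,f,k}(z) / F_{e,f}(z))`. -/
def canonicalCoord {d q₁ q₂ : ℕ} (e : Fin q₁ → Fin d → ℕ) (f : Fin q₂ → Fin d → ℕ)
    (k : Fin d) : MvPowerSeries (Fin d) ℚ :=
  MvPowerSeries.X k * (PowerSeries.exp ℚ).subst (G e f k * (F e f)⁻¹)

/-- `F_{e,f}` has constant term `1`, so that it is invertible. -/
theorem constantCoeff_F {d q₁ q₂ : ℕ} (e : Fin q₁ → Fin d → ℕ) (f : Fin q₂ → Fin d → ℕ) :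
    MvPowerSeries.constantCoeff (F e f) = 1 := by
  change Q e f _ = 1
  simp [Q]

/-- `G_{e,f,k} / F_{e,f}` has constant term `0`, so that it may be substituted in the exponential
series. -/
theorem hasSubst_G_div_F {d q₁ q₂ : ℕ} (e : Fin q₁ → Fin d → ℕ) (f : Fin q₂ → Fin d → ℕ)
    (k : Fin d) : PowerSeries.HasSubst (G e f k * (F e f)⁻¹) := by
  apply PowerSeries.HasSubst.of_constantCoeff_zero
  have h : MvPowerSeries.constantCoeff (G e f k) = 0 := by
    change Q e f _ * _ = 0
    simp
  rw [map_mul, h, zero_mul]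

/-- The formal power series `g` with rational coefficients lies in `z_k ℤ[[z]]`. -/
def MemXMulInt {d : ℕ} (k : Fin d) (g : MvPowerSeries (Fin d) ℚ) : Prop :=
  ∃ u : MvPowerSeries (Fin d) ℤ,
    g = MvPowerSeries.X k * MvPowerSeries.map (Int.castRingHom ℚ) u

/-- The formal power series `g` with rational coefficients lies in `z_k ℤ_p[[z]]`. -/
def MemXMulPadicInt {d : ℕ} (p : ℕ) [Fact p.Prime] (k : Fin d)
    (g : MvPowerSeries (Fin d) ℚ) : Prop :=
  ∃ u : MvPowerSeries (Fin d) ℤ_[p],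
    MvPowerSeries.map (algebraMap ℚ ℚ_[p]) g =
      MvPowerSeries.X k * MvPowerSeries.map (algebraMap ℤ_[p] ℚ_[p]) u

/-- The maps given by the `d`-tuples `a` and `b` of formal power series in `d` variables without
constant terms are compositional inverses of each other: `a(b(z)) = z` and `b(a(z)) = z`. -/
structure IsCompInverse {d : ℕ} (a b : Fin d → MvPowerSeries (Fin d) ℚ) : Prop where
  constantCoeff_left : ∀ k, MvPowerSeries.constantCoeff (a k) = 0
  constantCoeff_right : ∀ k, MvPowerSeries.constantCoeff (b k) = 0
  left_comp_right : ∀ k, (a k).subst b = MvPowerSeries.X k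
  right_comp_left : ∀ k, (b k).subst a = MvPowerSeries.X k

/-- A compositional inverse is unique. -/
theorem IsCompInverse.unique {d : ℕ} {a b c : Fin d → MvPowerSeries (Fin d) ℚ}
    (hb : IsCompInverse a b) (hc : IsCompInverse a c) : b = c := by
  have ha := MvPowerSeries.hasSubst_of_constantCoeff_zero hb.constantCoeff_left
  have hc' := MvPowerSeries.hasSubst_of_constantCoeff_zero hc.constantCoeff_right
  have hX : (fun s => (a s).subst c) = (MvPowerSeries.X : Fin d → MvPowerSeries (Fin d) ℚ) :=
    funext hc.left_comp_right
  funext k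
  have h := MvPowerSeries.subst_comp_subst_apply (R := ℚ) ha hc' (b k)
  rw [hb.right_comp_left, MvPowerSeries.subst_X hc', hX, MvPowerSeries.subst_self] at h
  exact h.symm

end FactorialRatio

end

open FactorialRatio

/-!
The family of all linear forms `cᵢ`, with signs `εᵢ = 1` in the numerator and `εᵢ = -1` in the
denominator, satisfies `∑ᵢ εᵢ cᵢ = 0`. Write `Q(n) = ∏ᵢ (cᵢ · n)! ^ εᵢ`, let `Δ` be the Landau
function and put `h_k = G_k / F`, so that the canonical coordinates are `z_k exp(h_k)`.

**Integrality of `Q`.** By Legendre's formula (`padicValRat_ratio`), the `p`-adic valuation of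
`Q(n)` is `∑_{l ≥ 1} Δ(n / p ^ l)`, and `Δ` is periodic on rational points. Conversely, `Δ(x)` is
the valuation of `Q(n)` when `n / p` is just above `x` and `p` is large, since `Δ` is
right-continuous.

**Integrality of the canonical coordinates.** By the Dieudonné–Dwork criterion
(`padicDvd_coeff_mvExp`), `exp(± h_k)` has `p`-integral coefficients once `p h_k(z) - h_k(zᵖ)` is
divisible by `p`. The identity `∑ₙ Q(n) (H(n) - h(z)) zⁿ = 0`, with `H(n) = ∑ᵢ εᵢ cᵢ⁽ᵏ⁾ H_{cᵢ · n}`,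
fails when the sum is restricted to the `n` in a residue class modulo `p ^ s`; the coefficients of
the failure are the defects. A single strong induction on the exponent
(`padicDvd_defect_and_dworkDefect`) gives the divisibility by `p` of the coefficients of
`p h(z) - h(zᵖ)` together with the divisibility of the defect on the class of `U` by
`p ^ (1 - s + ∑_{l < s} Δ(U / p ^ l))`. In the inductive step, `p` times a defect at `m` is
compared, by replacing `p h(z)` with `h(zᵖ)` and `p H(n)` with `H(⌊n / p⌋)`, to a defect at
`⌊m / p⌋` with coefficients `Q(a + p K)`, `a` being the residue of `m`. The quotient
`Q(a + p K) / Q(K)` is approximated by functions of `K` modulo `p ^ t`, exactly so for large `t`,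
and the telescoped differences of these approximations are small enough for the induction hypothesis
to apply (`padicDvd_defect_onClass_comp`). The hypothesis `Δ ≥ 1` on `D` is what controls the
differences: where no linear form reaches `1` at the fractional part of `n / p ^ (r + 1)`, the
factors `(cᵢ · n)! / (cᵢ · ⌊n / p⌋)!` are well approximated, and elsewhere `Q(n)` gains a factor `p`
at each level.

**Failure of integrality.** If `Δ(x) = 0` and some linear form is at least `1` at `x`, then
`r_k = ∑ᵢ εᵢ cᵢ⁽ᵏ⁾ H_{⌊cᵢ · x⌋}` is nonzero for some `k`: one has
`a H_{⌊a⌋} - ⌊a⌋ = ∫₁^A ⌊a / s⌋ ds` for `a ≤ A`, hence `∑_k r_k x_k = ∫₁^A Δ(x / s) ds` with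
`A = max (cᵢ · x)`, and the integral is positive after a small perturbation of `x`
(`exists_harmonicOf_ne_zero`). For large `p` and `n` below `p` in all coordinates, the coefficient
of `zⁿ` in `G_k` is `Q(n) r_k / p` up to a `p`-integral number, where `r_k` is taken at `x = n / p`.
Choosing first the integer parts `⌊cᵢ · n / p⌋`, then `n`, minimal with `Δ(n / p) = 0` and some
`r_k ≠ 0` gives a coefficient of `G_k` that is not `p`-integral while all those of lower order are,
in `G_j` for all `j`; this passes to `h_k` and to `exp(± h_k)`.

**Mirror maps.** The compositional inverse of `(z_k exp(h_k))_k` is `(z_k v_k)_k`, where `v` is the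
solution of the fixed point equation `v_k(z) = exp(-h_k)(z₁ v₁, …, z_d v_d)`
(`exists_isCompInverse`). The coefficients of `zⁿ` in `v_k` and `exp(-h_k)` agree up to the ring
generated by those of lower order (`coeff_sub_coeff_mem`), so both dichotomies carry over.
-/

namespace FactorialRatio

/-! ### Composition with the exponential series -/

open MvPowerSeries in
theorem coeff_pow_eq_zero_of_degree_lt {σ R : Type*} [CommSemiring R] {h : MvPowerSeries σ R}
    (h0 : constantCoeff h = 0) {n : σ →₀ ℕ} {j : ℕ} (hj : n.degree < j) :
    coeff n (h ^ j) = 0 := by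
  apply coeff_of_lt_order
  calc ((n.degree : ℕ) : ℕ∞) < j := by exact_mod_cast hj
    _ = j • (1 : ℕ∞) := by simp
    _ ≤ j • h.order := by
        gcongr
        exact one_le_order_iff_constCoeff_eq_zero.mpr h0
    _ ≤ _ := le_order_pow j

open MvPowerSeries in
/-- Only finitely many powers of `h` contribute to a given coefficient of `f(h)`. -/
theorem coeff_subst_eq_coeff_sum {σ R : Type*} [CommRing R] (f : PowerSeries R)
    {h : MvPowerSeries σ R} (h0 : constantCoeff h = 0) {n : σ →₀ ℕ} {N : ℕ} (hN : n.degree < N) :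
    coeff n (f.subst h) = coeff n (∑ j ∈ Finset.range N, C (PowerSeries.coeff j f) * h ^ j) := by
  rw [PowerSeries.coeff_subst (PowerSeries.HasSubst.of_constantCoeff_zero h0),
    finsum_eq_sum_of_support_subset (s := Finset.range N), map_sum]
  · simp
  · intro j hj
    by_contra hj'
    simp only [Finset.coe_range, Set.mem_Iio, not_lt] at hj'
    simp [coeff_pow_eq_zero_of_degree_lt h0 (hN.trans_le hj')] at hj

open MvPowerSeries in
theorem coeff_mul_eq_sum_Iic {σ R : Type*} [DecidableEq σ] [CommSemiring R]
    (a b : MvPowerSeries σ R) (n : σ →₀ ℕ) :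
    coeff n (a * b) = ∑ m ∈ Finset.Iic n, coeff m a * coeff (n - m) b := by
  rw [coeff_mul]
  refine Finset.sum_bij' (fun x _ => x.1) (fun m _ => (m, n - m)) ?_ ?_ ?_ ?_ ?_
  · intro x hx
    rw [← Finset.HasAntidiagonal.mem_antidiagonal.mp hx]
    simp
  · intro m hm
    simpa [Finset.HasAntidiagonal.mem_antidiagonal] using
      add_tsub_cancel_of_le (Finset.mem_Iic.mp hm)
  · intro x hx
    rw [← Finset.HasAntidiagonal.mem_antidiagonal.mp hx]
    simp
  · simp
  · intro x hx
    rw [← Finset.HasAntidiagonal.mem_antidiagonal.mp hx]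
    simp

open MvPowerSeries in
theorem coeff_mul_congr {σ R : Type*} [CommSemiring R] {a a' : MvPowerSeries σ R}
    (b : MvPowerSeries σ R) {n : σ →₀ ℕ} (h : ∀ m ≤ n, coeff m a = coeff m a') :
    coeff n (a * b) = coeff n (a' * b) := by
  classical
  rw [coeff_mul_eq_sum_Iic, coeff_mul_eq_sum_Iic]
  exact Finset.sum_congr rfl fun m hm => by rw [h m (Finset.mem_Iic.mp hm)]

open MvPowerSeries in
/-- Chain rule for the partial derivatives of `f(h)`. -/
theorem pderiv_powerSeries_subst {σ R : Type*} [CommRing R] (f : PowerSeries R)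
    {h : MvPowerSeries σ R} (h0 : constantCoeff h = 0) (i : σ) :
    pderiv R i (f.subst h) = (PowerSeries.derivative R f).subst h * pderiv R i h := by
  ext n
  have hd : (n + Finsupp.single i 1).degree < n.degree + 2 := by
    rw [map_add]; simp
  rw [coeff_pderiv, coeff_subst_eq_coeff_sum f h0 hd, ← coeff_pderiv,
    coeff_mul_congr (a' := ∑ j ∈ Finset.range (n.degree + 1),
      C (PowerSeries.coeff j (PowerSeries.derivative R f)) * h ^ j)]
  · rw [map_sum, Finset.sum_range_succ', Finset.sum_mul]
    simp only [pow_zero, mul_one, pderiv_C, add_zero]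
    congr 1
    refine Finset.sum_congr rfl fun j _ => ?_
    rw [Derivation.leibniz, pderiv_C, smul_zero, add_zero, pderiv_pow, PowerSeries.coeff_derivative]
    simp
    ring
  · intro m hm
    exact coeff_subst_eq_coeff_sum _ h0 (Nat.lt_succ_of_le (Finsupp.degree_mono hm))

/-- `exp(h)` for a power series `h` with rational coefficients. -/
noncomputable abbrev mvExp {σ : Type*} (h : MvPowerSeries σ ℚ) : MvPowerSeries σ ℚ :=
  (PowerSeries.exp ℚ).subst h

section Exp

open MvPowerSeries

variable {σ : Type*}

theorem pderiv_mvExp {h : MvPowerSeries σ ℚ} (h0 : constantCoeff h = 0) (i : σ) :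
    pderiv ℚ i (mvExp h) = mvExp h * pderiv ℚ i h := by
  rw [pderiv_powerSeries_subst _ h0, PowerSeries.derivative_exp]

theorem constantCoeff_mvExp {h : MvPowerSeries σ ℚ} (h0 : constantCoeff h = 0) :
    constantCoeff (mvExp h) = 1 := by
  rw [← coeff_zero_eq_constantCoeff_apply, coeff_subst_eq_coeff_sum _ h0 (N := 1) (by simp)]
  simp

/-- A power series `E` with `E(0) = 1` and `∂ᵢE = E ∂ᵢh` for all `i` is `exp(h)`. -/
theorem eq_mvExp {E h : MvPowerSeries σ ℚ} (h0 : constantCoeff h = 0)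
    (hE : constantCoeff E = 1) (hd : ∀ i, pderiv ℚ i E = E * pderiv ℚ i h) : E = mvExp h := by
  have hE' : constantCoeff (mvExp h) ≠ 0 := by rw [constantCoeff_mvExp h0]; exact one_ne_zero
  have key : E * (mvExp h)⁻¹ = 1 := by
    apply pderiv.ext
    · intro i
      rw [Derivation.leibniz, pderiv_inv', pderiv_mvExp h0, hd, pderiv_one]
      simp only [smul_eq_mul]
      linear_combination (-(E * pderiv ℚ i h * (mvExp h)⁻¹)) * MvPowerSeries.mul_inv_cancel _ hE'
    · rw [map_mul, hE, MvPowerSeries.constantCoeff_inv, constantCoeff_mvExp h0]; simp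
  calc E = E * (mvExp h * (mvExp h)⁻¹) := by rw [MvPowerSeries.mul_inv_cancel _ hE', mul_one]
    _ = mvExp h * (E * (mvExp h)⁻¹) := by ring
    _ = mvExp h := by rw [key, mul_one]

theorem mvExp_add {g h : MvPowerSeries σ ℚ} (g0 : constantCoeff g = 0)
    (h0 : constantCoeff h = 0) : mvExp (g + h) = mvExp g * mvExp h := by
  symm
  apply eq_mvExp
  · rw [map_add, g0, h0, add_zero]
  · rw [map_mul, constantCoeff_mvExp g0, constantCoeff_mvExp h0, one_mul]
  · intro i
    rw [Derivation.leibniz, pderiv_mvExp g0, pderiv_mvExp h0, map_add]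
    simp only [smul_eq_mul]
    ring

theorem mvExp_zero : mvExp (0 : MvPowerSeries σ ℚ) = 1 := by
  symm
  apply eq_mvExp <;> simp

theorem mvExp_mul_mvExp_neg {h : MvPowerSeries σ ℚ} (h0 : constantCoeff h = 0) :
    mvExp h * mvExp (-h) = 1 := by
  rw [← mvExp_add h0 (by rw [map_neg, h0, neg_zero]), add_neg_cancel, mvExp_zero]

theorem mvExp_nsmul {h : MvPowerSeries σ ℚ} (h0 : constantCoeff h = 0) (n : ℕ) :
    mvExp (n • h) = mvExp h ^ n := by
  induction n with
  | zero => rw [zero_smul, mvExp_zero, pow_zero]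
  | succ n ih =>
    have h1 : constantCoeff (n • h) = 0 := by rw [map_nsmul, h0, smul_zero]
    rw [succ_nsmul, mvExp_add h1 h0, ih, pow_succ]

theorem expand_mvExp [Finite σ] {p : ℕ} (hp : p ≠ 0) {h : MvPowerSeries σ ℚ}
    (h0 : constantCoeff h = 0) :
    expand p hp (mvExp h) = mvExp (expand p hp h) := by
  have h1 : constantCoeff (expand p hp h) = 0 := by rw [constantCoeff_expand, h0]
  have hs := PowerSeries.HasSubst.of_constantCoeff_zero h0
  unfold mvExp PowerSeries.subst
  rw [expand_subst]
  exact hs.const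

/-- Compare coefficients of `zⁿ` in `zᵢ ∂ᵢ exp(h) = exp(h) zᵢ ∂ᵢh`. -/
theorem natCast_mul_coeff_mvExp [DecidableEq σ] {h : MvPowerSeries σ ℚ} (h0 : constantCoeff h = 0)
    (n : σ →₀ ℕ) (i : σ) :
    (n i : ℚ) * coeff n (mvExp h) =
      ∑ m ∈ Finset.Iic n, coeff m (mvExp h) * (((n - m) i : ℕ) * coeff (n - m) h) := by
  have key : ∀ (f : MvPowerSeries σ ℚ) (m : σ →₀ ℕ),
      coeff m (X i * pderiv ℚ i f) = (m i : ℚ) * coeff m f := by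
    intro f m
    rw [mul_comm, X_def, coeff_mul_monomial, mul_one]
    split_ifs with hm
    · rw [coeff_pderiv, tsub_add_cancel_of_le hm]
      have : 1 ≤ m i := by simpa using hm i
      simp [Nat.cast_sub this]
      ring
    · have : m i = 0 := by
        by_contra h'
        exact hm (by simpa using Nat.one_le_iff_ne_zero.mpr h')
      simp [this]
  rw [← key, pderiv_mvExp h0, mul_left_comm, coeff_mul_eq_sum_Iic]
  simp_rw [key]

end Exp

/-! ### Integrality at a prime and the Dieudonné–Dwork criterion -/

/-- `PadicDvd p k x` says that the rational number `x` lies in `p ^ k ℤ_(p)`, where `k` may be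
negative. -/
def PadicDvd (p : ℕ) (k : ℤ) (x : ℚ) : Prop :=
  padicNorm p x ≤ (p : ℚ) ^ (-k)

namespace PadicDvd

variable {p : ℕ} {k l : ℤ} {x y : ℚ}

theorem zero : PadicDvd p k 0 := by
  rw [PadicDvd, padicNorm.zero]
  positivity

theorem neg (hx : PadicDvd p k x) : PadicDvd p k (-x) := by
  rwa [PadicDvd, padicNorm.neg]

variable [hp : Fact p.Prime]

theorem add (hx : PadicDvd p k x) (hy : PadicDvd p k y) : PadicDvd p k (x + y) :=
  padicNorm.nonarchimedean.trans (max_le hx hy)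

theorem sub (hx : PadicDvd p k x) (hy : PadicDvd p k y) : PadicDvd p k (x - y) := by
  rw [sub_eq_add_neg]
  exact hx.add hy.neg

theorem mul (hx : PadicDvd p k x) (hy : PadicDvd p l y) : PadicDvd p (k + l) (x * y) := by
  have h0 : (p : ℚ) ≠ 0 := by exact_mod_cast hp.out.ne_zero
  rw [PadicDvd, padicNorm.mul, neg_add, zpow_add₀ h0]
  exact mul_le_mul hx hy (padicNorm.nonneg _) (by positivity)

theorem mono (hx : PadicDvd p k x) (h : l ≤ k) : PadicDvd p l x := by
  have h1 : (1 : ℚ) ≤ p := by exact_mod_cast hp.out.one_lt.le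
  exact hx.trans (zpow_le_zpow_right₀ h1 (by omega))

theorem sum {α : Type*} {s : Finset α} {f : α → ℚ} (h : ∀ a ∈ s, PadicDvd p k (f a)) :
    PadicDvd p k (∑ a ∈ s, f a) :=
  Finset.sum_induction _ _ (fun _ _ => add) zero h

theorem intCast (z : ℤ) : PadicDvd p 0 z := by
  simpa [PadicDvd] using padicNorm.of_int z

theorem natCast (n : ℕ) : PadicDvd p 0 n := by
  simpa [PadicDvd] using padicNorm.of_nat n

theorem one : PadicDvd p 0 1 := by
  simpa using natCast (p := p) 1

theorem mul_left (hx : PadicDvd p 0 x) (hy : PadicDvd p k y) : PadicDvd p k (x * y) := by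
  simpa using hx.mul hy

theorem iff_le_padicValRat (hx : x ≠ 0) : PadicDvd p k x ↔ k ≤ padicValRat p x := by
  have h1 : (1 : ℚ) < p := by exact_mod_cast hp.out.one_lt
  rw [PadicDvd, padicNorm.eq_zpow_of_nonzero hx, zpow_le_zpow_iff_right₀ h1]
  omega

theorem prime : PadicDvd p 1 p := by
  have h0 : (p : ℚ) ≠ 0 := by exact_mod_cast hp.out.ne_zero
  rw [iff_le_padicValRat h0, padicValRat.self hp.out.one_lt]

theorem prime_mul (hx : PadicDvd p k x) : PadicDvd p (k + 1) (p * x) := by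
  rw [add_comm]
  exact prime.mul hx

theorem of_prime_mul (hx : PadicDvd p (k + 1) (p * x)) : PadicDvd p k x := by
  have h0 : (p : ℚ) ≠ 0 := by exact_mod_cast hp.out.ne_zero
  by_cases h : x = 0
  · rw [h]; exact zero
  rw [iff_le_padicValRat (mul_ne_zero h0 h), padicValRat.mul h0 h,
    padicValRat.self hp.out.one_lt] at hx
  rw [iff_le_padicValRat h]
  omega

theorem iff_norm_cast_le : PadicDvd p k x ↔ ‖(x : ℚ_[p])‖ ≤ (p : ℝ) ^ (-k) := by
  rw [PadicDvd, Padic.eq_padicNorm, ← Rat.cast_le (K := ℝ)]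
  simp

/-- An integer prime to `p` is invertible in `ℤ_(p)`. -/
theorem of_natCast_mul {n : ℕ} (hn : ¬ p ∣ n) (h : PadicDvd p k (n * x)) : PadicDvd p k x := by
  rwa [PadicDvd, padicNorm.mul, (padicNorm.nat_eq_one_iff n).mpr hn, one_mul] at h

end PadicDvd

/-- The ring `ℤ_(p)` of rational numbers whose denominator is prime to `p`. -/
def padicIntegral (p : ℕ) [Fact p.Prime] : Subring ℚ where
  carrier := {x | PadicDvd p 0 x}
  mul_mem' := PadicDvd.mul_left
  one_mem' := PadicDvd.one
  add_mem' := PadicDvd.add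
  zero_mem' := PadicDvd.zero
  neg_mem' := PadicDvd.neg

theorem mem_padicIntegral {p : ℕ} [Fact p.Prime] {x : ℚ} :
    x ∈ padicIntegral p ↔ PadicDvd p 0 x := Iff.rfl

/-- A rational number that is `p`-integral for all primes `p` is an integer. -/
theorem exists_int_eq_of_forall_padicDvd {x : ℚ}
    (h : ∀ (p : ℕ) [Fact p.Prime], PadicDvd p 0 x) : ∃ z : ℤ, x = z := by
  have hden : x.den = 1 := by
    by_contra hne
    obtain ⟨q, hq, hqd⟩ := Nat.exists_prime_and_dvd hne
    have : Fact q.Prime := ⟨hq⟩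
    have h1 := PadicDvd.natCast (p := q) x.den
    have h2 : padicNorm q x.num = 1 := by
      rw [padicNorm.int_eq_one_iff]
      intro h3
      have h4 : q ∣ x.num.natAbs := Int.natCast_dvd.mp h3
      exact hq.one_lt.ne' (Nat.dvd_one.mp (x.reduced ▸ Nat.dvd_gcd h4 hqd))
    have h3 : padicNorm q x.den < 1 := (padicNorm.nat_lt_one_iff _).mpr hqd
    have h4 : x * x.den = x.num := Rat.mul_den_eq_num x
    have h5 : padicNorm q x * padicNorm q x.den = 1 := by rw [← padicNorm.mul, h4, h2]
    have h6 : padicNorm q x ≤ 1 := by simpa [PadicDvd] using h q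
    have h7 := padicNorm.nonneg (p := q) (x.den : ℚ)
    nlinarith
  exact ⟨x.num, by rw [← Rat.mul_den_eq_num x, hden]; simp⟩

/-- Coefficients in a subring are stable under products, monomial by monomial. -/
theorem coeff_mul_mem {σ R : Type*} [CommRing R] (A : Subring R) {a b : MvPowerSeries σ R}
    {n : σ →₀ ℕ} (ha : ∀ m ≤ n, MvPowerSeries.coeff m a ∈ A)
    (hb : ∀ m ≤ n, MvPowerSeries.coeff m b ∈ A) : MvPowerSeries.coeff n (a * b) ∈ A := by
  classical
  rw [coeff_mul_eq_sum_Iic]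
  exact A.sum_mem fun m hm =>
    A.mul_mem (ha _ (Finset.mem_Iic.mp hm)) (hb _ tsub_le_self)

theorem coeff_one_mem {σ R : Type*} [CommRing R] (A : Subring R) (n : σ →₀ ℕ) :
    MvPowerSeries.coeff n (1 : MvPowerSeries σ R) ∈ A := by
  classical
  rw [MvPowerSeries.coeff_one]
  split_ifs
  exacts [A.one_mem, A.zero_mem]

theorem coeff_pow_mem {σ R : Type*} [CommRing R] (A : Subring R) {a : MvPowerSeries σ R}
    {n : σ →₀ ℕ} (ha : ∀ m ≤ n, MvPowerSeries.coeff m a ∈ A) (j : ℕ) :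
    ∀ m ≤ n, MvPowerSeries.coeff m (a ^ j) ∈ A := by
  induction j with
  | zero => intro m _; rw [pow_zero]; exact coeff_one_mem A m
  | succ j ih =>
    intro m hm
    rw [pow_succ]
    exact coeff_mul_mem A (fun l hl => ih l (hl.trans hm)) (fun l hl => ha l (hl.trans hm))

/-- For a power series `f` with `p`-integral coefficients, `f(z) ^ p ≡ f(zᵖ)` modulo `p`. -/
theorem padicDvd_coeff_pow_sub_expand {σ : Type*} [Finite σ] {p : ℕ} [hp : Fact p.Prime]
    {f : MvPowerSeries σ ℚ} (hf : ∀ n, PadicDvd p 0 (MvPowerSeries.coeff n f)) (n : σ →₀ ℕ) :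
    PadicDvd p 1 (MvPowerSeries.coeff n (f ^ p - MvPowerSeries.expand p hp.out.ne_zero f)) := by
  let f' : MvPowerSeries σ ℤ_[p] := fun n =>
    ⟨((MvPowerSeries.coeff n f : ℚ) : ℚ_[p]), by simpa [PadicDvd.iff_norm_cast_le] using hf n⟩
  have hmap : f.map (algebraMap ℚ ℚ_[p]) = f'.map (PadicInt.Coe.ringHom (p := p)) := by
    ext m
    rw [MvPowerSeries.coeff_map, MvPowerSeries.coeff_map]
    rfl
  have hker : MvPowerSeries.coeff n (f' ^ p - MvPowerSeries.expand p hp.out.ne_zero f') ∈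
      RingHom.ker (PadicInt.toZMod (p := p)) := by
    rw [RingHom.mem_ker, ← MvPowerSeries.coeff_map, map_sub, map_pow, MvPowerSeries.map_expand,
      ← MvPowerSeries.map_frobenius_expand (p := p) (hp := hp.out.ne_zero)
        (f := MvPowerSeries.map PadicInt.toZMod f'), ZMod.frobenius_zmod]
    simp
  rw [PadicInt.ker_toZMod, PadicInt.maximalIdeal_eq_span_p, ← pow_one (p : ℤ_[p]),
    ← PadicInt.norm_le_pow_iff_mem_span_pow] at hker
  rw [PadicDvd.iff_norm_cast_le]
  have hcast : ((MvPowerSeries.coeff n (f ^ p - MvPowerSeries.expand p hp.out.ne_zero f) : ℚ) :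
      ℚ_[p]) = MvPowerSeries.coeff n (f' ^ p - MvPowerSeries.expand p hp.out.ne_zero f') := by
    rw [← eq_ratCast (algebraMap ℚ ℚ_[p]),
      show ∀ x : ℤ_[p], (x : ℚ_[p]) = PadicInt.Coe.ringHom (p := p) x from fun _ => rfl,
      ← MvPowerSeries.coeff_map, ← MvPowerSeries.coeff_map]
    simp only [map_sub (MvPowerSeries.map _), map_pow (MvPowerSeries.map _),
      MvPowerSeries.map_expand, hmap]
  rw [hcast]
  exact_mod_cast hker

/-- `exp(p g)` is congruent to `1` modulo `p` if `g` has `p`-integral coefficients, since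
`p ^ j / j!` is divisible by `p` for `j ≥ 1`. -/
theorem padicDvd_coeff_mvExp_prime_smul_sub_one {σ : Type*} {p : ℕ} [hp : Fact p.Prime]
    {g : MvPowerSeries σ ℚ} (g0 : MvPowerSeries.constantCoeff g = 0)
    (hg : ∀ n, PadicDvd p 0 (MvPowerSeries.coeff n g)) (n : σ →₀ ℕ) :
    PadicDvd p 1 (MvPowerSeries.coeff n (mvExp (p • g) - 1)) := by
  have g0' : MvPowerSeries.constantCoeff (p • g) = 0 := by rw [map_nsmul, g0, smul_zero]
  rw [map_sub, mvExp, coeff_subst_eq_coeff_sum _ g0' (Nat.lt_succ_self _), Finset.sum_range_succ',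
    map_add]
  simp only [pow_zero, mul_one, PowerSeries.coeff_exp, Nat.factorial_zero, Nat.cast_one, div_one,
    map_one, add_sub_cancel_right, map_sum, eq_ratCast, Rat.cast_id]
  refine PadicDvd.sum fun j _ => ?_
  have h1 : MvPowerSeries.coeff n (MvPowerSeries.C (1 / ((j + 1).factorial : ℚ)) *
      (p • g) ^ (j + 1)) =
      ((p : ℚ) ^ (j + 1) / (j + 1).factorial) * MvPowerSeries.coeff n (g ^ (j + 1)) := by
    rw [MvPowerSeries.coeff_C_mul, smul_pow, ← Nat.cast_smul_eq_nsmul ℚ, map_smul]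
    simp
    ring
  rw [h1]
  have h2 : PadicDvd p 1 ((p : ℚ) ^ (j + 1) / (j + 1).factorial) := by
    have h0 : (p : ℚ) ≠ 0 := by exact_mod_cast hp.out.ne_zero
    have h3 : ((j + 1).factorial : ℚ) ≠ 0 := by exact_mod_cast Nat.factorial_ne_zero _
    rw [PadicDvd.iff_le_padicValRat (div_ne_zero (pow_ne_zero _ h0) h3),
      padicValRat.div (pow_ne_zero _ h0) h3, padicValRat.pow, padicValRat.self hp.out.one_lt,
      padicValRat.of_nat]
    have := padicValNat_factorial_lt_of_ne_zero (p := p) (n := j + 1) (by omega)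
    generalize padicValNat p (j + 1).factorial = v at *
    push_cast
    omega
  rw [mul_comm]
  exact PadicDvd.mul_left (coeff_pow_mem (padicIntegral p) (fun m _ => hg m) _ n le_rfl) h2

/-- The Dieudonné–Dwork criterion: `exp(h)` has `p`-integral coefficients as soon as
`p h(z) - h(zᵖ)` has coefficients in `p ℤ_(p)`. -/
theorem padicDvd_coeff_mvExp {σ : Type*} [Finite σ] {p : ℕ} [hp : Fact p.Prime]
    {h : MvPowerSeries σ ℚ} (h0 : MvPowerSeries.constantCoeff h = 0)
    (hh : ∀ n, PadicDvd p 1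
      (MvPowerSeries.coeff n (p • h - MvPowerSeries.expand p hp.out.ne_zero h)))
    (n : σ →₀ ℕ) : PadicDvd p 0 (MvPowerSeries.coeff n (mvExp h)) := by
  classical
  have hpQ : (p : ℚ) ≠ 0 := by exact_mod_cast hp.out.ne_zero
  set φ := MvPowerSeries.expand (σ := σ) (R := ℚ) p hp.out.ne_zero with hφ
  set E := mvExp h with hE
  let g : MvPowerSeries σ ℚ := (p : ℚ)⁻¹ • (p • h - φ h)
  have hpg : p • g = p • h - φ h := by
    rw [← Nat.cast_smul_eq_nsmul ℚ, smul_inv_smul₀ hpQ]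
  have hφ0 : MvPowerSeries.constantCoeff (φ h) = 0 := by
    rw [hφ, MvPowerSeries.constantCoeff_expand, h0]
  have g0 : MvPowerSeries.constantCoeff g = 0 := by
    rw [← MvPowerSeries.coeff_zero_eq_constantCoeff_apply, map_smul,
      MvPowerSeries.coeff_zero_eq_constantCoeff_apply, map_sub, map_nsmul, h0, hφ0]
    simp
  have hg : ∀ n, PadicDvd p 0 (MvPowerSeries.coeff n g) := fun n =>
    PadicDvd.of_prime_mul (by
      have := hh n
      rw [← hpg, map_nsmul, nsmul_eq_mul] at this
      simpa using this)
  have hpow : E ^ p = φ E * mvExp (p • g) := by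
    rw [hE, ← mvExp_nsmul h0, hφ, expand_mvExp _ h0, ← hφ, ← mvExp_add hφ0, hpg, add_sub_cancel]
    rw [map_nsmul, g0, smul_zero]
  set Y := mvExp (p • g) - 1 with hY
  have hYc := padicDvd_coeff_mvExp_prime_smul_sub_one g0 hg
  -- Strong induction on the exponent; the coefficient of `z ^ n` in `E ^ p` is isolated by
  -- splitting off the monomial `E(n) z ^ n`.
  induction n using WellFoundedLT.induction with
  | _ n ih =>
  by_cases hn0 : n = 0
  · rw [hn0, MvPowerSeries.coeff_zero_eq_constantCoeff_apply, constantCoeff_mvExp h0]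
    exact PadicDvd.one
  let T : MvPowerSeries σ ℚ := fun m => if m < n then MvPowerSeries.coeff m E else 0
  have hTc : ∀ m, MvPowerSeries.coeff m T = if m < n then MvPowerSeries.coeff m E else 0 :=
    fun m => rfl
  have hT : ∀ m, PadicDvd p 0 (MvPowerSeries.coeff m T) := by
    intro m
    rw [hTc]
    split_ifs with hm
    exacts [ih m hm, PadicDvd.zero]
  have hET : ∀ j : ℕ, ∀ m < n, MvPowerSeries.coeff m (E ^ j) = MvPowerSeries.coeff m (T ^ j) := by
    intro j
    induction j with
    | zero => intro m _; rw [pow_zero, pow_zero]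
    | succ j ihj =>
      intro m hm
      rw [pow_succ, pow_succ, coeff_mul_eq_sum_Iic, coeff_mul_eq_sum_Iic]
      refine Finset.sum_congr rfl fun l hl => ?_
      rw [ihj l (lt_of_le_of_lt (Finset.mem_Iic.mp hl) hm), hTc,
        if_pos (lt_of_le_of_lt tsub_le_self hm)]
  have hE0 : MvPowerSeries.coeff 0 E = 1 := constantCoeff_mvExp h0
  have hE0' : ∀ j : ℕ, MvPowerSeries.coeff 0 (E ^ j) = 1 := fun j => by
    rw [MvPowerSeries.coeff_zero_eq_constantCoeff_apply, map_pow,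
      ← MvPowerSeries.coeff_zero_eq_constantCoeff_apply, hE0, one_pow]
  have hpos : 0 < n := pos_iff_ne_zero.mpr hn0
  have hEn : ∀ j : ℕ, MvPowerSeries.coeff n (E ^ j) =
      MvPowerSeries.coeff n (T ^ j) + j * MvPowerSeries.coeff n E := by
    intro j
    induction j with
    | zero => simp
    | succ j ihj =>
      have h1 : MvPowerSeries.coeff n (E ^ (j + 1)) - MvPowerSeries.coeff n (T ^ (j + 1)) =
          ∑ m ∈ Finset.Iic n, (if m = 0 then MvPowerSeries.coeff n E else if m = n then
            j * MvPowerSeries.coeff n E else 0) := by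
        rw [pow_succ, pow_succ, coeff_mul_eq_sum_Iic, coeff_mul_eq_sum_Iic,
          ← Finset.sum_sub_distrib]
        refine Finset.sum_congr rfl fun m hm => ?_
        split_ifs with hm0 hmn
        · subst hm0
          rw [← hET j 0 hpos, hE0', tsub_zero, hTc n, if_neg (lt_irrefl _)]
          ring
        · subst hmn
          rw [ihj, tsub_self, hTc 0, if_pos hpos, hE0]
          ring
        · have hmn' : m < n := lt_of_le_of_ne (Finset.mem_Iic.mp hm) hmn
          have : n - m < n := by
            refine lt_of_le_of_ne tsub_le_self fun h' => hm0 ?_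
            have := tsub_add_cancel_of_le hmn'.le
            rw [h'] at this
            simpa using this
          rw [hET j m hmn', hTc (n - m), if_pos this, sub_self]
      rw [Finset.sum_eq_add (0 : σ →₀ ℕ) n hpos.ne (by
        intro m _ hm
        rw [if_neg hm.1, if_neg hm.2]) (by simp) (by simp)] at h1
      rw [if_pos rfl, if_neg hn0, if_pos rfl] at h1
      push_cast
      linarith
  have hφET : MvPowerSeries.coeff n (φ E) = MvPowerSeries.coeff n (φ T) := by
    by_cases hdvd : ∀ i, p ∣ n i
    · choose m hm using hdvd
      have := Fintype.ofFinite σ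
      have hnm : n = p • Finsupp.equivFunOnFinite.symm m := by
        ext i
        simp [hm]
      set m' := Finsupp.equivFunOnFinite.symm m
      have hm0 : m' ≠ 0 := by
        intro h'
        rw [h', smul_zero] at hnm
        exact hn0 hnm
      have hlt : m' < n := by
        have h1 : m' ≤ n := by
          rw [hnm]
          exact le_self_nsmul (zero_le) hp.out.ne_zero
        refine lt_of_le_of_ne h1 fun h' => hm0 ?_
        ext i
        have h2 := DFunLike.congr_fun hnm i
        rw [← h'] at h2
        simp only [Finsupp.smul_apply, smul_eq_mul] at h2
        have := hp.out.two_le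
        simp only [Finsupp.coe_zero, Pi.zero_apply]
        nlinarith
      rw [hnm, hφ, MvPowerSeries.coeff_expand_smul, MvPowerSeries.coeff_expand_smul, hTc,
        if_pos (hnm ▸ hlt)]
    · push Not at hdvd
      obtain ⟨i, hi⟩ := hdvd
      rw [hφ, MvPowerSeries.coeff_expand_of_not_dvd p _ _ hi,
        MvPowerSeries.coeff_expand_of_not_dvd p _ _ hi]
  have hφY : PadicDvd p 1 (MvPowerSeries.coeff n (φ E * Y)) := by
    rw [coeff_mul_eq_sum_Iic]
    refine PadicDvd.sum fun m hm => ?_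
    by_cases hmn : m = n
    · rw [hmn, tsub_self, MvPowerSeries.coeff_zero_eq_constantCoeff_apply, hY, map_sub,
        constantCoeff_mvExp (by rw [map_nsmul, g0, smul_zero]), map_one, sub_self, mul_zero]
      exact PadicDvd.zero
    · refine PadicDvd.mul_left ?_ (hYc _)
      have hmn' : m < n := lt_of_le_of_ne (Finset.mem_Iic.mp hm) hmn
      by_cases hdvd : ∀ i, p ∣ m i
      · choose l hl using hdvd
        have := Fintype.ofFinite σ
        have hml : m = p • Finsupp.equivFunOnFinite.symm l := by
          ext i
          simp [hl]
        rw [hml, hφ, MvPowerSeries.coeff_expand_smul]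
        refine ih _ (lt_of_le_of_lt ?_ hmn')
        rw [hml]
        exact le_self_nsmul (zero_le) hp.out.ne_zero
      · push Not at hdvd
        obtain ⟨i, hi⟩ := hdvd
        rw [hφ, MvPowerSeries.coeff_expand_of_not_dvd p _ _ hi]
        exact PadicDvd.zero
  have hfrob := padicDvd_coeff_pow_sub_expand hT n
  apply PadicDvd.of_prime_mul
  have key : (p : ℚ) * MvPowerSeries.coeff n E =
      MvPowerSeries.coeff n (φ E * Y) - MvPowerSeries.coeff n (T ^ p - φ T) := by
    have h1 := congrArg (MvPowerSeries.coeff n) hpow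
    have h2 : φ E * mvExp (p • g) = φ E * Y + φ E := by rw [hY]; ring
    rw [h2, map_add, hEn, hφET] at h1
    rw [map_sub]
    linarith
  rw [key, zero_add]
  exact hφY.sub hfrob

/-! ### Ratios of factorials and their valuations -/

/-- Componentwise floor division of a vector of natural numbers by `q`. -/
def vdiv {d : ℕ} (n : Fin d → ℕ) (q : ℕ) : Fin d → ℕ := fun k => n k / q

/-- Componentwise remainder of a vector of natural numbers modulo `q`. -/
def vmod {d : ℕ} (n : Fin d → ℕ) (q : ℕ) : Fin d → ℕ := fun k => n k % q

section Vectors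

variable {d : ℕ}

theorem vmod_add_smul_vdiv (n : Fin d → ℕ) (q : ℕ) : vmod n q + q • vdiv n q = n := by
  funext k
  exact Nat.mod_add_div (n k) q

theorem dotProduct_eq_vmod_add (c n : Fin d → ℕ) (q : ℕ) :
    c ⬝ᵥ n = c ⬝ᵥ vmod n q + q * (c ⬝ᵥ vdiv n q) := by
  conv_lhs => rw [← vmod_add_smul_vdiv n q]
  rw [dotProduct_add, dotProduct_smul, smul_eq_mul]

theorem vmod_vmod_of_dvd (n : Fin d → ℕ) {q r : ℕ} (h : q ∣ r) :
    vmod (vmod n r) q = vmod n q :=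
  funext fun k => Nat.mod_mod_of_dvd (n k) h

theorem vmod_eq_of_dvd {n m : Fin d → ℕ} {q r : ℕ} (h : q ∣ r) (hnm : vmod n r = vmod m r) :
    vmod n q = vmod m q := by
  rw [← vmod_vmod_of_dvd n h, hnm, vmod_vmod_of_dvd m h]

theorem vdiv_vmod_mul (n : Fin d → ℕ) (p q : ℕ) :
    vdiv (vmod n (p * q)) p = vmod (vdiv n p) q :=
  funext fun k => Nat.mod_mul_right_div_self (n k) p q

theorem vmod_vdiv_eq_of_vmod_mul_eq {n m : Fin d → ℕ} {p q : ℕ}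
    (h : vmod n (p * q) = vmod m (p * q)) : vmod (vdiv n p) q = vmod (vdiv m p) q := by
  rw [← vdiv_vmod_mul, h, vdiv_vmod_mul]

theorem vmod_mul_eq_iff {n m : Fin d → ℕ} {p q : ℕ} :
    vmod n (p * q) = vmod m (p * q) ↔
      vmod n p = vmod m p ∧ vmod (vdiv n p) q = vmod (vdiv m p) q := by
  constructor
  · intro h
    exact ⟨vmod_eq_of_dvd (dvd_mul_right p q) h, vmod_vdiv_eq_of_vmod_mul_eq h⟩
  · rintro ⟨h1, h2⟩
    funext k
    have h3 : n k % p = m k % p := congrFun h1 k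
    have h4 : n k / p % q = m k / p % q := congrFun h2 k
    simp only [vmod, Nat.mod_mul, h3, h4]

end Vectors

section Wraps

variable {d : ℕ} {ι : Type*}

/-- The fractional part of `n / q` satisfies `cᵢ · {n / q} ≥ 1` for some `i`. -/
def Wraps (c : ι → Fin d → ℕ) (q : ℕ) (n : Fin d → ℕ) : Prop :=
  ∃ i, q ≤ c i ⬝ᵥ vmod n q

variable {c : ι → Fin d → ℕ}

theorem wraps_congr {q r : ℕ} (hqr : q ∣ r) {n m : Fin d → ℕ} (h : vmod n r = vmod m r) :
    Wraps c q n ↔ Wraps c q m := by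
  unfold Wraps
  rw [vmod_eq_of_dvd hqr h]

/-- Without wrapping at level `r + 1`, no multiple of `p ^ r` lies between `cᵢ · ⌊n / p⌋` and
`cᵢ · n / p`. -/
theorem div_pow_succ_eq_of_not_wraps {p r : ℕ} (hp : 0 < p) {n : Fin d → ℕ}
    (h : ¬ Wraps c (p ^ (r + 1)) n) (i : ι) {l : ℕ} (hl : r ≤ l) :
    c i ⬝ᵥ n / p ^ (l + 1) = c i ⬝ᵥ vdiv n p / p ^ l := by
  have hr : c i ⬝ᵥ n / p ^ (r + 1) = c i ⬝ᵥ vdiv n p / p ^ r := by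
    have h0 : c i ⬝ᵥ vmod n (p ^ (r + 1)) < p ^ (r + 1) := by
      by_contra h'
      exact h ⟨i, not_lt.mp h'⟩
    have h1 : vmod (vdiv n p) (p ^ r) = vdiv (vmod n (p ^ (r + 1))) p := by
      rw [pow_succ', vdiv_vmod_mul]
    have h2 : vdiv (vdiv n p) (p ^ r) = vdiv n (p ^ (r + 1)) := by
      funext k
      simp only [vdiv, Nat.div_div_eq_div_mul, pow_succ']
    have h3 : c i ⬝ᵥ vdiv (vmod n (p ^ (r + 1))) p < p ^ r := by
      have h4 := dotProduct_eq_vmod_add (c i) (vmod n (p ^ (r + 1))) p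
      rw [pow_succ'] at h0
      refine lt_of_mul_lt_mul_left (a := p) ?_ hp.le
      rw [pow_succ'] at h4 ⊢
      omega
    rw [dotProduct_eq_vmod_add (c i) n (p ^ (r + 1)),
      dotProduct_eq_vmod_add (c i) (vdiv n p) (p ^ r), h1, h2,
      Nat.add_mul_div_left _ _ (pow_pos hp _), Nat.add_mul_div_left _ _ (pow_pos hp _),
      Nat.div_eq_of_lt h0, Nat.div_eq_of_lt h3]
  obtain ⟨m, rfl⟩ := Nat.exists_eq_add_of_le hl
  rw [add_right_comm, pow_add p (r + 1) m, pow_add p r m, ← Nat.div_div_eq_div_mul,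
    ← Nat.div_div_eq_div_mul, hr]

theorem wraps_of_pow_dvd {p v : ℕ} (hp : 0 < p) {n : Fin d → ℕ} {i : ι} {x : ℕ}
    (hx : c i ⬝ᵥ vdiv n p < x) (hx' : x ≤ c i ⬝ᵥ n / p) (hv : p ^ v ∣ x) {l : ℕ} (hl : 1 ≤ l)
    (hlv : l ≤ v + 1) : Wraps c (p ^ l) n := by
  by_contra h
  obtain ⟨r, rfl⟩ := Nat.exists_eq_add_of_le' hl
  have h1 := div_pow_succ_eq_of_not_wraps hp h i (show r ≤ v by omega)
  obtain ⟨y, rfl⟩ := hv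
  have h2 : y ≤ c i ⬝ᵥ n / p ^ (v + 1) := by
    rw [pow_succ', ← Nat.div_div_eq_div_mul, Nat.le_div_iff_mul_le (pow_pos hp v), mul_comm]
    exact hx'
  have h3 : c i ⬝ᵥ vdiv n p / p ^ v < y := by
    rw [Nat.div_lt_iff_lt_mul (pow_pos hp v), mul_comm]
    exact hx
  omega

end Wraps

section Ratio

open scoped Nat

variable {d : ℕ} {ι : Type*} [Fintype ι]

/-- The product `∏ᵢ (cᵢ · n)! ^ εᵢ`; the exponents `εᵢ = 1` and `εᵢ = -1` give the ratios of
factorials. -/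
def ratio (c : ι → Fin d → ℕ) (ε : ι → ℤ) (n : Fin d → ℕ) : ℚ :=
  ∏ i, ((c i ⬝ᵥ n)! : ℚ) ^ ε i

/-- The value `∑ᵢ εᵢ ⌊cᵢ · n / q⌋` of the Landau function at `n / q`. -/
def floorSum (c : ι → Fin d → ℕ) (ε : ι → ℤ) (q : ℕ) (n : Fin d → ℕ) : ℤ :=
  ∑ i, ε i * ((c i ⬝ᵥ n / q : ℕ) : ℤ)

/-- The sum of the Landau function over `n / p ^ l` for `l < s`. -/
def levelSum (c : ι → Fin d → ℕ) (ε : ι → ℤ) (p s : ℕ) (n : Fin d → ℕ) : ℤ :=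
  ∑ l ∈ Finset.range s, floorSum c ε (p ^ l) n

/-- The quotient of the values of a ratio of factorials at `n` and at `⌊n / p⌋`. -/
def ratioStep (c : ι → Fin d → ℕ) (ε : ι → ℤ) (p : ℕ) (n : Fin d → ℕ) : ℚ :=
  ratio c ε n / ratio c ε (vdiv n p)

variable {c : ι → Fin d → ℕ} {ε : ι → ℤ}

theorem ratio_ne_zero (n : Fin d → ℕ) : ratio c ε n ≠ 0 :=
  Finset.prod_ne_zero_iff.mpr fun _ _ => zpow_ne_zero _ (by exact_mod_cast Nat.factorial_ne_zero _)

theorem ratio_zero : ratio c ε 0 = 1 := by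
  simp [ratio]

theorem ratioStep_ne_zero (p : ℕ) (n : Fin d → ℕ) : ratioStep c ε p n ≠ 0 :=
  div_ne_zero (ratio_ne_zero _) (ratio_ne_zero _)

theorem ratioStep_mul_ratio (p : ℕ) (n : Fin d → ℕ) :
    ratioStep c ε p n * ratio c ε (vdiv n p) = ratio c ε n :=
  div_mul_cancel₀ _ (ratio_ne_zero _)

theorem balanced_dotProduct (hbal : ∀ k, ∑ i, ε i * (c i k : ℤ) = 0) (n : Fin d → ℕ) :
    ∑ i, ε i * ((c i ⬝ᵥ n : ℕ) : ℤ) = 0 := by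
  simp only [dotProduct, Nat.cast_sum, Nat.cast_mul, Finset.mul_sum]
  rw [Finset.sum_comm]
  refine Finset.sum_eq_zero fun k _ => ?_
  simp_rw [← mul_assoc]
  rw [← Finset.sum_mul, hbal, zero_mul]

/-- The Landau function is periodic. -/
theorem floorSum_vmod (hbal : ∀ k, ∑ i, ε i * (c i k : ℤ) = 0) (q : ℕ) (n : Fin d → ℕ) :
    floorSum c ε q (vmod n q) = floorSum c ε q n := by
  rcases Nat.eq_zero_or_pos q with rfl | hq
  · simp [floorSum]
  · unfold floorSum
    rw [← sub_eq_zero, ← Finset.sum_sub_distrib, ← neg_eq_zero, ← Finset.sum_neg_distrib,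
      ← balanced_dotProduct hbal (vdiv n q)]
    refine Finset.sum_congr rfl fun i _ => ?_
    rw [dotProduct_eq_vmod_add (c i) n q, Nat.add_mul_div_left _ _ hq]
    push_cast
    ring

theorem floorSum_congr (hbal : ∀ k, ∑ i, ε i * (c i k : ℤ) = 0) {q : ℕ} {n m : Fin d → ℕ}
    (h : vmod n q = vmod m q) : floorSum c ε q n = floorSum c ε q m := by
  rw [← floorSum_vmod hbal, h, floorSum_vmod hbal]

theorem levelSum_congr (hbal : ∀ k, ∑ i, ε i * (c i k : ℤ) = 0) {p s t : ℕ} {n m : Fin d → ℕ}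
    (h : vmod n (p ^ s) = vmod m (p ^ s)) (ht : t ≤ s + 1) :
    levelSum c ε p t n = levelSum c ε p t m :=
  Finset.sum_congr rfl fun _ hl => floorSum_congr hbal (vmod_eq_of_dvd
    (pow_dvd_pow p (Nat.lt_succ_iff.mp ((Finset.mem_range.mp hl).trans_le ht))) h)

theorem levelSum_mono (hpos : ∀ q n, 0 < q → 0 ≤ floorSum c ε q n) {p : ℕ} (hp : 0 < p)
    {s t : ℕ} (hst : s ≤ t) (n : Fin d → ℕ) :
    levelSum c ε p s n ≤ levelSum c ε p t n :=
  Finset.sum_le_sum_of_subset_of_nonneg (Finset.range_mono hst)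
    fun l _ _ => hpos _ _ (pow_pos hp l)

/-- The Landau function being at least `1` where the linear forms wrap around, `levelSum` grows
by at least `1` at each such level. -/
theorem levelSum_add_le (hwrap : ∀ q n, 0 < q → Wraps c q n → 1 ≤ floorSum c ε q n)
    {p : ℕ} (hp : 0 < p) {s t : ℕ} (hst : s ≤ t) {n : Fin d → ℕ}
    (h : ∀ l, s ≤ l → l < t → Wraps c (p ^ l) n) :
    levelSum c ε p s n + (t - s : ℕ) ≤ levelSum c ε p t n := by
  induction t, hst using Nat.le_induction with
  | base => simp
  | succ t hst ih =>
    have h1 := ih fun l hl _ => h l hl (by omega)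
    have h2 := hwrap _ _ (pow_pos hp t) (h t hst (Nat.lt_succ_self t))
    have h3 : levelSum c ε p (t + 1) n = levelSum c ε p t n + floorSum c ε (p ^ t) n :=
      Finset.sum_range_succ _ _
    omega

/-- **Legendre's formula** for ratios of factorials. -/
theorem padicValRat_ratio (hbal : ∀ k, ∑ i, ε i * (c i k : ℤ) = 0) {p : ℕ} [hp : Fact p.Prime]
    {n : Fin d → ℕ} {b : ℕ} (hb : ∀ i, c i ⬝ᵥ n < p ^ b) :
    padicValRat p (ratio c ε n) = levelSum c ε p b n := by
  have hval : ∀ s : Finset ι, padicValRat p (∏ i ∈ s, ((c i ⬝ᵥ n)! : ℚ) ^ ε i) =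
      ∑ i ∈ s, ε i * (padicValNat p (c i ⬝ᵥ n)! : ℤ) := by
    classical
    intro s
    induction s using Finset.induction_on with
    | empty => simp
    | insert a s ha ih =>
      rw [Finset.prod_insert ha, Finset.sum_insert ha, padicValRat.mul, ih, padicValRat.zpow,
        padicValRat.of_nat]
      · exact zpow_ne_zero _ (by exact_mod_cast Nat.factorial_ne_zero _)
      · exact Finset.prod_ne_zero_iff.mpr fun _ _ =>
          zpow_ne_zero _ (by exact_mod_cast Nat.factorial_ne_zero _)
  rw [ratio, hval]
  rcases Nat.eq_zero_or_pos b with rfl | hb0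
  · have h0 : ∀ i, c i ⬝ᵥ n = 0 := fun i => by simpa using hb i
    simp [h0, levelSum]
  have h1 : ∀ i, (padicValNat p (c i ⬝ᵥ n)! : ℤ) =
      ∑ l ∈ Finset.Ico 1 b, ((c i ⬝ᵥ n / p ^ l : ℕ) : ℤ) := fun i => by
    rw [padicValNat_factorial (b := b)]
    · push_cast; rfl
    · exact Nat.log_lt_of_lt_pow' hb0.ne' (hb i)
  simp_rw [h1, Finset.mul_sum]
  rw [Finset.sum_comm, levelSum, Finset.range_eq_Ico, Finset.sum_eq_sum_Ico_succ_bot hb0]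
  have h2 : floorSum c ε (p ^ 0) n = 0 := by
    simpa [floorSum] using balanced_dotProduct hbal n
  rw [h2, zero_add]
  rfl

theorem exists_forall_dotProduct_lt_pow (c : ι → Fin d → ℕ) {p : ℕ} (hp : 1 < p)
    (n : Fin d → ℕ) : ∃ b, ∀ b' ≥ b, ∀ i, c i ⬝ᵥ n < p ^ b' := by
  refine ⟨∑ i, c i ⬝ᵥ n, fun b' hb' i => ?_⟩
  calc c i ⬝ᵥ n ≤ ∑ i, c i ⬝ᵥ n :=
        Finset.single_le_sum (f := fun i => c i ⬝ᵥ n) (fun _ _ => Nat.zero_le _)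
          (Finset.mem_univ i)
    _ ≤ b' := hb'
    _ < p ^ b' := Nat.lt_pow_self hp

theorem padicDvd_ratio (hbal : ∀ k, ∑ i, ε i * (c i k : ℤ) = 0)
    (hpos : ∀ q n, 0 < q → 0 ≤ floorSum c ε q n) {p : ℕ} [hp : Fact p.Prime] (s : ℕ)
    (n : Fin d → ℕ) : PadicDvd p (levelSum c ε p s n) (ratio c ε n) := by
  obtain ⟨b, hb⟩ := exists_forall_dotProduct_lt_pow c hp.out.one_lt n
  rw [PadicDvd.iff_le_padicValRat (ratio_ne_zero n),
    padicValRat_ratio hbal (hb (max b s) (le_max_left b s))]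
  exact levelSum_mono hpos hp.out.pos (le_max_right b s) n

theorem floorSum_pow_succ_eq_of_not_wraps {p r : ℕ} (hp : 0 < p) {n : Fin d → ℕ}
    (h : ¬ Wraps c (p ^ (r + 1)) n) {l : ℕ} (hl : r ≤ l) :
    floorSum c ε (p ^ (l + 1)) n = floorSum c ε (p ^ l) (vdiv n p) :=
  Finset.sum_congr rfl fun i _ => by rw [div_pow_succ_eq_of_not_wraps hp h i hl]

theorem padicValRat_ratioStep (hbal : ∀ k, ∑ i, ε i * (c i k : ℤ) = 0) {p : ℕ}
    [hp : Fact p.Prime] {r : ℕ} {n : Fin d → ℕ} (h : ¬ Wraps c (p ^ (r + 1)) n) {s : ℕ}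
    (hs : r ≤ s) :
    padicValRat p (ratioStep c ε p n) =
      levelSum c ε p (s + 1) n - levelSum c ε p s (vdiv n p) := by
  obtain ⟨b, hb⟩ := exists_forall_dotProduct_lt_pow c hp.out.one_lt n
  obtain ⟨b', hb'⟩ := exists_forall_dotProduct_lt_pow c hp.out.one_lt (vdiv n p)
  set B := max (max b b') s
  have key : ∀ t, s ≤ t → levelSum c ε p (t + 1) n - levelSum c ε p t (vdiv n p) =
      levelSum c ε p (s + 1) n - levelSum c ε p s (vdiv n p) := by
    intro t ht
    induction t, ht using Nat.le_induction with
    | base => rfl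
    | succ t ht ih =>
      rw [← ih]
      have h1 : levelSum c ε p (t + 1 + 1) n =
        levelSum c ε p (t + 1) n + floorSum c ε (p ^ (t + 1)) n := Finset.sum_range_succ _ _
      have h2 : levelSum c ε p (t + 1) (vdiv n p) =
        levelSum c ε p t (vdiv n p) + floorSum c ε (p ^ t) (vdiv n p) := Finset.sum_range_succ _ _
      rw [h1, h2, floorSum_pow_succ_eq_of_not_wraps hp.out.pos h (hs.trans ht)]
      ring
  rw [ratioStep, padicValRat.div (ratio_ne_zero _) (ratio_ne_zero _),
    padicValRat_ratio hbal (hb (B + 1) (by omega)),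
    padicValRat_ratio hbal (hb' B (by omega)), key B (by omega)]

end Ratio

/-! ### Congruences for ratios of factorials and harmonic numbers -/

section OneUnits

variable {p : ℕ} [hp : Fact p.Prime] {k : ℤ} {x y : ℚ}

theorem padicDvd_zero_of_sub_one (hk : 0 ≤ k) (hx : PadicDvd p k (x - 1)) : PadicDvd p 0 x := by
  simpa using (hx.mono hk).add PadicDvd.one

theorem padicDvd_mul_sub_one (hk : 0 ≤ k) (hx : PadicDvd p k (x - 1))
    (hy : PadicDvd p k (y - 1)) : PadicDvd p k (x * y - 1) := by
  have h : x * y - 1 = y * (x - 1) + (y - 1) := by ring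
  rw [h]
  exact ((padicDvd_zero_of_sub_one hk hy).mul_left hx).add hy

theorem padicDvd_inv_sub_one (hk : 1 ≤ k) (hx : PadicDvd p k (x - 1)) :
    PadicDvd p k (x⁻¹ - 1) := by
  have h1 : padicNorm p (x - 1) < 1 := by
    have hp1 : (1 : ℚ) < p := by exact_mod_cast hp.out.one_lt
    exact lt_of_le_of_lt hx (zpow_lt_one_of_neg₀ hp1 (by omega))
  have h2 : padicNorm p x = 1 := by
    have h3 := padicNorm.add_eq_max_of_ne (p := p) (q := x - 1) (r := 1)
      (by rw [padicNorm.one]; exact h1.ne)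
    rwa [sub_add_cancel, padicNorm.one, max_eq_right h1.le] at h3
  have hx0 : x ≠ 0 := by
    rintro rfl
    simp at h2
  have h4 : x⁻¹ - 1 = x⁻¹ * -(x - 1) := by field_simp; ring
  have h5 : PadicDvd p 0 x⁻¹ := by
    have h6 := padicNorm.div (p := p) 1 x
    rw [h2, padicNorm.one, one_div] at h6
    simp [PadicDvd, h6]
  rw [h4]
  exact h5.mul_left hx.neg

theorem padicDvd_zpow_sub_one (hk : 1 ≤ k) (hx : PadicDvd p k (x - 1)) (m : ℤ) :
    PadicDvd p k (x ^ m - 1) := by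
  have hpow : ∀ y : ℚ, PadicDvd p k (y - 1) → ∀ n : ℕ, PadicDvd p k (y ^ n - 1) := by
    intro y hy n
    induction n with
    | zero => rw [pow_zero, sub_self]; exact PadicDvd.zero
    | succ n ih => rw [pow_succ]; exact padicDvd_mul_sub_one (by omega) ih hy
  obtain ⟨n, rfl | rfl⟩ := m.eq_nat_or_neg
  · simpa using hpow x hx n
  · simpa using hpow x⁻¹ (padicDvd_inv_sub_one hk hx) n

theorem padicDvd_prod_sub_one {α : Type*} {s : Finset α} {f : α → ℚ} (hk : 0 ≤ k)
    (h : ∀ a ∈ s, PadicDvd p k (f a - 1)) : PadicDvd p k (∏ a ∈ s, f a - 1) :=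
  Finset.prod_induction f (fun x => PadicDvd p k (x - 1)) (fun _ _ => padicDvd_mul_sub_one hk)
    (by rw [sub_self]; exact PadicDvd.zero) h

end OneUnits

section PrimeToPFactorial

open scoped Nat

variable (p : ℕ)

/-- The product of the positive integers up to `N` that are prime to `p`. -/
def primeToFactorial (N : ℕ) : ℕ :=
  ∏ l ∈ Finset.range N, if p ∣ l + 1 then 1 else l + 1

theorem primeToFactorial_succ (N : ℕ) :
    primeToFactorial p (N + 1) = primeToFactorial p N * if p ∣ N + 1 then 1 else N + 1 :=
  Finset.prod_range_succ _ _

theorem factorial_eq_primeToFactorial (N : ℕ) :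
    N ! = primeToFactorial p N * p ^ (N / p) * (N / p)! := by
  induction N with
  | zero => simp [primeToFactorial]
  | succ N ih =>
    rw [Nat.factorial_succ, ih, primeToFactorial_succ, Nat.succ_div]
    split_ifs with h
    · have h1 : N + 1 = p * (N / p + 1) := by
        obtain ⟨m, hm⟩ := h
        have h2 : (N + 1) / p = N / p + 1 := by rw [Nat.succ_div, if_pos ⟨m, hm⟩]
        rw [← h2, Nat.mul_div_cancel' ⟨m, hm⟩]
      rw [Nat.factorial_succ, pow_succ]
      calc (N + 1) * (primeToFactorial p N * p ^ (N / p) * (N / p)!)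
          = (p * (N / p + 1)) * (primeToFactorial p N * p ^ (N / p) * (N / p)!) := by rw [← h1]
        _ = _ := by ring
    · rw [add_zero]
      ring

variable {p}

theorem not_dvd_primeToFactorial (hp : p.Prime) (N : ℕ) : ¬ p ∣ primeToFactorial p N := by
  induction N with
  | zero => simpa [primeToFactorial] using hp.one_lt.ne'
  | succ N ih =>
    rw [primeToFactorial_succ, hp.dvd_mul, not_or]
    refine ⟨ih, ?_⟩
    split_ifs with h
    · simpa using hp.one_lt.ne'
    · exact h

/-- The integers prime to `p` in a block of `p ^ (t + 1)` consecutive integers have a product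
modulo `p ^ (t + 1)` that does not depend on the block. -/
theorem primeToFactorial_add_mul_modEq (t N M : ℕ) :
    primeToFactorial p (N + p ^ (t + 1) * M) ≡
      primeToFactorial p N * primeToFactorial p (p ^ (t + 1)) ^ M [MOD p ^ (t + 1)] := by
  have hpq : p ∣ p ^ (t + 1) := dvd_pow_self p (Nat.succ_ne_zero t)
  set q := p ^ (t + 1)
  have step : ∀ N, primeToFactorial p (N + q) ≡
      primeToFactorial p N * primeToFactorial p q [MOD q] := by
    intro N
    induction N with
    | zero => simp [primeToFactorial]; rfl
    | succ N ih =>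
      rw [add_right_comm, primeToFactorial_succ, primeToFactorial_succ, mul_right_comm]
      have h1 : (p ∣ N + q + 1) ↔ p ∣ N + 1 := by
        rw [add_right_comm]
        exact Nat.dvd_add_left hpq
      simp only [h1]
      refine ih.mul ?_
      split_ifs
      · rfl
      · rw [add_right_comm]
        exact Nat.add_modEq_right
  induction M with
  | zero => simp; rfl
  | succ M ih =>
    rw [mul_add, mul_one, ← add_assoc, pow_succ, ← mul_assoc]
    exact (step _).trans (ih.mul_right _)

end PrimeToPFactorial

section Congruences

open scoped Nat

variable {d : ℕ} {ι : Type*} {c : ι → Fin d → ℕ}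

theorem factorial_div_factorial_eq_prod_Ioc {a b : ℕ} (h : a ≤ b) :
    (b ! : ℚ) / a ! = ∏ x ∈ Finset.Ioc a b, (x : ℚ) := by
  induction b, h using Nat.le_induction with
  | base =>
    rw [Finset.Ioc_self, Finset.prod_empty, div_self]
    exact_mod_cast Nat.factorial_ne_zero _
  | succ b h ih =>
    rw [← Finset.insert_Ioc_right_eq_Ioc_add_one h, Finset.prod_insert (by simp), ← ih,
      Nat.factorial_succ]
    push_cast
    ring

theorem dotProduct_vdiv_le {p : ℕ} (hp : 0 < p) (c n : Fin d → ℕ) :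
    c ⬝ᵥ vdiv n p ≤ c ⬝ᵥ n / p := by
  rw [Nat.le_div_iff_mul_le hp, mul_comm]
  have := dotProduct_eq_vmod_add c n p
  omega

/-- One linear form at a time: up to the factor `(W p ^ (p ^ t)) ^ M`, which cancels in balanced
products, `(cᵢ · n)! / (cᵢ · ⌊n / p⌋)!` depends modulo `p ^ (t + 1 - r)` only on the residue
class of `n` modulo `p ^ (t + 1)`. -/
theorem padicDvd_factorial_quotient {p : ℕ} [hp : Fact p.Prime] {r t : ℕ} (hrt : r ≤ t)
    {n : Fin d → ℕ} (h : ¬ Wraps c (p ^ (r + 1)) n) (i : ι) :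
    PadicDvd p (t + 1 - r)
      ((((c i ⬝ᵥ n)! : ℚ) / (c i ⬝ᵥ vdiv n p)!) /
        (((c i ⬝ᵥ vmod n (p ^ (t + 1)))! : ℚ) / (c i ⬝ᵥ vdiv (vmod n (p ^ (t + 1))) p)!) /
        ((primeToFactorial p (p ^ (t + 1)) : ℚ) * (p : ℚ) ^ (p ^ t)) ^
          (c i ⬝ᵥ vdiv n (p ^ (t + 1))) - 1) := by
  have hp0 : (p : ℚ) ≠ 0 := by exact_mod_cast hp.out.ne_zero
  have hpp := hp.out.pos
  set n₀ := vmod n (p ^ (t + 1)) with hn₀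
  set M := c i ⬝ᵥ vdiv n (p ^ (t + 1)) with hM
  set N₀ := c i ⬝ᵥ n₀ with hN₀
  set K₀ := c i ⬝ᵥ vdiv n₀ p with hK₀
  set W := primeToFactorial p (p ^ (t + 1)) with hW
  have hN : c i ⬝ᵥ n = N₀ + p ^ (t + 1) * M := dotProduct_eq_vmod_add (c i) n (p ^ (t + 1))
  have hK : c i ⬝ᵥ vdiv n p = K₀ + p ^ t * M := by
    have h1 : vmod (vdiv n p) (p ^ t) = vdiv n₀ p := by rw [hn₀, pow_succ', vdiv_vmod_mul]
    have h2 : vdiv (vdiv n p) (p ^ t) = vdiv n (p ^ (t + 1)) := by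
      funext k
      simp only [vdiv, Nat.div_div_eq_div_mul, pow_succ']
    rw [dotProduct_eq_vmod_add (c i) (vdiv n p) (p ^ t), h1, h2]
  have hNp : (N₀ + p ^ (t + 1) * M) / p = N₀ / p + p ^ t * M := by
    rw [pow_succ', mul_assoc, Nat.add_mul_div_left _ _ hpp]
  have h₀ : ¬ Wraps c (p ^ (r + 1)) n₀ := by
    rw [wraps_congr (pow_dvd_pow p (Nat.succ_le_succ hrt)) (m := n)]
    · exact h
    · exact vmod_vmod_of_dvd n dvd_rfl
  have hle : K₀ ≤ N₀ / p := dotProduct_vdiv_le hpp _ _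
  -- The quotient of the parts prime to `p`.
  have hunit : PadicDvd p (t + 1)
      ((primeToFactorial p (N₀ + p ^ (t + 1) * M) : ℚ) / (primeToFactorial p N₀ * W ^ M) - 1) := by
    have hden : ¬ p ∣ primeToFactorial p N₀ * W ^ M := by
      rw [hp.out.dvd_mul, not_or]
      exact ⟨not_dvd_primeToFactorial hp.out _,
        fun h' => not_dvd_primeToFactorial hp.out _ (hp.out.dvd_of_dvd_pow h')⟩
    have hden0 : ((primeToFactorial p N₀ * W ^ M : ℕ) : ℚ) ≠ 0 := by
      intro h'
      rw [Nat.cast_eq_zero] at h'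
      exact hden (h' ▸ dvd_zero p)
    apply PadicDvd.of_natCast_mul hden
    obtain ⟨z, hz⟩ := (primeToFactorial_add_mul_modEq (p := p) t N₀ M).symm.dvd
    have h1 : ((primeToFactorial p N₀ * W ^ M : ℕ) : ℚ) *
        ((primeToFactorial p (N₀ + p ^ (t + 1) * M) : ℚ) / (primeToFactorial p N₀ * W ^ M) - 1) =
        (p : ℚ) ^ (t + 1) * z := by
      have hz' : (primeToFactorial p (N₀ + p ^ (t + 1) * M) : ℚ) - primeToFactorial p N₀ * W ^ M =
          (p : ℚ) ^ (t + 1) * z := by exact_mod_cast hz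
      rw [← hz']
      push_cast at hden0 ⊢
      rw [mul_sub, mul_one, mul_comm _ (_ / _), div_mul_cancel₀ _ hden0]
    rw [h1]
    have h2 : PadicDvd p (t + 1) ((p : ℚ) ^ (t + 1)) := by
      rw [PadicDvd.iff_le_padicValRat (pow_ne_zero _ hp0), padicValRat.pow,
        padicValRat.self hp.out.one_lt]
      simp
    simpa using h2.mul (PadicDvd.intCast z)
  -- The quotient of the remaining linear factors.
  have hlin : PadicDvd p (t + 1 - r)
      (∏ y ∈ Finset.Ioc K₀ (N₀ / p), (((y + p ^ t * M : ℕ) : ℚ) / y) - 1) := by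
    refine padicDvd_prod_sub_one (by omega) fun y hy => ?_
    obtain ⟨hy1, hy2⟩ := Finset.mem_Ioc.mp hy
    have hy0 : (y : ℚ) ≠ 0 := by exact_mod_cast (Nat.zero_lt_of_lt hy1).ne'
    have hval : padicValNat p y + 1 ≤ r := by
      by_contra h'
      refine h₀ (wraps_of_pow_dvd (v := r) hpp hy1 hy2 ?_ (by omega) le_rfl)
      exact (padicValNat_dvd_iff_le (Nat.zero_lt_of_lt hy1).ne').mpr (by omega)
    have h1 : ((y + p ^ t * M : ℕ) : ℚ) / y - 1 = (M : ℚ) * ((p : ℚ) ^ t / y) := by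
      push_cast
      field_simp
      ring
    rw [h1]
    refine (PadicDvd.natCast M).mul_left ?_
    rw [PadicDvd.iff_le_padicValRat (div_ne_zero (pow_ne_zero _ hp0) hy0),
      padicValRat.div (pow_ne_zero _ hp0) hy0, padicValRat.pow, padicValRat.self hp.out.one_lt,
      padicValRat.of_nat]
    omega
  have hprod : ∏ x ∈ Finset.Ioc (K₀ + p ^ t * M) (N₀ / p + p ^ t * M), (x : ℚ) =
      (∏ y ∈ Finset.Ioc K₀ (N₀ / p), (((y + p ^ t * M : ℕ) : ℚ) / y)) *
        ∏ y ∈ Finset.Ioc K₀ (N₀ / p), (y : ℚ) := by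
    rw [← Finset.prod_mul_distrib, ← Finset.image_add_right_Ioc,
      Finset.prod_image (by simp [Set.InjOn])]
    refine Finset.prod_congr rfl fun y hy => ?_
    have hy0 : (y : ℚ) ≠ 0 := by
      exact_mod_cast (Nat.zero_lt_of_lt (Finset.mem_Ioc.mp hy).1).ne'
    rw [div_mul_cancel₀ _ hy0]
  have hfac : ∀ N K : ℕ, K ≤ N / p → ((N ! : ℕ) : ℚ) / (K ! : ℕ) =
      primeToFactorial p N * (p : ℚ) ^ (N / p) * ∏ x ∈ Finset.Ioc K (N / p), (x : ℚ) := by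
    intro N K hKN
    rw [← factorial_div_factorial_eq_prod_Ioc hKN, factorial_eq_primeToFactorial p N]
    push_cast
    ring
  rw [hN, hK, hfac _ _ (by rw [hNp]; omega), hfac _ _ hle, hNp, hprod]
  have hP0 : (∏ y ∈ Finset.Ioc K₀ (N₀ / p), (y : ℚ)) ≠ 0 :=
    Finset.prod_ne_zero_iff.mpr fun y hy => by
      exact_mod_cast (Nat.zero_lt_of_lt (Finset.mem_Ioc.mp hy).1).ne'
  have hu0 : ∀ N, (primeToFactorial p N : ℚ) ≠ 0 := fun N h' => by
    rw [Nat.cast_eq_zero] at h'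
    exact not_dvd_primeToFactorial hp.out N (h' ▸ dvd_zero p)
  have hW0 : (W : ℚ) ≠ 0 := hu0 _
  have hN0 := hu0 N₀
  convert padicDvd_mul_sub_one (by omega) (hunit.mono (by omega : (t : ℤ) + 1 - r ≤ t + 1)) hlin
    using 2
  rw [pow_add (p : ℚ) (N₀ / p), pow_mul (p : ℚ) (p ^ t), mul_pow (W : ℚ)]
  generalize (∏ y ∈ Finset.Ioc K₀ (N₀ / p), (((y + p ^ t * M : ℕ) : ℚ) / y)) = P₁
  generalize (∏ y ∈ Finset.Ioc K₀ (N₀ / p), (y : ℚ)) = P₂ at hP0 ⊢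
  generalize (primeToFactorial p (N₀ + p ^ (t + 1) * M) : ℚ) = u
  field_simp

variable [Fintype ι] {ε : ι → ℤ}

/-- The quotient `Q(n) / Q(⌊n / p⌋)` depends modulo `p ^ (t + 1 - r)`, multiplicatively, only on
the residue class of `n` modulo `p ^ (t + 1)`. -/
theorem padicDvd_ratioStep_div_sub_one (hbal : ∀ k, ∑ i, ε i * (c i k : ℤ) = 0) {p : ℕ}
    [hp : Fact p.Prime] {r t : ℕ} (hrt : r ≤ t) {n : Fin d → ℕ}
    (h : ¬ Wraps c (p ^ (r + 1)) n) :
    PadicDvd p (t + 1 - r)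
      (ratioStep c ε p (vmod n (p ^ (t + 1))) / ratioStep c ε p n - 1) := by
  have hp0 : (p : ℚ) ≠ 0 := by exact_mod_cast hp.out.ne_zero
  set B := (primeToFactorial p (p ^ (t + 1)) : ℚ) * (p : ℚ) ^ (p ^ t) with hB
  have hB0 : B ≠ 0 := by
    refine mul_ne_zero (fun h' => ?_) (pow_ne_zero _ hp0)
    rw [Nat.cast_eq_zero] at h'
    exact not_dvd_primeToFactorial hp.out _ (h' ▸ dvd_zero p)
  have hstep : ∀ m, ratioStep c ε p m =
      ∏ i, (((c i ⬝ᵥ m)! : ℚ) / (c i ⬝ᵥ vdiv m p)!) ^ ε i := fun m => by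
    simp only [ratioStep, ratio, div_zpow, Finset.prod_div_distrib]
  have hcancel : ∏ i, (B ^ (c i ⬝ᵥ vdiv n (p ^ (t + 1)))) ^ ε i = 1 := by
    have h1 : ∀ i, (B ^ (c i ⬝ᵥ vdiv n (p ^ (t + 1)))) ^ ε i =
        B ^ (ε i * ((c i ⬝ᵥ vdiv n (p ^ (t + 1)) : ℕ) : ℤ)) := fun i => by
      rw [← zpow_natCast, ← zpow_mul, mul_comm]
    simp_rw [h1]
    have h2 : ∀ (s : Finset ι) (g : ι → ℤ), ∏ i ∈ s, B ^ g i = B ^ ∑ i ∈ s, g i := by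
      classical
      intro s g
      induction s using Finset.induction_on with
      | empty => simp
      | insert a s ha ih => rw [Finset.prod_insert ha, Finset.sum_insert ha, zpow_add₀ hB0, ih]
    rw [h2, balanced_dotProduct hbal, zpow_zero]
  have key : ratioStep c ε p n / ratioStep c ε p (vmod n (p ^ (t + 1))) =
      ∏ i, ((((c i ⬝ᵥ n)! : ℚ) / (c i ⬝ᵥ vdiv n p)!) /
        (((c i ⬝ᵥ vmod n (p ^ (t + 1)))! : ℚ) / (c i ⬝ᵥ vdiv (vmod n (p ^ (t + 1))) p)!) /
        B ^ (c i ⬝ᵥ vdiv n (p ^ (t + 1)))) ^ ε i := by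
    rw [hstep, hstep]
    simp only [div_zpow _ (B ^ _), div_zpow (_ / _), Finset.prod_div_distrib, hcancel, div_one]
  rw [← inv_div, key]
  refine padicDvd_inv_sub_one (by omega) (padicDvd_prod_sub_one (by omega) fun i _ => ?_)
  exact padicDvd_zpow_sub_one (by omega) (padicDvd_factorial_quotient hrt h i) _

end Congruences

section Harmonic

theorem padicDvd_prime_mul_harmonic_sub {p : ℕ} [hp : Fact p.Prime] (N : ℕ) :
    PadicDvd p 1 (p * harmonic N - harmonic (N / p)) := by
  induction N with
  | zero => simpa using PadicDvd.zero
  | succ N ih =>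
    rw [harmonic_succ, Nat.succ_div]
    split_ifs with h
    · obtain ⟨m, hm⟩ := h
      have h1 : N / p + 1 = m := by
        have h2 : (N + 1) / p = N / p + 1 := by rw [Nat.succ_div, if_pos ⟨m, hm⟩]
        rw [← h2, hm, Nat.mul_div_cancel_left _ hp.out.pos]
      have hp0 : (p : ℚ) ≠ 0 := by exact_mod_cast hp.out.ne_zero
      have hm0 : (m : ℚ) ≠ 0 := by
        rintro h'
        rw [Nat.cast_eq_zero] at h'
        simp [h'] at hm
      rw [harmonic_succ, h1, hm]
      convert ih using 1
      push_cast
      field_simp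
      ring
    · rw [add_zero]
      have h1 : (p : ℚ) * (harmonic N + ((N + 1 : ℕ) : ℚ)⁻¹) - harmonic (N / p) =
          (p * harmonic N - harmonic (N / p)) + p * ((N + 1 : ℕ) : ℚ)⁻¹ := by ring
      rw [h1]
      refine ih.add ?_
      rw [← zero_add (1 : ℤ)]
      refine PadicDvd.prime_mul (PadicDvd.of_natCast_mul h ?_)
      rw [mul_inv_cancel₀ (by positivity)]
      exact PadicDvd.one

theorem harmonic_sub_harmonic {a b : ℕ} (h : a ≤ b) :
    harmonic b - harmonic a = ∑ x ∈ Finset.Ioc a b, (x : ℚ)⁻¹ := by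
  induction b, h using Nat.le_induction with
  | base => simp
  | succ b h ih =>
    rw [← Finset.insert_Ioc_right_eq_Ioc_add_one h, Finset.sum_insert (by simp), ← ih,
      harmonic_succ]
    ring

variable {d : ℕ} {ι : Type*} [Fintype ι] {c : ι → Fin d → ℕ} {ε : ι → ℤ}

/-- The hypothesis on the Landau function makes `Q(n)` absorb the denominators in
`p H_{cᵢ · n} - H_{cᵢ · ⌊n / p⌋}`. -/
theorem padicDvd_ratio_mul_harmonic_sub (hbal : ∀ k, ∑ i, ε i * (c i k : ℤ) = 0)
    (hpos : ∀ q n, 0 < q → 0 ≤ floorSum c ε q n)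
    (hwrap : ∀ q n, 0 < q → Wraps c q n → 1 ≤ floorSum c ε q n)
    {p : ℕ} [hp : Fact p.Prime] (s : ℕ) (n : Fin d → ℕ) (i : ι) :
    PadicDvd p (1 - s + levelSum c ε p (s + 1) n)
      (ratio c ε n * (p * harmonic (c i ⬝ᵥ n) - harmonic (c i ⬝ᵥ vdiv n p))) := by
  have hpp := hp.out.pos
  have h1 : (p : ℚ) * harmonic (c i ⬝ᵥ n) - harmonic (c i ⬝ᵥ vdiv n p) =
      (p * harmonic (c i ⬝ᵥ n) - harmonic (c i ⬝ᵥ n / p)) +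
        (harmonic (c i ⬝ᵥ n / p) - harmonic (c i ⬝ᵥ vdiv n p)) := by ring
  rw [h1, mul_add]
  refine PadicDvd.add ?_ ?_
  · have h2 := (padicDvd_ratio hbal hpos (p := p) (s + 1) n).mul
      (padicDvd_prime_mul_harmonic_sub (p := p) (c i ⬝ᵥ n))
    exact h2.mono (by omega)
  · rw [harmonic_sub_harmonic (dotProduct_vdiv_le hpp _ _), Finset.mul_sum]
    refine PadicDvd.sum fun x hx => ?_
    obtain ⟨hx1, hx2⟩ := Finset.mem_Ioc.mp hx
    have hx0 : x ≠ 0 := (Nat.zero_lt_of_lt hx1).ne'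
    have hxQ : (x : ℚ) ≠ 0 := by exact_mod_cast hx0
    set v := padicValNat p x with hv
    have hw : ∀ l, 1 ≤ l → l ≤ v + 1 → Wraps c (p ^ l) n := fun l hl hlv =>
      wraps_of_pow_dvd hpp hx1 hx2 ((padicValNat_dvd_iff_le hx0).mpr le_rfl) hl hlv
    have hinv : PadicDvd p (-v) (x : ℚ)⁻¹ := by
      rw [PadicDvd.iff_le_padicValRat (inv_ne_zero hxQ), padicValRat.inv, padicValRat.of_nat]
    rcases le_or_gt s (v + 1) with hsv | hsv
    · have h3 := levelSum_add_le hwrap hpp (s := s + 1) (t := v + 2) (by omega) (n := n)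
        fun l hl hlt => hw l (by omega) (by omega)
      refine ((padicDvd_ratio hbal hpos (p := p) (v + 2) n).mul hinv).mono ?_
      omega
    · refine ((padicDvd_ratio hbal hpos (p := p) (s + 1) n).mul hinv).mono ?_
      omega

end Harmonic

/-! ### Defects of series identities on residue classes -/

section Pairing

variable {d : ℕ}

/-- The coefficient of `z ^ m` in `∑ₙ A(n) (H(n) - h(z)) zⁿ`. -/
def defect (H h A : (Fin d → ℕ) → ℚ) (m : Fin d → ℕ) : ℚ :=
  A m * H m - ∑ n ∈ Finset.Iic m, A n * h (m - n)

/-- The coefficient of `z ^ m` in `∑ₙ A(n) (p H(n) - h(zᵖ)) zⁿ`. -/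
def frobeniusDefect (p : ℕ) (H h A : (Fin d → ℕ) → ℚ) (m : Fin d → ℕ) : ℚ :=
  p * (A m * H m) -
    ∑ n ∈ Finset.Iic m, A n * if vmod (m - n) p = 0 then h (vdiv (m - n) p) else 0

/-- The coefficient of `z ^ m` in `p h(z) - h(zᵖ)`. -/
def dworkDefect (p : ℕ) (h : (Fin d → ℕ) → ℚ) (m : Fin d → ℕ) : ℚ :=
  p * h m - if vmod m p = 0 then h (vdiv m p) else 0

/-- The restriction of a function to the residue class of `U` modulo `q`. -/
def onClass (U : Fin d → ℕ) (q : ℕ) (A : (Fin d → ℕ) → ℚ) (n : Fin d → ℕ) : ℚ :=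
  if vmod n q = vmod U q then A n else 0

variable {H h A B : (Fin d → ℕ) → ℚ}

theorem defect_congr {m : Fin d → ℕ} (hAB : ∀ n ≤ m, A n = B n) :
    defect H h A m = defect H h B m := by
  unfold defect
  rw [hAB m le_rfl, Finset.sum_congr rfl fun n hn => by rw [hAB n (Finset.mem_Iic.mp hn)]]

theorem defect_add (m : Fin d → ℕ) :
    defect H h (fun n => A n + B n) m = defect H h A m + defect H h B m := by
  simp only [defect, add_mul, Finset.sum_add_distrib]
  ring

theorem defect_const_mul (a : ℚ) (m : Fin d → ℕ) :
    defect H h (fun n => a * A n) m = a * defect H h A m := by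
  simp only [defect, mul_sub, Finset.mul_sum, mul_assoc]

theorem defect_sum {α : Type*} (S : Finset α) (C : α → (Fin d → ℕ) → ℚ) (m : Fin d → ℕ) :
    defect H h (fun n => ∑ a ∈ S, C a n) m = ∑ a ∈ S, defect H h (C a) m := by
  simp only [defect, Finset.sum_mul, Finset.sum_sub_distrib]
  rw [Finset.sum_comm]

theorem defect_zero (m : Fin d → ℕ) : defect H h (fun _ => 0) m = 0 := by
  simp [defect]

theorem prime_mul_defect (p : ℕ) (m : Fin d → ℕ) :
    p * defect H h A m =
      frobeniusDefect p H h A m - ∑ n ∈ Finset.Iic m, A n * dworkDefect p h (m - n) := by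
  simp only [defect, frobeniusDefect, dworkDefect, mul_sub, Finset.mul_sum,
    Finset.sum_sub_distrib]
  rw [Finset.sum_congr rfl fun n _ => mul_left_comm (A n) (p : ℚ) (h (m - n))]
  ring

theorem vdiv_mono {p : ℕ} {n m : Fin d → ℕ} (hnm : n ≤ m) : vdiv n p ≤ vdiv m p :=
  fun k => Nat.div_le_div_right (hnm k)

theorem vdiv_vmod_add_smul {p : ℕ} (hp : 0 < p) (m K : Fin d → ℕ) :
    vdiv (vmod m p + p • K) p = K := by
  funext k
  simp only [vdiv, vmod, Pi.add_apply, Pi.smul_apply, smul_eq_mul]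
  rw [Nat.add_mul_div_left _ _ hp, Nat.div_eq_of_lt (Nat.mod_lt _ hp), zero_add]

theorem vmod_vmod_add_smul (p : ℕ) (m K : Fin d → ℕ) :
    vmod (vmod m p + p • K) p = vmod m p := by
  funext k
  simp [vmod]

/-- Only the exponents `n = a + p K`, where `a` is the residue of `m` modulo `p`, contribute to
the coefficient of `z ^ m` in `∑ₙ A(n) h(zᵖ) zⁿ`. -/
theorem sum_Iic_mul_ite_vmod {p : ℕ} (hp : 0 < p) (m : Fin d → ℕ) :
    ∑ n ∈ Finset.Iic m, A n * (if vmod (m - n) p = 0 then h (vdiv (m - n) p) else 0) =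
      ∑ K ∈ Finset.Iic (vdiv m p), A (vmod m p + p • K) * h (vdiv m p - K) := by
  have hsub : ∀ K ≤ vdiv m p, m - (vmod m p + p • K) = p • (vdiv m p - K) := by
    intro K _
    conv_lhs => enter [1]; rw [← vmod_add_smul_vdiv m p]
    funext k
    simp only [Pi.sub_apply, Pi.add_apply, Pi.smul_apply, smul_eq_mul, Nat.mul_sub]
    omega
  simp only [mul_ite, mul_zero]
  rw [← Finset.sum_filter]
  symm
  refine Finset.sum_bij' (fun K _ => vmod m p + p • K) (fun n _ => vdiv n p) ?_ ?_ ?_ ?_ ?_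
  · intro K hK
    have hK' := Finset.mem_Iic.mp hK
    refine Finset.mem_filter.mpr ⟨Finset.mem_Iic.mpr ?_, ?_⟩
    · calc vmod m p + p • K ≤ vmod m p + p • vdiv m p := by gcongr
        _ = m := vmod_add_smul_vdiv m p
    · rw [hsub K hK']
      funext k
      simp [vmod]
  · intro n hn
    exact Finset.mem_Iic.mpr (vdiv_mono (Finset.mem_Iic.mp (Finset.mem_filter.mp hn).1))
  · intro K _
    exact vdiv_vmod_add_smul hp m K
  · intro n hn
    obtain ⟨h1, h2⟩ := Finset.mem_filter.mp hn
    rw [Finset.mem_Iic] at h1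
    have h3 : vmod m p = vmod n p := by
      funext k
      have h4 : (m k - n k) % p = 0 := congrFun h2 k
      have h5 := (Nat.modEq_iff_dvd' (h1 k)).mpr (Nat.dvd_of_mod_eq_zero h4)
      exact h5.symm
    rw [h3, vmod_add_smul_vdiv]
  · intro K hK
    rw [hsub K (Finset.mem_Iic.mp hK)]
    congr 2
    funext k
    simp [vdiv, hp]

/-- The Frobenius defect at `m` in terms of the defect at `⌊m / p⌋`. -/
theorem frobeniusDefect_eq {p : ℕ} (hp : 0 < p) (m : Fin d → ℕ) :
    frobeniusDefect p H h A m =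
      defect H h (fun K => A (vmod m p + p • K)) (vdiv m p) +
        A m * (p * H m - H (vdiv m p)) := by
  unfold frobeniusDefect defect
  rw [sum_Iic_mul_ite_vmod hp]
  simp only [vmod_add_smul_vdiv]
  ring

end Pairing

section Approximation

variable {d : ℕ} {ι : Type*} [Fintype ι] {c : ι → Fin d → ℕ} {ε : ι → ℤ}

open Classical in
/-- The approximation of `Q(n) / Q(⌊n / p⌋)` by a function of `n` modulo `p ^ (t + 1)`. It is the
value at the representative of the residue class if the linear forms do not wrap around at one of
the first `t + 1` levels, and `0` otherwise, when `Q(n)` is divisible by a large power of `p`. -/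
noncomputable def stepApprox (c : ι → Fin d → ℕ) (ε : ι → ℤ) (p t : ℕ) (n : Fin d → ℕ) : ℚ :=
  if ∃ r ≤ t, ¬ Wraps c (p ^ (r + 1)) n then ratioStep c ε p (vmod n (p ^ (t + 1))) else 0

theorem stepApprox_congr {p t : ℕ} {n m : Fin d → ℕ}
    (h : vmod n (p ^ (t + 1)) = vmod m (p ^ (t + 1))) :
    stepApprox c ε p t n = stepApprox c ε p t m := by
  unfold stepApprox
  rw [h]
  congr 1
  refine propext (exists_congr fun r => and_congr_right fun hr => not_congr ?_)
  exact wraps_congr (pow_dvd_pow p (Nat.succ_le_succ hr)) h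

theorem stepApprox_eq_ratioStep {p t : ℕ} {n : Fin d → ℕ} (hn : ∀ k, n k < p ^ (t + 1))
    (hc : ∀ i, c i ⬝ᵥ n < p ^ (t + 1)) : stepApprox c ε p t n = ratioStep c ε p n := by
  have h1 : vmod n (p ^ (t + 1)) = n := funext fun k => Nat.mod_eq_of_lt (hn k)
  rw [stepApprox, h1, if_pos]
  refine ⟨t, le_rfl, ?_⟩
  rintro ⟨i, hi⟩
  rw [h1] at hi
  exact absurd (hc i) (not_lt.mpr hi)

theorem padicDvd_ratioStep_vmod (hbal : ∀ k, ∑ i, ε i * (c i k : ℤ) = 0) {p : ℕ}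
    [hp : Fact p.Prime] {r t : ℕ} (hrt : r ≤ t) {n : Fin d → ℕ}
    (h : ¬ Wraps c (p ^ (r + 1)) n) :
    PadicDvd p (levelSum c ε p (t + 1) n - levelSum c ε p t (vdiv n p))
      (ratioStep c ε p (vmod n (p ^ (t + 1)))) := by
  have h1 : vmod (vmod n (p ^ (t + 1))) (p ^ (t + 1)) = vmod n (p ^ (t + 1)) :=
    vmod_vmod_of_dvd n dvd_rfl
  rw [PadicDvd.iff_le_padicValRat (ratioStep_ne_zero p _),
    padicValRat_ratioStep hbal (r := r) (s := t) _ hrt,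
    levelSum_congr hbal h1 (by omega : t + 1 ≤ t + 1 + 1),
    levelSum_congr (s := t) hbal (n := vdiv (vmod n (p ^ (t + 1))) p) (m := vdiv n p) _ (by omega)]
  · rw [pow_succ'] at h1 ⊢
    exact vmod_vdiv_eq_of_vmod_mul_eq h1
  · rwa [wraps_congr (pow_dvd_pow p (Nat.succ_le_succ hrt)) h1]

theorem padicDvd_stepApprox (hbal : ∀ k, ∑ i, ε i * (c i k : ℤ) = 0) {p : ℕ}
    [hp : Fact p.Prime] (t : ℕ) (n : Fin d → ℕ) :
    PadicDvd p (levelSum c ε p (t + 1) n - levelSum c ε p t (vdiv n p))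
      (stepApprox c ε p t n) := by
  unfold stepApprox
  split_ifs with h
  · obtain ⟨r, hr, h⟩ := h
    exact padicDvd_ratioStep_vmod hbal hr h
  · exact PadicDvd.zero

/-- Consecutive approximations are close to each other. -/
theorem padicDvd_stepApprox_succ_sub (hbal : ∀ k, ∑ i, ε i * (c i k : ℤ) = 0)
    (hpos : ∀ q n, 0 < q → 0 ≤ floorSum c ε q n)
    (hwrap : ∀ q n, 0 < q → Wraps c q n → 1 ≤ floorSum c ε q n) {p : ℕ} [hp : Fact p.Prime]
    {s t : ℕ} (hst : s ≤ t) (n : Fin d → ℕ) :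
    PadicDvd p (levelSum c ε p (s + 1) n - s + (t + 1) - levelSum c ε p (t + 1) (vdiv n p))
      (stepApprox c ε p (t + 1) n - stepApprox c ε p t n) := by
  classical
  by_cases hex : ∃ r ≤ t + 1, ¬ Wraps c (p ^ (r + 1)) n
  swap
  · have hex' : ¬ ∃ r ≤ t, ¬ Wraps c (p ^ (r + 1)) n :=
      fun ⟨r, hr, h⟩ => hex ⟨r, by omega, h⟩
    rw [stepApprox, if_neg hex, stepApprox, if_neg hex', sub_zero]
    exact PadicDvd.zero
  -- Let `r + 1` be the first level at which the linear forms do not wrap around.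
  have hex₀ : ∃ r, ¬ Wraps c (p ^ (r + 1)) n := ⟨hex.choose, hex.choose_spec.2⟩
  set r := Nat.find hex₀ with hr
  have hwr : ¬ Wraps c (p ^ (r + 1)) n := Nat.find_spec hex₀
  have hlt : ∀ l, 1 ≤ l → l < r + 1 → Wraps c (p ^ l) n := by
    intro l hl hlr
    obtain ⟨l, rfl⟩ := Nat.exists_eq_add_of_le' hl
    exact not_not.mp (Nat.find_min hex₀ (m := l) (by omega))
  have hrt : r ≤ t + 1 := by
    obtain ⟨r', hr', h'⟩ := hex
    exact (Nat.find_min' hex₀ h').trans hr'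
  have hval := padicDvd_ratioStep_vmod hbal hrt hwr
  have hsum : levelSum c ε p (s + 1) n + (r - s) ≤ levelSum c ε p (t + 1 + 1) n := by
    rcases le_total s r with hsr | hsr
    · have h1 := levelSum_add_le hwrap hp.out.pos (s := s + 1) (t := r + 1) (by omega) (n := n)
        fun l hl hl' => hlt l (by omega) hl'
      have h2 := levelSum_mono hpos hp.out.pos (p := p) (s := r + 1) (t := t + 1 + 1) (by omega) n
      omega
    · have h2 := levelSum_mono hpos hp.out.pos (p := p) (s := s + 1) (t := t + 1 + 1) (by omega) n
      omega
  have hdiff : PadicDvd p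
      (levelSum c ε p (t + 1 + 1) n - levelSum c ε p (t + 1) (vdiv n p) + (t + 1 - r))
      (stepApprox c ε p (t + 1) n - stepApprox c ε p t n) := by
    rw [stepApprox, if_pos hex]
    by_cases hrt' : r ≤ t
    · rw [stepApprox, if_pos ⟨r, hrt', hwr⟩]
      set n' := vmod n (p ^ (t + 1 + 1)) with hn'
      have h1 : vmod n' (p ^ (t + 1)) = vmod n (p ^ (t + 1)) :=
        vmod_vmod_of_dvd n (pow_dvd_pow p (Nat.le_succ _))
      have h2 : ¬ Wraps c (p ^ (r + 1)) n' := by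
        rwa [wraps_congr (pow_dvd_pow p (Nat.succ_le_succ hrt')) h1]
      have h3 := padicDvd_ratioStep_div_sub_one hbal hrt' h2
      rw [h1] at h3
      have h4 : ratioStep c ε p n' ≠ 0 := ratioStep_ne_zero p n'
      have h5 : ratioStep c ε p n' - ratioStep c ε p (vmod n (p ^ (t + 1))) =
          -(ratioStep c ε p n' *
            (ratioStep c ε p (vmod n (p ^ (t + 1))) / ratioStep c ε p n' - 1)) := by
        field_simp
        ring
      rw [h5]
      exact (hval.mul h3).neg
    · have h1 : ¬ ∃ r ≤ t, ¬ Wraps c (p ^ (r + 1)) n := fun ⟨r', hr', h'⟩ =>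
        hrt' ((Nat.find_min' hex₀ h').trans hr')
      rw [stepApprox, if_neg h1, sub_zero]
      exact hval.mono (by omega)
  exact hdiff.mono (by omega)

end Approximation

/-! ### The congruence `p h(z) ≡ h(zᵖ)` -/

section Congruence

variable {d : ℕ} {ι : Type*} [Fintype ι] {c : ι → Fin d → ℕ} {ε : ι → ℤ}
  {H h : (Fin d → ℕ) → ℚ}

/-- Functions on residue classes modulo `q`, as finite combinations of the indicator functions. -/
theorem defect_mul_of_vmod {q : ℕ} (hq : 0 < q) {g A : (Fin d → ℕ) → ℚ}
    (hg : ∀ n, g n = g (vmod n q)) (m : Fin d → ℕ) :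
    defect H h (fun n => g n * A n) m =
      ∑ κ ∈ Fintype.piFinset fun _ : Fin d => Finset.range q,
        g κ * defect H h (onClass κ q A) m := by
  simp_rw [← defect_const_mul]
  rw [← defect_sum]
  refine defect_congr fun n _ => ?_
  have hmem : vmod n q ∈ Fintype.piFinset fun _ : Fin d => Finset.range q :=
    Fintype.mem_piFinset.mpr fun k => Finset.mem_range.mpr (Nat.mod_lt _ hq)
  rw [Finset.sum_eq_single_of_mem _ hmem]
  · rw [← hg, onClass, if_pos (vmod_vmod_of_dvd n dvd_rfl).symm]
  · intro κ hκ hne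
    have h1 : vmod κ q = κ := funext fun k =>
      Nat.mod_eq_of_lt (Finset.mem_range.mp (Fintype.mem_piFinset.mp hκ k))
    rw [onClass, h1, if_neg (fun h' => hne h'.symm), mul_zero]

/-- Telescoping the approximations of `Q(n) / Q(⌊n / p⌋)` turns bounds for the defects on all
residue classes at one exponent into bounds for the defects of `K ↦ Q(a + p K)`. -/
theorem padicDvd_defect_onClass_comp (hbal : ∀ k, ∑ i, ε i * (c i k : ℤ) = 0)
    (hpos : ∀ q n, 0 < q → 0 ≤ floorSum c ε q n)
    (hwrap : ∀ q n, 0 < q → Wraps c q n → 1 ≤ floorSum c ε q n) {p : ℕ} [hp : Fact p.Prime]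
    {m : Fin d → ℕ}
    (ih : ∀ U s, PadicDvd p (1 - s + levelSum c ε p s U)
      (defect H h (onClass U (p ^ s) (ratio c ε)) m)) (a U : Fin d → ℕ) (s : ℕ) :
    PadicDvd p (1 - s + levelSum c ε p (s + 1) U)
      (defect H h (fun K => onClass U (p ^ (s + 1)) (ratio c ε) (vmod a p + p • K)) m) := by
  classical
  have hpp := hp.out.pos
  by_cases haU : vmod a p = vmod U p
  swap
  · have h1 : ∀ K, onClass U (p ^ (s + 1)) (ratio c ε) (vmod a p + p • K) = 0 := by
      intro K
      rw [onClass, if_neg]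
      intro h'
      have h2 := vmod_eq_of_dvd (dvd_pow_self p (Nat.succ_ne_zero s)) h'
      rw [vmod_vmod_add_smul] at h2
      exact haU h2
    simp_rw [h1]
    rw [defect_zero]
    exact PadicDvd.zero
  set u := vdiv U p with hu
  let τ : ℕ → (Fin d → ℕ) → ℚ := fun t K => stepApprox c ε p t (vmod a p + p • K)
  let A : ℕ → (Fin d → ℕ) → ℚ := fun t K =>
    (if vmod K (p ^ s) = vmod u (p ^ s) then τ t K else 0) * ratio c ε K
  have hvmod : ∀ (t : ℕ) (K K' : Fin d → ℕ), vmod K (p ^ t) = vmod K' (p ^ t) →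
      vmod (vmod a p + p • K) (p ^ (t + 1)) = vmod (vmod a p + p • K') (p ^ (t + 1)) := by
    intro t K K' hKK
    rw [pow_succ', vmod_mul_eq_iff, vmod_vmod_add_smul, vmod_vmod_add_smul,
      vdiv_vmod_add_smul hpp, vdiv_vmod_add_smul hpp]
    exact ⟨rfl, hKK⟩
  have hclass : ∀ K, vmod (vmod a p + p • K) (p ^ (s + 1)) = vmod U (p ^ (s + 1)) ↔
      vmod K (p ^ s) = vmod u (p ^ s) := by
    intro K
    rw [pow_succ', vmod_mul_eq_iff, vmod_vmod_add_smul, vdiv_vmod_add_smul hpp]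
    exact and_iff_right haU
  have hlevel : ∀ K, vmod K (p ^ s) = vmod u (p ^ s) →
      levelSum c ε p (s + 1) (vmod a p + p • K) = levelSum c ε p (s + 1) U := fun K hK =>
    levelSum_congr hbal ((hclass K).mpr hK) (Nat.le_succ _)
  have hbound : ∀ t, s ≤ t → PadicDvd p (1 - s + levelSum c ε p (s + 1) U)
      (defect H h (A t) m) := by
    intro t hst
    induction t, hst using Nat.le_induction with
    | base =>
      have h1 : ∀ K, A s K = τ s u * onClass u (p ^ s) (ratio c ε) K := by
        intro K
        simp only [A, onClass]
        split_ifs with hK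
        · rw [show τ s K = τ s u from stepApprox_congr (hvmod s K u hK)]
        · ring
      rw [defect_congr fun K _ => h1 K, defect_const_mul]
      have h2 := padicDvd_stepApprox (ε := ε) hbal (p := p) s (vmod a p + p • u)
      rw [vdiv_vmod_add_smul hpp, hlevel u rfl] at h2
      exact (h2.mul (ih u s)).mono (by omega)
    | succ t hst iht =>
      have h1 : ∀ K, A (t + 1) K = A t K +
          (if vmod K (p ^ s) = vmod u (p ^ s) then τ (t + 1) K - τ t K else 0) * ratio c ε K := by
        intro K
        simp only [A]
        split_ifs <;> ring
      rw [defect_congr fun K _ => h1 K, defect_add]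
      refine iht.add ?_
      rw [defect_mul_of_vmod (q := p ^ (t + 1)) (pow_pos hpp _)
        (g := fun K => if vmod K (p ^ s) = vmod u (p ^ s) then τ (t + 1) K - τ t K else 0)]
      · refine PadicDvd.sum fun κ _ => ?_
        split_ifs with hκ
        · have h2 := padicDvd_stepApprox_succ_sub hbal hpos hwrap (p := p) hst (vmod a p + p • κ)
          rw [vdiv_vmod_add_smul hpp, hlevel κ hκ] at h2
          exact (h2.mul (ih κ (t + 1))).mono (by push_cast; omega)
        · rw [zero_mul]
          exact PadicDvd.zero
      · intro K
        have h2 : vmod (vmod K (p ^ (t + 1))) (p ^ (t + 1)) = vmod K (p ^ (t + 1)) :=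
          vmod_vmod_of_dvd K dvd_rfl
        have h3 : vmod (vmod K (p ^ (t + 1))) (p ^ t) = vmod K (p ^ t) :=
          vmod_vmod_of_dvd K (pow_dvd_pow p (Nat.le_succ t))
        have h4 : vmod (vmod K (p ^ (t + 1))) (p ^ s) = vmod K (p ^ s) :=
          vmod_vmod_of_dvd K (pow_dvd_pow p (by omega))
        simp only [h4]
        rw [show τ (t + 1) (vmod K (p ^ (t + 1))) = τ (t + 1) K from
            stepApprox_congr (hvmod _ _ _ h2),
          show τ t (vmod K (p ^ (t + 1))) = τ t K from stepApprox_congr (hvmod _ _ _ h3)]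
  -- For exponents bounded by `m`, the approximations are eventually exact. The coordinates are
  -- added to the linear forms, so that the exponents themselves are bounded as well.
  obtain ⟨b, hb⟩ := exists_forall_dotProduct_lt_pow
    (fun i : ι ⊕ Fin d => Sum.elim c (fun k => Pi.single k 1) i) hp.out.one_lt
    (vmod a p + p • m)
  have hex : defect H h (fun K => onClass U (p ^ (s + 1)) (ratio c ε) (vmod a p + p • K)) m =
      defect H h (A (max b s)) m := by
    refine defect_congr fun K hK => ?_
    have hle : vmod a p + p • K ≤ vmod a p + p • m := by gcongr
    simp only [A, onClass, hclass]
    split_ifs with hKu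
    · rw [show τ (max b s) K = ratioStep c ε p (vmod a p + p • K) from
        stepApprox_eq_ratioStep (fun k => ?_) (fun i => ?_)]
      · rw [← ratioStep_mul_ratio p (vmod a p + p • K), vdiv_vmod_add_smul hpp]
      · have h1 := hb (max b s + 1) (by omega) (Sum.inr k)
        simp only [Sum.elim_inr, single_dotProduct, one_mul] at h1
        exact (hle k).trans_lt h1
      · exact (dotProduct_le_dotProduct_of_nonneg_left hle (zero_le (a := c i))).trans_lt
          (hb (max b s + 1) (by omega) (Sum.inl i))
    · rw [zero_mul]
  rw [hex]
  exact hbound _ (le_max_right b s)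

/-- The congruence `p h(z) ≡ h(zᵖ)` modulo `p` for a series `h` with
`∑ₙ Q(n) H(n) zⁿ = h(z) ∑ₙ Q(n) zⁿ`, proved together with bounds for the defects of this identity
on residue classes, by induction on the exponent. -/
theorem padicDvd_defect_and_dworkDefect (hbal : ∀ k, ∑ i, ε i * (c i k : ℤ) = 0)
    (hpos : ∀ q n, 0 < q → 0 ≤ floorSum c ε q n)
    (hwrap : ∀ q n, 0 < q → Wraps c q n → 1 ≤ floorSum c ε q n) {p : ℕ} [hp : Fact p.Prime]
    (hh : ∀ m, defect H h (ratio c ε) m = 0) (H0 : H 0 = 0)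
    (hH : ∀ s n, PadicDvd p (1 - s + levelSum c ε p (s + 1) n)
      (ratio c ε n * (p * H n - H (vdiv n p)))) (m : Fin d → ℕ) :
    (∀ U s, PadicDvd p (1 - s + levelSum c ε p s U)
      (defect H h (onClass U (p ^ s) (ratio c ε)) m)) ∧
    PadicDvd p 1 (dworkDefect p h m) := by
  have hpp := hp.out.pos
  have hIic0 : Finset.Iic (0 : Fin d → ℕ) = {0} := by
    ext n
    simp
  have h0 : h 0 = 0 := by
    have h1 := hh 0
    simpa [defect, hIic0, H0, ratio_zero] using h1
  induction m using WellFoundedLT.induction with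
  | _ m ih =>
  by_cases hm0 : m = 0
  · subst hm0
    refine ⟨fun U s => ?_, ?_⟩
    · have h1 : defect H h (onClass U (p ^ s) (ratio c ε)) 0 = 0 := by
        simp [defect, hIic0, H0, h0]
      rw [h1]
      exact PadicDvd.zero
    · have h1 : dworkDefect p h (0 : Fin d → ℕ) = 0 := by
        have h2 : vdiv (0 : Fin d → ℕ) p = 0 := by
          funext k
          simp [vdiv]
        simp [dworkDefect, h2, h0]
      rw [h1]
      exact PadicDvd.zero
  have hlt : vdiv m p < m := by
    refine lt_of_le_of_ne (fun k => Nat.div_le_self _ _) fun h' => hm0 ?_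
    funext k
    have h1 : m k / p = m k := congrFun h' k
    by_contra h2
    exact (Nat.div_lt_self (Nat.pos_of_ne_zero h2) hp.out.one_lt).ne h1
  -- The bound for the Frobenius defect uses the induction hypothesis at `⌊m / p⌋` only.
  have hfrob : ∀ U s, PadicDvd p (1 - s + levelSum c ε p (s + 1) U)
      (frobeniusDefect p H h (onClass U (p ^ (s + 1)) (ratio c ε)) m) := by
    intro U s
    rw [frobeniusDefect_eq hpp]
    refine (padicDvd_defect_onClass_comp hbal hpos hwrap (ih _ hlt).1 m U s).add ?_
    rw [onClass]
    split_ifs with hU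
    · rw [← levelSum_congr hbal hU (Nat.le_succ _)]
      exact hH s m
    · rw [zero_mul]
      exact PadicDvd.zero
  have hdwork : PadicDvd p 1 (dworkDefect p h m) := by
    have h1 := prime_mul_defect (H := H) (h := h) (A := ratio c ε) p m
    have h2 : frobeniusDefect p H h (ratio c ε) m =
        frobeniusDefect p H h (onClass m (p ^ (0 + 1)) (ratio c ε)) m := by
      rw [frobeniusDefect_eq hpp, frobeniusDefect_eq hpp]
      simp only [onClass, zero_add, pow_one, vmod_vmod_add_smul, if_true]
    have h3 : PadicDvd p 1 (frobeniusDefect p H h (ratio c ε) m) := by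
      rw [h2]
      refine (hfrob m 0).mono ?_
      have : 0 ≤ levelSum c ε p (0 + 1) m :=
        Finset.sum_nonneg fun l _ => hpos _ _ (pow_pos hpp l)
      rw [Nat.cast_zero, sub_zero]
      exact le_add_of_nonneg_right this
    rw [hh, mul_zero,
      ← Finset.add_sum_erase _ _ (Finset.mem_Iic.mpr (zero_le : (0 : Fin d → ℕ) ≤ m)),
      ratio_zero, one_mul, tsub_zero] at h1
    have h4 : dworkDefect p h m = frobeniusDefect p H h (ratio c ε) m -
        ∑ n ∈ (Finset.Iic m).erase 0, ratio c ε n * dworkDefect p h (m - n) := by linarith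
    rw [h4]
    refine h3.sub (PadicDvd.sum fun n hn => ?_)
    obtain ⟨hn0, hnm⟩ := Finset.mem_erase.mp hn
    have h5 : m - n < m := by
      refine lt_of_le_of_ne tsub_le_self fun h' => hn0 ?_
      have h6 := tsub_add_cancel_of_le (Finset.mem_Iic.mp hnm)
      rw [h'] at h6
      simpa using h6
    have h7 : PadicDvd p 0 (ratio c ε n) := by
      simpa [levelSum] using padicDvd_ratio hbal hpos (p := p) 0 n
    exact h7.mul_left (ih _ h5).2
  refine ⟨fun U s => ?_, hdwork⟩
  rcases s with _ | s
  · have h1 : defect H h (onClass U (p ^ 0) (ratio c ε)) m = 0 := by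
      rw [← hh m]
      refine defect_congr fun n _ => ?_
      rw [onClass, if_pos]
      funext k
      simp [vmod, Nat.mod_one]
    rw [h1]
    exact PadicDvd.zero
  · apply PadicDvd.of_prime_mul
    rw [prime_mul_defect]
    refine ((hfrob U s).mono (by push_cast; omega)).sub (PadicDvd.sum fun n hn => ?_)
    have h1 : PadicDvd p 1 (dworkDefect p h (m - n)) := by
      by_cases hn0 : m - n = m
      · rw [hn0]
        exact hdwork
      · exact (ih _ (lt_of_le_of_ne tsub_le_self hn0)).2
    rw [onClass]
    split_ifs with hU
    · have h2 := (padicDvd_ratio hbal hpos (p := p) (s + 1) n).mul h1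
      rw [levelSum_congr hbal hU (by omega : s + 1 ≤ s + 1 + 1)] at h2
      exact h2.mono (by push_cast; omega)
    · rw [zero_mul]
      exact PadicDvd.zero

end Congruence

/-! ### Compositional inverses -/

section Inverse

open MvPowerSeries

variable {σ R : Type*} [CommRing R]

theorem coeff_prod_pow_congr {v w : σ → MvPowerSeries σ R} {n : σ →₀ ℕ}
    (h : ∀ j, ∀ l ≤ n, coeff l (v j) = coeff l (w j)) (m : σ →₀ ℕ) :
    ∀ l ≤ n, coeff l (m.prod fun j e => v j ^ e) = coeff l (m.prod fun j e => w j ^ e) := by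
  classical
  have hmul : ∀ a a' b b' : MvPowerSeries σ R, (∀ l ≤ n, coeff l a = coeff l a') →
      (∀ l ≤ n, coeff l b = coeff l b') → ∀ l ≤ n, coeff l (a * b) = coeff l (a' * b') := by
    intro a a' b b' ha hb l hl
    rw [coeff_mul_eq_sum_Iic, coeff_mul_eq_sum_Iic]
    refine Finset.sum_congr rfl fun m hm => ?_
    rw [ha m ((Finset.mem_Iic.mp hm).trans hl), hb _ (tsub_le_self.trans hl)]
  have hpow : ∀ j (e : ℕ), ∀ l ≤ n, coeff l (v j ^ e) = coeff l (w j ^ e) := by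
    intro j e
    induction e with
    | zero => intro l _; rw [pow_zero, pow_zero]
    | succ e ih => rw [pow_succ, pow_succ]; exact hmul _ _ _ _ ih (h j)
  exact Finset.prod_hom_rel (r := fun a a' => ∀ l ≤ n, coeff l a = coeff l a')
    (fun _ _ => rfl) fun j _ _ hbc => hmul _ _ _ _ (hpow j _) hbc

theorem coeff_prod_pow_mem (A : Subring R) {v : σ → MvPowerSeries σ R} {n : σ →₀ ℕ}
    (h : ∀ j, ∀ l ≤ n, coeff l (v j) ∈ A) (m : σ →₀ ℕ) :
    ∀ l ≤ n, coeff l (m.prod fun j e => v j ^ e) ∈ A :=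
  Finset.prod_induction _ (fun a => ∀ l ≤ n, coeff l a ∈ A)
    (fun _ _ ha hb _ hl => coeff_mul_mem A (fun k hk => ha k (hk.trans hl))
      fun k hk => hb k (hk.trans hl))
    (fun l _ => coeff_one_mem A l) fun j _ => coeff_pow_mem A (h j) _

theorem degree_lt_of_lt {l n : σ →₀ ℕ} (h : l < n) : l.degree < n.degree := by
  refine lt_of_le_of_ne (Finsupp.degree_mono h.le) fun h' => h.not_ge ?_
  have h1 : (n - l).degree + l.degree = n.degree := by
    rw [← map_add, tsub_add_cancel_of_le h.le]
  have h2 : n - l = 0 := (Finsupp.degree_eq_zero_iff _).mp (by omega)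
  exact tsub_eq_zero_iff_le.mp h2

theorem tsub_lt_of_ne_zero {n m : σ →₀ ℕ} (hm : m ≤ n) (hm0 : m ≠ 0) : n - m < n := by
  refine lt_of_le_of_ne tsub_le_self fun h => hm0 ?_
  have h1 := tsub_add_cancel_of_le hm
  rw [h] at h1
  simpa using h1

variable [Finite σ]

theorem hasSubst_X_mul (v : σ → MvPowerSeries σ R) : HasSubst fun j => X j * v j :=
  hasSubst_of_constantCoeff_zero fun j => by simp

theorem coeff_subst_X_mul [DecidableEq σ] (f : MvPowerSeries σ R) (v : σ → MvPowerSeries σ R)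
    (n : σ →₀ ℕ) :
    coeff n (f.subst fun j => X j * v j) =
      ∑ m ∈ Finset.Iic n, coeff m f * coeff (n - m) (m.prod fun j e => v j ^ e) := by
  have hprod : ∀ m : σ →₀ ℕ, (m.prod fun j e => (X j * v j) ^ e) =
      monomial m (1 : R) * m.prod fun j e => v j ^ e := by
    intro m
    simp only [mul_pow, Finsupp.prod_mul]
    congr 1
    rw [monomial_one_eq]
  rw [coeff_subst (hasSubst_X_mul v), finsum_eq_sum_of_support_subset (s := Finset.Iic n)]
  · refine Finset.sum_congr rfl fun m hm => ?_
    rw [hprod, coeff_monomial_mul, if_pos (Finset.mem_Iic.mp hm), one_mul, smul_eq_mul]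
  · intro m hm
    by_contra hmn
    rw [Finset.coe_Iic, Set.mem_Iic] at hmn
    rw [Function.mem_support, hprod, coeff_monomial_mul, if_neg hmn, smul_zero] at hm
    exact hm rfl

/-- The coefficient of `zⁿ` in `f(z v(z))` involves the coefficients of `v` below `n` only. -/
theorem coeff_subst_X_mul_congr (f : MvPowerSeries σ R) {v w : σ → MvPowerSeries σ R}
    {n : σ →₀ ℕ} (h : ∀ j, ∀ l < n, coeff l (v j) = coeff l (w j)) :
    coeff n (f.subst fun j => X j * v j) = coeff n (f.subst fun j => X j * w j) := by
  classical
  rw [coeff_subst_X_mul, coeff_subst_X_mul]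
  refine Finset.sum_congr rfl fun m hm => ?_
  by_cases hm0 : m = 0
  · simp [hm0]
  · rw [coeff_prod_pow_congr (n := n - m) (fun j l hl => h j l
      (lt_of_le_of_lt hl (tsub_lt_of_ne_zero (Finset.mem_Iic.mp hm) hm0))) m _ le_rfl]

/-- The fixed point equation `v = E(z v)` has a solution, obtained by iteration. -/
theorem exists_eq_subst_X_mul (E : σ → MvPowerSeries σ R) :
    ∃ v : σ → MvPowerSeries σ R, ∀ k, v k = (E k).subst fun j => X j * v j := by
  let Ψ : (σ → MvPowerSeries σ R) → σ → MvPowerSeries σ R :=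
    fun v k => (E k).subst fun j => X j * v j
  let V : ℕ → σ → MvPowerSeries σ R := fun t => Ψ^[t] 1
  have hV : ∀ t, V (t + 1) = Ψ (V t) := fun t => Function.iterate_succ_apply' Ψ t 1
  have hstab : ∀ t k (n : σ →₀ ℕ), n.degree < t → coeff n (V t k) = coeff n (V (t + 1) k) := by
    intro t
    induction t with
    | zero => intro k n hn; omega
    | succ t ih =>
      intro k n hn
      rw [hV (t + 1), hV t]
      refine coeff_subst_X_mul_congr _ fun j l hl => ?_
      have h1 : l.degree < n.degree := degree_lt_of_lt hl
      have h2 := ih j l (by omega)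
      rwa [hV t] at h2
  have hstab' : ∀ k (n : σ →₀ ℕ) t, n.degree + 1 ≤ t →
      coeff n (V t k) = coeff n (V (n.degree + 1) k) := by
    intro k n t ht
    induction t, ht using Nat.le_induction with
    | base => rfl
    | succ t ht ih => rw [← hstab t k n ht, ih]
  let v : σ → MvPowerSeries σ R := fun k n => coeff n (V (n.degree + 1) k)
  refine ⟨v, fun k => ?_⟩
  ext n
  calc coeff n (v k) = coeff n (V (n.degree + 1) k) := rfl
    _ = coeff n (V (n.degree + 1 + 1) k) := (hstab' k n _ (Nat.le_succ _)).symm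
    _ = coeff n (Ψ (V (n.degree + 1)) k) := by rw [hV]
    _ = coeff n (Ψ v k) := coeff_subst_X_mul_congr _ fun j l hl =>
        hstab' j l _ (by have := degree_lt_of_lt hl; omega)

theorem constantCoeff_eq_one_of_eq_subst {E v : σ → MvPowerSeries σ R}
    (hE : ∀ k, constantCoeff (E k) = 1) (hv : ∀ k, v k = (E k).subst fun j => X j * v j) (k : σ) :
    constantCoeff (v k) = 1 := by
  classical
  have h1 : (Finset.Iic 0 : Finset (σ →₀ ℕ)) = {0} := by
    ext m
    simp
  rw [← coeff_zero_eq_constantCoeff_apply, hv k, coeff_subst_X_mul, h1, Finset.sum_singleton]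
  simp [hE]

/-- For a solution of `v = E(z v)`, the coefficients of `zⁿ` in `v` and `E` agree up to the ring
generated by the coefficients of lower order. -/
theorem coeff_sub_coeff_mem {E v : σ → MvPowerSeries σ R} (hE : ∀ k, constantCoeff (E k) = 1)
    (hv : ∀ k, v k = (E k).subst fun j => X j * v j) (A : Subring R) {n : σ →₀ ℕ}
    (hvA : ∀ k, ∀ l < n, coeff l (v k) ∈ A) (hEA : ∀ k, ∀ l < n, coeff l (E k) ∈ A) (k : σ) :
    coeff n (v k) - coeff n (E k) ∈ A := by
  classical
  have h0 := constantCoeff_eq_one_of_eq_subst hE hv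
  rw [congrArg (coeff n) (hv k), coeff_subst_X_mul,
    ← Finset.add_sum_erase _ _ (Finset.mem_Iic.mpr (le_refl n)), tsub_self]
  have h1 : coeff 0 (n.prod fun j e => v j ^ e) = 1 := by
    rw [coeff_zero_eq_constantCoeff_apply, Finsupp.prod, map_prod]
    refine Finset.prod_eq_one fun j _ => ?_
    rw [map_pow, h0, one_pow]
  rw [h1, mul_one, add_sub_cancel_left]
  refine A.sum_mem fun m hm => ?_
  obtain ⟨hmn, hm⟩ := Finset.mem_erase.mp hm
  have hlt : m < n := lt_of_le_of_ne (Finset.mem_Iic.mp hm) hmn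
  refine A.mul_mem (hEA k m hlt) ?_
  by_cases hm0 : m = 0
  · rw [hm0, Finsupp.prod_zero_index]
    exact coeff_one_mem A _
  · exact coeff_prod_pow_mem A (n := n - m) (fun j l hl => hvA j l
      (lt_of_le_of_lt hl (tsub_lt_of_ne_zero hlt.le hm0))) m _ le_rfl

theorem subst_X_mul_eq_X {E E' v : σ → MvPowerSeries σ R} (hE : ∀ k, E k * E' k = 1)
    (hv : ∀ k, v k = (E' k).subst fun j => X j * v j) (k : σ) :
    (X k * E k).subst (fun j => X j * v j) = X k := by
  have hs := hasSubst_X_mul v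
  have h1 : (E k).subst (fun j => X j * v j) * v k = 1 := by
    conv_lhs => enter [2]; rw [hv k]
    rw [← subst_mul hs, hE, ← coe_substAlgHom hs, map_one]
  rw [subst_mul hs, subst_X hs, mul_assoc, mul_comm (v k), h1, mul_one]

end Inverse

/-- The compositional inverse of `z E(z)` is `z v(z)`, where `v` solves `v = E'(z v)` for the
reciprocals `E'` of the series `E`. -/
theorem exists_isCompInverse {d : ℕ} {E E' : Fin d → MvPowerSeries (Fin d) ℚ}
    (hE : ∀ k, E k * E' k = 1) (hE' : ∀ k, MvPowerSeries.constantCoeff (E' k) = 1) :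
    ∃ v : Fin d → MvPowerSeries (Fin d) ℚ,
      (∀ k, v k = (E' k).subst fun j => MvPowerSeries.X j * v j) ∧
      IsCompInverse (fun k => MvPowerSeries.X k * E k) fun k => MvPowerSeries.X k * v k := by
  obtain ⟨v, hv⟩ := exists_eq_subst_X_mul E'
  have hv0 : ∀ k, MvPowerSeries.constantCoeff (v k) ≠ 0 := fun k => by
    rw [constantCoeff_eq_one_of_eq_subst hE' hv]
    exact one_ne_zero
  -- `z v` has a right inverse `z w` as well. It equals `z E`, which is a left inverse of `z v`.
  obtain ⟨w, hw⟩ := exists_eq_subst_X_mul fun k => (v k)⁻¹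
  have hvw : ∀ k, v k * (v k)⁻¹ = 1 := fun k => MvPowerSeries.mul_inv_cancel _ (hv0 k)
  have h1 := subst_X_mul_eq_X hE hv
  have h2 := subst_X_mul_eq_X hvw hw
  have hsv := hasSubst_X_mul v
  have hsw := hasSubst_X_mul w
  have h3 : (fun k => MvPowerSeries.X k * E k) = fun k => MvPowerSeries.X k * w k := by
    funext k
    have h4 := MvPowerSeries.subst_comp_subst_apply (R := ℚ) hsv hsw (MvPowerSeries.X k * E k)
    rw [h1, MvPowerSeries.subst_X hsw, funext h2] at h4
    rw [h4]
    exact (congrFun MvPowerSeries.subst_self _).symm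
  refine ⟨v, hv, ⟨by simp, by simp, h1, ?_⟩⟩
  rw [h3]
  exact h2

/-! ### The Landau function at real points -/

section Floors

variable {d : ℕ} {ι : Type*}

/-- The integer parts `⌊cᵢ · x⌋` of linear forms. -/
noncomputable def floors (c : ι → Fin d → ℕ) (x : Fin d → ℝ) : ι → ℕ :=
  fun i => ⌊dotReal (c i) x⌋₊

/-- The point `n / q` for a vector `n` of natural numbers. -/
noncomputable def ratPoint (n : Fin d → ℕ) (q : ℕ) : Fin d → ℝ := fun k => (n k : ℝ) / q

theorem dotReal_mono (c : Fin d → ℕ) {x y : Fin d → ℝ} (h : x ≤ y) : dotReal c x ≤ dotReal c y :=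
  Finset.sum_le_sum fun k _ => mul_le_mul_of_nonneg_left (h k) (Nat.cast_nonneg _)

theorem dotReal_nonneg (c : Fin d → ℕ) {x : Fin d → ℝ} (h : 0 ≤ x) : 0 ≤ dotReal c x :=
  Finset.sum_nonneg fun k _ => mul_nonneg (Nat.cast_nonneg _) (h k)

theorem dotReal_ratPoint (c n : Fin d → ℕ) (q : ℕ) :
    dotReal c (ratPoint n q) = ((c ⬝ᵥ n : ℕ) : ℝ) / q := by
  simp only [dotReal, ratPoint, dotProduct, Nat.cast_sum, Nat.cast_mul, Finset.sum_div,
    mul_div_assoc]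

theorem floors_mono (c : ι → Fin d → ℕ) {x y : Fin d → ℝ} (h : x ≤ y) :
    floors c x ≤ floors c y :=
  fun i => Nat.floor_mono (dotReal_mono (c i) h)

theorem floors_ratPoint (c : ι → Fin d → ℕ) (n : Fin d → ℕ) (q : ℕ) (i : ι) :
    floors c (ratPoint n q) i = c i ⬝ᵥ n / q := by
  rw [floors, dotReal_ratPoint, Nat.floor_div_eq_div]

theorem ratPoint_nonneg (n : Fin d → ℕ) (q : ℕ) : 0 ≤ ratPoint n q :=
  fun _ => div_nonneg (Nat.cast_nonneg _) (Nat.cast_nonneg _)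

theorem ratPoint_mono {m n : Fin d → ℕ} (h : m ≤ n) (q : ℕ) : ratPoint m q ≤ ratPoint n q :=
  fun k => div_le_div_of_nonneg_right (Nat.cast_le.mpr (h k)) (Nat.cast_nonneg _)

theorem ratPoint_lt_one {n : Fin d → ℕ} {q : ℕ} (h : ∀ k, n k < q) (k : Fin d) :
    ratPoint n q k < 1 := by
  rw [ratPoint, div_lt_one (by exact_mod_cast Nat.zero_lt_of_lt (h k))]
  exact_mod_cast h k

/-- The integer parts of linear forms with natural coefficients are right-continuous. -/
theorem exists_floors_eq [Finite ι] (c : ι → Fin d → ℕ) {x : Fin d → ℝ} (hx : 0 ≤ x) :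
    ∃ δ > 0, ∀ y, x ≤ y → (∀ k, y k ≤ x k + δ) → floors c y = floors c x := by
  have h1 : ∀ᶠ δ : ℝ in nhdsWithin 0 (Set.Ioi 0), ∀ i,
      dotReal (c i) x + δ * ∑ k, (c i k : ℝ) < ⌊dotReal (c i) x⌋₊ + 1 := by
    rw [Filter.eventually_all]
    intro i
    have h2 : ContinuousAt (fun δ : ℝ => dotReal (c i) x + δ * ∑ k, (c i k : ℝ)) 0 := by fun_prop
    refine (h2.eventually_lt continuousAt_const ?_).filter_mono nhdsWithin_le_nhds
    simpa using Nat.lt_floor_add_one (dotReal (c i) x)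
  obtain ⟨δ, hδ, hδ0⟩ := (h1.and self_mem_nhdsWithin).exists
  refine ⟨δ, hδ0, fun y hxy hy => funext fun i => ?_⟩
  refine le_antisymm (Nat.lt_succ_iff.mp ?_) (floors_mono c hxy i)
  rw [floors, Nat.floor_lt (dotReal_nonneg _ (hx.trans hxy))]
  refine lt_of_le_of_lt ?_ ((hδ i).trans_eq (Nat.cast_add_one _).symm)
  calc dotReal (c i) y ≤ ∑ k, (c i k : ℝ) * (x k + δ) :=
        Finset.sum_le_sum fun k _ => mul_le_mul_of_nonneg_left (hy k) (Nat.cast_nonneg _)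
    _ = dotReal (c i) x + δ * ∑ k, (c i k : ℝ) := by
        simp only [mul_add, Finset.sum_add_distrib, dotReal, Finset.mul_sum]
        congr 1
        exact Finset.sum_congr rfl fun k _ => mul_comm _ _

/-- Every point `x ≥ 0` has points `n / q` just above it, for all large `q`. -/
theorem exists_ratPoint_near {x : Fin d → ℝ} (hx : 0 ≤ x) {δ : ℝ} (hδ : 0 < δ) :
    ∃ q₀ : ℕ, ∀ q ≥ q₀, ∃ n : Fin d → ℕ,
      x ≤ ratPoint n q ∧ ∀ k, ratPoint n q k ≤ x k + δ := by
  obtain ⟨q₀, hq₀⟩ := exists_nat_gt δ⁻¹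
  refine ⟨q₀, fun q hq => ⟨fun k => ⌈(q : ℝ) * x k⌉₊, fun k => ?_, fun k => ?_⟩⟩
  all_goals
    have hq' : δ⁻¹ < q := hq₀.trans_le (by exact_mod_cast hq)
    have hqpos : (0 : ℝ) < q := (inv_pos.mpr hδ).trans hq'
  · rw [ratPoint, le_div_iff₀ hqpos, mul_comm]
    exact Nat.le_ceil _
  · rw [ratPoint, div_le_iff₀ hqpos]
    have h1 := Nat.ceil_lt_add_one (mul_nonneg hqpos.le (hx k))
    have h2 : 1 < q * δ := by
      rwa [inv_lt_iff_one_lt_mul₀ hδ] at hq'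
    nlinarith

theorem dotProduct_lt_of_floors_lt {c : ι → Fin d → ℕ} {p : ℕ} (hp : 0 < p) {n : Fin d → ℕ} {i : ι}
    (h : floors c (ratPoint n p) i < p) : c i ⬝ᵥ n < p ^ 2 := by
  rw [floors_ratPoint, Nat.div_lt_iff_lt_mul hp] at h
  rwa [pow_two]

variable [Fintype ι]

/-- The value of the Landau function in terms of the integer parts of the linear forms. -/
def landauOf (ε : ι → ℤ) (φ : ι → ℕ) : ℤ := ∑ i, ε i * (φ i : ℤ)

/-- The value `∑ᵢ εᵢ cᵢ⁽ᵏ⁾ H_{φᵢ}`. -/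
def harmonicOf (c : ι → Fin d → ℕ) (ε : ι → ℤ) (k : Fin d) (φ : ι → ℕ) : ℚ :=
  ∑ i, (ε i : ℚ) * c i k * harmonic (φ i)

theorem floorSum_eq_landauOf (c : ι → Fin d → ℕ) (ε : ι → ℤ) (q : ℕ) (n : Fin d → ℕ) :
    floorSum c ε q n = landauOf ε (floors c (ratPoint n q)) := by
  simp only [floorSum, landauOf, floors_ratPoint]

end Floors

section LandauCriterion

variable {d : ℕ} {ι : Type*} [Fintype ι] {c : ι → Fin d → ℕ} {ε : ι → ℤ}

/-- The Landau function at rational points is nonnegative, as soon as it is so on the unit cube. -/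
theorem floorSum_nonneg (hbal : ∀ k, ∑ i, ε i * (c i k : ℤ) = 0)
    (hL : ∀ x ∈ Set.Icc (0 : Fin d → ℝ) 1, 0 ≤ landauOf ε (floors c x))
    {q : ℕ} (hq : 0 < q) (n : Fin d → ℕ) : 0 ≤ floorSum c ε q n := by
  rw [← floorSum_vmod hbal, floorSum_eq_landauOf]
  exact hL _ ⟨ratPoint_nonneg _ _, fun k =>
    (ratPoint_lt_one (fun k => Nat.mod_lt _ hq) k).le⟩

theorem exists_int_eq_ratio (hbal : ∀ k, ∑ i, ε i * (c i k : ℤ) = 0)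
    (hL : ∀ x ∈ Set.Icc (0 : Fin d → ℝ) 1, 0 ≤ landauOf ε (floors c x)) (n : Fin d → ℕ) :
    ∃ m : ℤ, ratio c ε n = m :=
  exists_int_eq_of_forall_padicDvd fun p _ => by
    simpa [levelSum] using padicDvd_ratio hbal (fun q n hq => floorSum_nonneg hbal hL hq n)
      (p := p) 0 n

/-- For `n` small with respect to `p ^ 2`, the valuation of `Q(n)` is the value of the Landau
function at `n / p`. -/
theorem padicValRat_ratio_eq_landauOf (hbal : ∀ k, ∑ i, ε i * (c i k : ℤ) = 0) {p : ℕ}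
    [hp : Fact p.Prime] {n : Fin d → ℕ} (h : ∀ i, c i ⬝ᵥ n < p ^ 2) :
    padicValRat p (ratio c ε n) = landauOf ε (floors c (ratPoint n p)) := by
  have h1 : floorSum c ε 1 n = 0 := by simpa [floorSum] using balanced_dotProduct hbal n
  rw [padicValRat_ratio hbal h, levelSum, Finset.sum_range_succ, Finset.sum_range_one, pow_zero,
    h1, zero_add, pow_one, floorSum_eq_landauOf]

/-- Approximating `x` from above by points `n / p` for a large prime `p`, the Landau function at `x`
is the `p`-adic valuation of `Q(n)`. -/
theorem landauOf_nonneg_of_ratio_int (hbal : ∀ k, ∑ i, ε i * (c i k : ℤ) = 0)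
    (hQ : ∀ n, ∃ m : ℤ, ratio c ε n = m) {x : Fin d → ℝ} (hx : 0 ≤ x) :
    0 ≤ landauOf ε (floors c x) := by
  obtain ⟨δ, hδ, hfl⟩ := exists_floors_eq c hx
  obtain ⟨q₀, hq₀⟩ := exists_ratPoint_near hx hδ
  obtain ⟨p, hpge, hp⟩ := Nat.exists_infinite_primes (q₀ + ∑ i, floors c x i + 1)
  have : Fact p.Prime := ⟨hp⟩
  obtain ⟨n, hn1, hn2⟩ := hq₀ p (by omega)
  have h1 := hfl _ hn1 hn2
  have h2 : ∀ i, c i ⬝ᵥ n < p ^ 2 := fun i => by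
    refine dotProduct_lt_of_floors_lt hp.pos ?_
    rw [h1]
    have := Finset.single_le_sum (f := floors c x) (fun _ _ => Nat.zero_le _) (Finset.mem_univ i)
    omega
  rw [← h1, ← padicValRat_ratio_eq_landauOf hbal h2]
  obtain ⟨m, hm⟩ := hQ n
  rw [hm, padicValRat.of_int]
  exact Int.natCast_nonneg _

end LandauCriterion

/-! ### Harmonic sums as integrals of the Landau function -/

section HarmonicIntegral

open MeasureTheory

theorem natCast_floor_div_eq_sum {a s : ℝ} (hs : 1 ≤ s) (ha : 0 ≤ a) :
    ((⌊a / s⌋₊ : ℕ) : ℝ) =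
      ∑ m ∈ Finset.Icc 1 ⌊a⌋₊, {t : ℝ | t ≤ a / m}.indicator (fun _ => (1 : ℝ)) s := by
  have hs0 : 0 < s := zero_lt_one.trans_le hs
  have h1 : (Finset.Icc 1 ⌊a⌋₊).filter (fun m : ℕ => s ≤ a / m) = Finset.Icc 1 ⌊a / s⌋₊ := by
    ext m
    rw [Finset.mem_filter, Finset.mem_Icc, Finset.mem_Icc]
    have h2 : ⌊a / s⌋₊ ≤ ⌊a⌋₊ := Nat.floor_mono (div_le_self ha hs)
    constructor
    · rintro ⟨⟨hm1, hm2⟩, hm3⟩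
      have hm0 : (0 : ℝ) < m := by exact_mod_cast hm1
      refine ⟨hm1, Nat.le_floor ?_⟩
      rwa [le_div_iff₀ hs0, mul_comm, ← le_div_iff₀ hm0]
    · rintro ⟨hm1, hm2⟩
      have hm0 : (0 : ℝ) < m := by exact_mod_cast hm1
      refine ⟨⟨hm1, hm2.trans h2⟩, ?_⟩
      have h3 := (Nat.le_floor_iff (div_nonneg ha hs0.le)).mp hm2
      rwa [le_div_iff₀ hs0, mul_comm, ← le_div_iff₀ hm0] at h3
  simp only [Set.indicator_apply, Set.mem_ofPred_eq]
  rw [← Finset.sum_filter, h1]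
  simp

theorem intervalIntegrable_floor_div {a u v : ℝ} (ha : 0 ≤ a) (hu : 0 < u) (hv : 0 < v) :
    IntervalIntegrable (fun s => ((⌊a / s⌋₊ : ℕ) : ℝ)) volume u v := by
  refine AntitoneOn.intervalIntegrable fun s hs t _ hst => ?_
  have hs0 : 0 < s := (lt_min hu hv).trans_le hs.1
  exact Nat.cast_le.mpr (Nat.floor_mono (div_le_div_of_nonneg_left ha hs0 hst))

/-- Harmonic numbers as integrals of integer parts. -/
theorem integral_floor_div {a A : ℝ} (ha : 0 ≤ a) (hA : 1 ≤ A) (haA : a ≤ A) :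
    ∫ s in (1 : ℝ)..A, ((⌊a / s⌋₊ : ℕ) : ℝ) = a * (harmonic ⌊a⌋₊ : ℚ) - ⌊a⌋₊ := by
  have h1 : ∀ m ∈ Finset.Icc 1 ⌊a⌋₊, a / m ∈ Set.Icc 1 A := by
    intro m hm
    rw [Finset.mem_Icc] at hm
    have hm1 : (1 : ℝ) ≤ m := by exact_mod_cast hm.1
    constructor
    · rw [le_div_iff₀ (by linarith), one_mul]
      exact (Nat.le_floor_iff ha).mp hm.2
    · exact (div_le_self ha hm1).trans haA
  have hint : ∀ m : ℕ, IntervalIntegrable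
      ({t : ℝ | t ≤ a / m}.indicator (fun _ => (1 : ℝ))) volume 1 A := by
    intro m
    refine AntitoneOn.intervalIntegrable fun s _ t _ hst => ?_
    simp only [Set.indicator_apply, Set.mem_ofPred_eq]
    split_ifs with h2 h3
    · exact le_rfl
    · exact absurd (hst.trans h2) h3
    · exact zero_le_one
    · exact le_rfl
  calc ∫ s in (1 : ℝ)..A, ((⌊a / s⌋₊ : ℕ) : ℝ)
      = ∫ s in (1 : ℝ)..A, ∑ m ∈ Finset.Icc 1 ⌊a⌋₊,
          {t : ℝ | t ≤ a / m}.indicator (fun _ => (1 : ℝ)) s := by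
        refine intervalIntegral.integral_congr fun s hs => ?_
        rw [Set.uIcc_of_le hA] at hs
        exact natCast_floor_div_eq_sum hs.1 ha
    _ = ∑ m ∈ Finset.Icc 1 ⌊a⌋₊, (a / m - 1) := by
        rw [intervalIntegral.integral_finsetSum fun m _ => hint m]
        refine Finset.sum_congr rfl fun m hm => ?_
        rw [intervalIntegral.integral_indicator (h1 m hm)]
        simp
    _ = a * (harmonic ⌊a⌋₊ : ℚ) - ⌊a⌋₊ := by
        rw [Finset.sum_sub_distrib, harmonic_eq_sum_Icc]
        simp [Finset.mul_sum, div_eq_mul_inv]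

end HarmonicIntegral

section Positivity

variable {d : ℕ} {ι : Type*} {c : ι → Fin d → ℕ} {ε : ι → ℤ}

/-- Distinct linear forms take distinct values at a suitable point `x + (τ, τ², …, τᵈ)` just above
`x`. -/
theorem exists_generic_point [Finite ι] (c : ι → Fin d → ℕ) {x : Fin d → ℝ} (hx : 0 ≤ x)
    (hx1 : ∀ k, x k < 1) :
    ∃ y, x ≤ y ∧ (∀ k, y k < 1) ∧ floors c y = floors c x ∧
      ∀ i j, c i ≠ c j → dotReal (c i) y ≠ dotReal (c j) y := by
  classical
  obtain ⟨δ, hδ, hfl⟩ := exists_floors_eq c hx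
  let Y : ℝ → Fin d → ℝ := fun τ k => x k + τ ^ ((k : ℕ) + 1)
  let P : ι → ι → Polynomial ℝ := fun i j =>
    ∑ k, Polynomial.C ((c i k : ℝ) - c j k) * (Polynomial.C (x k) + Polynomial.X ^ ((k : ℕ) + 1))
  have hPeval : ∀ i j τ, (P i j).eval τ = dotReal (c i) (Y τ) - dotReal (c j) (Y τ) := by
    intro i j τ
    simp only [P, Y, dotReal, Polynomial.eval_finsetSum, Polynomial.eval_mul, Polynomial.eval_C,
      Polynomial.eval_add, Polynomial.eval_pow, Polynomial.eval_X, ← Finset.sum_sub_distrib,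
      sub_mul]
  have hP : ∀ i j, c i ≠ c j → P i j ≠ 0 := by
    intro i j hij h0
    refine hij (funext fun k => ?_)
    have h1 : (P i j).coeff ((k : ℕ) + 1) = (c i k : ℝ) - c j k := by
      simp only [P, Polynomial.finsetSum_coeff, Polynomial.coeff_C_mul, Polynomial.coeff_add,
        Polynomial.coeff_C_succ, Polynomial.coeff_X_pow, zero_add, add_left_inj, Fin.val_inj]
      simp
    rw [h0, Polynomial.coeff_zero] at h1
    exact_mod_cast (sub_eq_zero.mp h1.symm)
  have hev : ∀ᶠ τ : ℝ in nhdsWithin 0 (Set.Ioi 0),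
      (∀ k, (Y τ) k < x k + δ) ∧ (∀ k, Y τ k < 1) ∧ ∀ i j, c i ≠ c j → ¬ (P i j).IsRoot τ := by
    have hcont : ∀ k, ContinuousAt (fun τ => Y τ k) 0 := fun k => by
      simp only [Y]
      fun_prop
    have hY0 : ∀ k, Y 0 k = x k := fun k => by simp [Y]
    refine Filter.Eventually.and (Filter.eventually_all.mpr fun k => ?_)
      (Filter.Eventually.and (Filter.eventually_all.mpr fun k => ?_)
        (Filter.eventually_all.mpr fun i => Filter.eventually_all.mpr fun j => ?_))
    · refine ((hcont k).eventually_lt continuousAt_const ?_).filter_mono nhdsWithin_le_nhds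
      rw [hY0]
      linarith
    · refine ((hcont k).eventually_lt continuousAt_const ?_).filter_mono nhdsWithin_le_nhds
      rw [hY0]
      exact hx1 k
    · by_cases hij : c i = c j
      · exact Filter.Eventually.of_forall fun _ h => absurd hij h
      · have hfin := (Polynomial.finite_setOfPred_isRoot (hP i j hij)).subset
          (Set.sdiff_subset (t := {0}))
        have h1 := hfin.isClosed.isOpen_compl.mem_nhds
          (show (0 : ℝ) ∈ ({τ | (P i j).IsRoot τ} \ {0})ᶜ by simp)
        filter_upwards [nhdsWithin_le_nhds h1, self_mem_nhdsWithin] with τ hτ hτ0 _ hroot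
        exact hτ ⟨hroot, ne_of_gt hτ0⟩
  obtain ⟨τ, ⟨h1, h2, h3⟩, hτ⟩ := (hev.and self_mem_nhdsWithin).exists
  have hxY : x ≤ Y τ := fun k => le_add_of_nonneg_right (pow_pos hτ _).le
  refine ⟨Y τ, hxY, h2, hfl _ hxY fun k => (h1 k).le, fun i j hij h => h3 i j hij ?_⟩
  rw [Polynomial.IsRoot, hPeval, h, sub_self]

variable [Fintype ι]

theorem dotReal_div (a : Fin d → ℕ) (x : Fin d → ℝ) (s : ℝ) :
    dotReal a (fun k => x k / s) = dotReal a x / s := by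
  simp only [dotReal, Finset.sum_div, mul_div_assoc]

/-- At a generic point `x` with `max (cᵢ · x) = A`, the forms reaching the maximum all have the same
sign, so that the Landau function is nonzero at `x / A`. -/
theorem landauOf_div_max_ne_zero (hε : ∀ i, ε i ≠ 0) {x : Fin d → ℝ}
    (hgen : ∀ i j, ε i ≠ ε j → dotReal (c i) x ≠ dotReal (c j) x) {i₀ : ι}
    (hmax : ∀ i, dotReal (c i) x ≤ dotReal (c i₀) x) (hpos : 0 < dotReal (c i₀) x) :
    landauOf ε (floors c fun k => x k / dotReal (c i₀) x) ≠ 0 := by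
  have h1 : landauOf ε (floors c fun k => x k / dotReal (c i₀) x) =
      ε i₀ * ∑ i, ((floors c (fun k => x k / dotReal (c i₀) x) i : ℕ) : ℤ) := by
    rw [landauOf, Finset.mul_sum]
    refine Finset.sum_congr rfl fun i _ => ?_
    by_cases hi : ε i = ε i₀
    · rw [hi]
    · have h2 : floors c (fun k => x k / dotReal (c i₀) x) i = 0 := by
        rw [floors, dotReal_div, Nat.floor_eq_zero, div_lt_one hpos]
        exact lt_of_le_of_ne (hmax i) (hgen i i₀ hi)
      simp [h2]
  have h3 : floors c (fun k => x k / dotReal (c i₀) x) i₀ = 1 := by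
    rw [floors, dotReal_div, div_self hpos.ne', Nat.floor_one]
  rw [h1]
  refine mul_ne_zero (hε i₀) (ne_of_gt ?_)
  refine Finset.sum_pos' (fun _ _ => Int.natCast_nonneg _) ⟨i₀, Finset.mem_univ _, ?_⟩
  rw [h3]
  exact zero_lt_one

theorem sum_harmonicOf_mul (x : Fin d → ℝ) :
    ∑ k, (harmonicOf c ε k (floors c x) : ℝ) * x k =
      ∑ i, (ε i : ℝ) * (dotReal (c i) x * (harmonic ⌊dotReal (c i) x⌋₊ : ℚ)) := by
  simp only [harmonicOf, dotReal, Rat.cast_sum, Finset.sum_mul, Finset.mul_sum]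
  rw [Finset.sum_comm]
  refine Finset.sum_congr rfl fun i _ => Finset.sum_congr rfl fun k _ => ?_
  push_cast
  simp only [floors, dotReal]
  ring

/-- If the Landau function vanishes at a point `x` of the unit cube where some linear form is at
least `1`, then one of the sums `∑ᵢ εᵢ cᵢ⁽ᵏ⁾ H_{⌊cᵢ · y⌋}` is nonzero at a suitable point `y` with
the same integer parts: for generic `y`, the sum over `k` of their products with `y_k` is the
integral of the values of the Landau function at `y / s`, for `1 ≤ s ≤ max (cᵢ · y)`. -/
theorem exists_harmonicOf_ne_zero (hε : ∀ i, ε i ≠ 0)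
    (hdis : ∀ i j, ε i ≠ ε j → c i ≠ c j)
    (hL : ∀ x ∈ Set.Icc (0 : Fin d → ℝ) 1, 0 ≤ landauOf ε (floors c x)) {x : Fin d → ℝ}
    (hx : 0 ≤ x) (hx1 : ∀ k, x k < 1) (hzero : landauOf ε (floors c x) = 0)
    (hone : ∃ i, 1 ≤ dotReal (c i) x) :
    ∃ k, harmonicOf c ε k (floors c x) ≠ 0 := by
  obtain ⟨y, hxy, hy1, hfl, hgen⟩ := exists_generic_point c hx hx1
  rw [← hfl] at hzero ⊢
  obtain ⟨i₁, hi₁⟩ := hone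
  obtain ⟨i₀, -, hmax⟩ := Finset.exists_max_image Finset.univ (fun i => dotReal (c i) y)
    ⟨i₁, Finset.mem_univ _⟩
  replace hmax := fun i => hmax i (Finset.mem_univ i)
  have hy : 0 ≤ y := hx.trans hxy
  set A := dotReal (c i₀) y with hA
  have hA1 : 1 ≤ A := hi₁.trans ((dotReal_mono _ hxy).trans (hmax i₁))
  have hA0 : 0 < A := zero_lt_one.trans_le hA1
  have hcube : ∀ s : ℝ, 1 ≤ s → (fun k => y k / s) ∈ Set.Icc (0 : Fin d → ℝ) 1 := fun s hs =>
    ⟨fun k => div_nonneg (hy k) (by linarith), fun k => (div_le_self (hy k) hs).trans (hy1 k).le⟩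
  have hpos : ∀ s : ℝ, 1 ≤ s → 0 ≤ landauOf ε (floors c fun k => y k / s) :=
    fun s hs => hL _ (hcube s hs)
  have hne := landauOf_div_max_ne_zero hε (fun i j hij => hgen i j (hdis i j hij)) hmax hA0
  have hA1' : 1 < A := by
    refine lt_of_le_of_ne hA1 fun h => hne ?_
    rw [← hA, ← h]
    simpa using hzero
  -- right-continuity at `y / A`
  obtain ⟨δ, hδ, hfl'⟩ := exists_floors_eq c (hcube A hA1).1
  obtain ⟨B, hB⟩ : ∃ B : ℝ, (1 < B ∧ ∀ k, y k / B < y k / A + δ) ∧ B < A := by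
    have h1 : ∀ᶠ s : ℝ in nhdsWithin A (Set.Iio A), 1 < s ∧ ∀ k, y k / s < y k / A + δ := by
      refine Filter.Eventually.filter_mono nhdsWithin_le_nhds
        ((eventually_gt_nhds hA1').and (Filter.eventually_all.mpr fun k => ?_))
      have h2 : ContinuousAt (fun s => y k / s) A :=
        continuousAt_const.div continuousAt_id hA0.ne'
      exact h2.eventually_lt continuousAt_const (by linarith)
    exact (h1.and self_mem_nhdsWithin).exists
  obtain ⟨⟨hB1, hBδ⟩, hBA⟩ := hB
  have hB0 : 0 < B := zero_lt_one.trans hB1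
  have hge : ∀ s ∈ Set.Icc B A, 1 ≤ landauOf ε (floors c fun k => y k / s) := by
    intro s hs
    have hs0 : 0 < s := hB0.trans_le hs.1
    rw [hfl' (fun k => y k / s) (fun k => div_le_div_of_nonneg_left (hy k) hs0 hs.2)
      fun k => (div_le_div_of_nonneg_left (hy k) hB0 hs.1).trans (hBδ k).le]
    exact Int.add_one_le_of_lt (lt_of_le_of_ne (hpos A hA1) (Ne.symm hne))
  let g : ℝ → ℝ := fun s => (landauOf ε (floors c fun k => y k / s) : ℤ)
  have hg : g = fun s => ∑ i, (ε i : ℝ) * ((⌊dotReal (c i) y / s⌋₊ : ℕ) : ℝ) := by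
    funext s
    simp only [g, landauOf, floors, dotReal_div]
    push_cast
    rfl
  have hgint : ∀ u v : ℝ, 0 < u → 0 < v → IntervalIntegrable g MeasureTheory.volume u v := by
    intro u v hu hv
    rw [hg]
    have h := IntervalIntegrable.sum Finset.univ fun i _ =>
      (intervalIntegrable_floor_div (dotReal_nonneg (c i) hy) hu hv).const_mul (ε i : ℝ)
    rwa [Finset.sum_fn] at h
  have hval : ∫ s in (1 : ℝ)..A, g s = ∑ k, (harmonicOf c ε k (floors c y) : ℝ) * y k := by
    rw [hg, intervalIntegral.integral_finsetSum fun i _ =>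
      (intervalIntegrable_floor_div (dotReal_nonneg _ hy) zero_lt_one hA0).const_mul _,
      sum_harmonicOf_mul]
    have h1 : ∑ i, (ε i : ℝ) * ((⌊dotReal (c i) y⌋₊ : ℕ) : ℝ) = 0 := by
      exact_mod_cast hzero
    rw [← sub_zero (∑ i, (ε i : ℝ) * (dotReal (c i) y * _)), ← h1, ← Finset.sum_sub_distrib]
    refine Finset.sum_congr rfl fun i _ => ?_
    rw [intervalIntegral.integral_const_mul,
      integral_floor_div (dotReal_nonneg _ hy) hA1 (hmax i), mul_sub]
  have hlow : 0 < ∫ s in (1 : ℝ)..A, g s := by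
    rw [← intervalIntegral.integral_add_adjacent_intervals (hgint 1 B zero_lt_one hB0)
      (hgint B A hB0 hA0)]
    refine add_pos_of_nonneg_of_pos (intervalIntegral.integral_nonneg hB1.le fun s hs =>
      Int.cast_nonneg (hpos s hs.1)) (lt_of_lt_of_le (sub_pos.mpr hBA) ?_)
    calc A - B = ∫ _ in B..A, (1 : ℝ) := by simp
      _ ≤ ∫ s in B..A, g s := intervalIntegral.integral_mono_on hBA.le
        intervalIntegrable_const (hgint B A hB0 hA0) fun s hs => by
          exact Int.cast_one (R := ℝ) ▸ Int.cast_le.mpr (hge s hs)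
  by_contra! hall
  rw [hval] at hlow
  simp [hall] at hlow

end Positivity

/-! ### Coefficients that are not integral -/

section Series

open MvPowerSeries

/-- In a quotient `h = g / f` with `f(0) = 1`, the coefficients of `zⁿ` in `h` and `g` agree up to
the ring generated by the coefficients of `f` and by the coefficients of `g` of lower order. -/
theorem coeff_sub_coeff_mem_of_mul_eq {σ R : Type*} [CommRing R] (A : Subring R)
    {f g h : MvPowerSeries σ R} (hf0 : constantCoeff f = 1) (hfA : ∀ l, coeff l f ∈ A)
    (hfh : f * h = g) {n : σ →₀ ℕ} (hgA : ∀ l < n, coeff l g ∈ A) :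
    (∀ l < n, coeff l h ∈ A) ∧ coeff n h - coeff n g ∈ A := by
  classical
  have key : ∀ l ≤ n, (∀ m < l, coeff m h ∈ A) → coeff l h - coeff l g ∈ A := by
    intro l _ hlA
    rw [← hfh, coeff_mul_eq_sum_Iic,
      ← Finset.add_sum_erase _ _ (Finset.mem_Iic.mpr zero_le), tsub_zero,
      coeff_zero_eq_constantCoeff_apply, hf0, one_mul, sub_add_cancel_left]
    refine A.neg_mem (A.sum_mem fun m hm => ?_)
    rw [Finset.mem_erase, Finset.mem_Iic] at hm
    exact A.mul_mem (hfA m) (hlA _ (tsub_lt_of_ne_zero hm.2 hm.1))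
  have hlow : ∀ l : σ →₀ ℕ, l < n → coeff l h ∈ A := by
    intro l
    induction hN : l.degree using Nat.strong_induction_on generalizing l with
    | _ N ih =>
      intro hl
      rw [← sub_add_cancel (coeff l h) (coeff l g)]
      exact A.add_mem (key l hl.le fun m hm =>
        ih _ (hN ▸ degree_lt_of_lt hm) m rfl (hm.trans hl)) (hgA l hl)
  exact ⟨hlow, key n le_rfl hlow⟩

/-- Below `p` in all variables, the coefficients of `zⁿ` in `exp g` and `g` agree up to a
`p`-integral number, as long as the coefficients of `g` of lower order are `p`-integral. -/
theorem coeff_mvExp_sub_coeff_mem {σ : Type*} {p : ℕ} [Fact p.Prime] {g : MvPowerSeries σ ℚ}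
    (g0 : constantCoeff g = 0) {n : σ →₀ ℕ} (hn0 : n ≠ 0) (hnp : ∀ i, n i < p)
    (hg : ∀ l < n, coeff l g ∈ padicIntegral p) :
    (∀ l < n, coeff l (mvExp g) ∈ padicIntegral p) ∧
      coeff n (mvExp g) - coeff n g ∈ padicIntegral p := by
  classical
  have hexp0 : coeff 0 (mvExp g) = 1 := by
    rw [coeff_zero_eq_constantCoeff_apply, constantCoeff_mvExp g0]
  have key : ∀ l ≤ n, l ≠ 0 → (∀ m < l, coeff m (mvExp g) ∈ padicIntegral p) →
      coeff l (mvExp g) - coeff l g ∈ padicIntegral p := by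
    intro l hln hl0 hlA
    obtain ⟨i, hi⟩ : ∃ i, l i ≠ 0 := by
      by_contra! h
      exact hl0 (Finsupp.ext h)
    have hip : ¬ p ∣ l i := fun h =>
      absurd (Nat.le_of_dvd (Nat.pos_of_ne_zero hi) h) (not_le.mpr ((hln i).trans_lt (hnp i)))
    rw [mem_padicIntegral]
    refine PadicDvd.of_natCast_mul hip ?_
    rw [mul_sub, natCast_mul_coeff_mvExp g0,
      ← Finset.add_sum_erase _ _ (Finset.mem_Iic.mpr zero_le), tsub_zero, hexp0, one_mul,
      add_sub_cancel_left, ← mem_padicIntegral]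
    refine Subring.sum_mem _ fun m hm => ?_
    rw [Finset.mem_erase, Finset.mem_Iic] at hm
    rcases eq_or_lt_of_le hm.2 with h | h
    · simp [h]
    · exact Subring.mul_mem _ (hlA m h) (Subring.mul_mem _ (natCast_mem _ _)
        (hg _ ((tsub_lt_of_ne_zero hm.2 hm.1).trans_le hln)))
  have hlow : ∀ l : σ →₀ ℕ, l < n → coeff l (mvExp g) ∈ padicIntegral p := by
    intro l
    induction hN : l.degree using Nat.strong_induction_on generalizing l with
    | _ N ih =>
      intro hl
      by_cases hl0 : l = 0
      · rw [hl0, hexp0]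
        exact Subring.one_mem _
      · rw [← sub_add_cancel (coeff l (mvExp g)) (coeff l g)]
        exact Subring.add_mem _ (key l hl.le hl0 fun m hm =>
          ih _ (hN ▸ degree_lt_of_lt hm) m rfl (hm.trans hl)) (hg l hl)
  exact ⟨hlow, key n le_rfl hn0 hlow⟩

/-- The solution of `v = E(z v)` has coefficients in a ring that contains those of `E`. -/
theorem coeff_mem_of_eq_subst {σ R : Type*} [CommRing R] [Finite σ]
    {E v : σ → MvPowerSeries σ R} (hE : ∀ k, constantCoeff (E k) = 1)
    (hv : ∀ k, v k = (E k).subst fun j => X j * v j) (A : Subring R) (l : σ →₀ ℕ)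
    (hEA : ∀ k, ∀ m ≤ l, coeff m (E k) ∈ A) (k : σ) : coeff l (v k) ∈ A := by
  induction hN : l.degree using Nat.strong_induction_on generalizing l k with
  | _ N ih =>
    rw [← sub_add_cancel (coeff l (v k)) (coeff l (E k))]
    exact A.add_mem (coeff_sub_coeff_mem hE hv A
      (fun j m hm => ih _ (hN ▸ degree_lt_of_lt hm) m
        (fun j l hl => hEA j l (hl.trans hm.le)) j rfl)
      (fun j m hm => hEA j m hm.le) k) (hEA k l le_rfl)

end Series

section HarmonicCongruences

variable {d : ℕ} {ι : Type*} [Fintype ι] {c : ι → Fin d → ℕ} {ε : ι → ℤ} {p : ℕ}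
  [hp : Fact p.Prime]

theorem padicDvd_harmonic {N : ℕ} (h : N < p) : PadicDvd p 0 (harmonic N) := by
  have h1 := padicDvd_prime_mul_harmonic_sub (p := p) N
  rw [Nat.div_eq_of_lt h, harmonic_zero, sub_zero] at h1
  exact PadicDvd.of_prime_mul (by simpa using h1)

theorem padicDvd_harmonicOf (k : Fin d) {φ : ι → ℕ} (h : ∀ i, φ i < p) :
    PadicDvd p 0 (harmonicOf c ε k φ) :=
  PadicDvd.sum fun i _ =>
    ((PadicDvd.intCast _).mul_left (PadicDvd.natCast _)).mul_left (padicDvd_harmonic (h i))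

/-- Summed form of `p H_N ≡ H_{⌊N / p⌋}` modulo `p`. -/
theorem padicDvd_prime_mul_harmonicOf_sub (k : Fin d) (n : Fin d → ℕ) :
    PadicDvd p 1 (p * harmonicOf c ε k (fun i => c i ⬝ᵥ n) -
      harmonicOf c ε k (floors c (ratPoint n p))) := by
  simp only [harmonicOf, Finset.mul_sum, ← Finset.sum_sub_distrib, floors_ratPoint]
  refine PadicDvd.sum fun i _ => ?_
  have h := ((PadicDvd.intCast (p := p) (ε i)).mul_left (PadicDvd.natCast (c i k))).mul_left
    (padicDvd_prime_mul_harmonic_sub (c i ⬝ᵥ n))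
  convert h using 1
  ring

/-- If `⌊cᵢ · n / p⌋ < p` for all `i`, the denominator of `∑ᵢ εᵢ cᵢ⁽ᵏ⁾ H_{cᵢ · n}` contains `p` at
most once, and only if `∑ᵢ εᵢ cᵢ⁽ᵏ⁾ H_{⌊cᵢ · n / p⌋}` is nonzero. The factor `Q(n)` absorbs it unless
the Landau function vanishes at `n / p`. -/
theorem padicDvd_ratio_mul_harmonicOf (hbal : ∀ k, ∑ i, ε i * (c i k : ℤ) = 0) {n : Fin d → ℕ}
    (k : Fin d) (hsmall : ∀ i, floors c (ratPoint n p) i < p)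
    (hnonneg : 0 ≤ landauOf ε (floors c (ratPoint n p)))
    (hzero : landauOf ε (floors c (ratPoint n p)) = 0 →
      harmonicOf c ε k (floors c (ratPoint n p)) = 0) :
    PadicDvd p 0 (ratio c ε n * harmonicOf c ε k fun i => c i ⬝ᵥ n) := by
  have hval := padicValRat_ratio_eq_landauOf (ε := ε) hbal (p := p) fun i =>
    dotProduct_lt_of_floors_lt hp.out.pos (hsmall i)
  have hcong := padicDvd_prime_mul_harmonicOf_sub (c := c) (ε := ε) (p := p) k n
  have hR := (PadicDvd.iff_le_padicValRat (ratio_ne_zero (c := c) (ε := ε) n)).mpr hval.ge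
  refine PadicDvd.of_prime_mul ?_
  rw [mul_left_comm]
  rcases hnonneg.eq_or_lt with h | h
  · rw [hzero h.symm, sub_zero] at hcong
    exact (hR.mono hnonneg).mul_left (hcong.mono (by norm_num))
  · have h1 := (hcong.mono zero_le_one).add (padicDvd_harmonicOf (c := c) (ε := ε) k hsmall)
    rw [sub_add_cancel] at h1
    simpa using (hR.mono (l := 1) (by omega)).mul h1

theorem not_padicDvd_ratio_mul_harmonicOf (hbal : ∀ k, ∑ i, ε i * (c i k : ℤ) = 0)
    {n : Fin d → ℕ} (k : Fin d) (hsmall : ∀ i, floors c (ratPoint n p) i < p)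
    (hzero : landauOf ε (floors c (ratPoint n p)) = 0)
    (hunit : ¬ PadicDvd p 1 (harmonicOf c ε k (floors c (ratPoint n p)))) :
    ¬ PadicDvd p 0 (ratio c ε n * harmonicOf c ε k fun i => c i ⬝ᵥ n) := by
  intro h
  have hval := padicValRat_ratio_eq_landauOf (ε := ε) hbal (p := p) fun i =>
    dotProduct_lt_of_floors_lt hp.out.pos (hsmall i)
  have hne := ratio_ne_zero (c := c) (ε := ε) n
  have hinv : PadicDvd p 0 (ratio c ε n)⁻¹ :=
    (PadicDvd.iff_le_padicValRat (inv_ne_zero hne)).mpr (by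
      rw [padicValRat.inv, hval, hzero]
      simp)
  have h1 := (hinv.mul_left h).prime_mul
  rw [inv_mul_cancel_left₀ hne, zero_add] at h1
  have h2 := h1.sub (padicDvd_prime_mul_harmonicOf_sub (c := c) (ε := ε) (p := p) k n)
  rw [sub_sub_cancel] at h2
  exact hunit h2

theorem not_padicDvd_one_of_num_lt {x : ℚ} (hx : x ≠ 0) (h : x.num.natAbs < p) :
    ¬ PadicDvd p 1 x := by
  intro h1
  have h2 : PadicDvd p 1 (x.num : ℚ) := by
    rw [← Rat.den_mul_eq_num]
    exact (PadicDvd.natCast x.den).mul_left h1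
  have h3 : (p : ℤ) ∣ x.num := by
    have h4 := (PadicDvd.iff_le_padicValRat (Int.cast_ne_zero.mpr (Rat.num_ne_zero.mpr hx))).mp h2
    rw [padicValRat.of_int] at h4
    have h5 : 1 ≤ padicValInt p x.num := by exact_mod_cast h4
    by_contra h6
    rw [padicValInt.eq_zero_of_not_dvd h6] at h5
    omega
  exact absurd (Nat.le_of_dvd (Int.natAbs_pos.mpr (Rat.num_ne_zero.mpr hx))
    (Int.natCast_dvd.mp h3)) (not_le.mpr h)

end HarmonicCongruences

section NonIntegrality

variable {d : ℕ} {ι : Type*} [Fintype ι] {c : ι → Fin d → ℕ} {ε : ι → ℤ}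

/-- If the Landau function vanishes at a point of the unit cube where some linear form is at least
`1`, then one of the series `∑ₙ Q(n) (∑ᵢ εᵢ cᵢ⁽ᵏ⁾ H_{cᵢ · n}) zⁿ` has, for all large primes `p`, a
coefficient that is not `p`-integral, while those of lower order are, for all `k`. The exponent is
minimal among those `n` for which `n / p` has minimal integer parts subject to a vanishing Landau
function and a nonzero sum `∑ᵢ εᵢ cᵢ⁽ᵏ⁾ H_{⌊cᵢ · n / p⌋}`. -/
theorem exists_not_padicDvd_ratio_mul_harmonicOf (hbal : ∀ k, ∑ i, ε i * (c i k : ℤ) = 0)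
    (hε : ∀ i, ε i ≠ 0) (hdis : ∀ i j, ε i ≠ ε j → c i ≠ c j)
    (hL : ∀ x ∈ Set.Icc (0 : Fin d → ℝ) 1, 0 ≤ landauOf ε (floors c x)) {x : Fin d → ℝ}
    (hx : 0 ≤ x) (hx1 : ∀ k, x k < 1) (hzero : landauOf ε (floors c x) = 0)
    (hone : ∃ i, 1 ≤ dotReal (c i) x) :
    ∃ (k : Fin d) (p₀ : ℕ), ∀ p ≥ p₀, p.Prime → ∃ n : Fin d →₀ ℕ, n ≠ 0 ∧ (∀ i, n i < p) ∧
      (∀ m < n, ∀ j, PadicDvd p 0 (ratio c ε m * harmonicOf c ε j fun i => c i ⬝ᵥ ⇑m)) ∧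
      ¬ PadicDvd p 0 (ratio c ε n * harmonicOf c ε k fun i => c i ⬝ᵥ ⇑n) := by
  classical
  let S : Set (ι → ℕ) := {φ | ∃ y : Fin d → ℝ, 0 ≤ y ∧ (∀ k, y k < 1) ∧ floors c y = φ ∧
    landauOf ε φ = 0 ∧ ∃ k, harmonicOf c ε k φ ≠ 0}
  have hS : S.Nonempty :=
    ⟨_, x, hx, hx1, rfl, hzero, exists_harmonicOf_ne_zero hε hdis hL hx hx1 hzero hone⟩
  obtain ⟨φ, ⟨z, hz, hz1, hzφ, hφ0, k, hk⟩, hmin⟩ := WellFounded.has_min wellFounded_lt S hS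
  obtain ⟨δ, hδ, hfl⟩ := exists_floors_eq c hz
  obtain ⟨δ', hδ', hδ'1⟩ : ∃ δ' > 0, δ' ≤ δ ∧ ∀ k, z k + δ' < 1 := by
    have h1 : ∀ᶠ t : ℝ in nhdsWithin 0 (Set.Ioi 0), t ≤ δ ∧ ∀ k, z k + t < 1 := by
      refine Filter.Eventually.filter_mono nhdsWithin_le_nhds
        ((eventually_le_nhds hδ).and (Filter.eventually_all.mpr fun k => ?_))
      have h2 : ContinuousAt (fun t => z k + t) 0 := by fun_prop
      exact h2.eventually_lt continuousAt_const (by simpa using hz1 k)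
    obtain ⟨t, ht, ht0⟩ := (h1.and self_mem_nhdsWithin).exists
    exact ⟨t, ht0, ht⟩
  obtain ⟨q₀, hq₀⟩ := exists_ratPoint_near hz hδ'
  refine ⟨k, q₀ + ∑ i, φ i + (harmonicOf c ε k φ).num.natAbs + 1, fun p hpge hp => ?_⟩
  have : Fact p.Prime := ⟨hp⟩
  obtain ⟨a, ha1, ha2⟩ := hq₀ p (by omega)
  have hφp : ∀ i, φ i < p := fun i => by
    have := Finset.single_le_sum (f := φ) (fun _ _ => Nat.zero_le _) (Finset.mem_univ i)
    omega
  have hap : ∀ i, a i < p := fun i => by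
    have h1 : (a i : ℝ) / p < 1 := (ha2 i).trans_lt (hδ'1.2 i)
    rw [div_lt_one (by exact_mod_cast hp.pos)] at h1
    exact_mod_cast h1
  obtain ⟨n, ⟨hna, hnφ⟩, hnmin⟩ := WellFounded.has_min wellFounded_lt
    {n : Fin d →₀ ℕ | n ≤ Finsupp.equivFunOnFinite.symm a ∧ floors c (ratPoint n p) = φ}
    ⟨Finsupp.equivFunOnFinite.symm a, le_rfl, by
      rw [← hzφ]
      exact hfl _ ha1 fun i => (ha2 i).trans (by linarith [hδ'1.1])⟩
  have hnp : ∀ i, n i < p := fun i => (hna i).trans_lt (hap i)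
  refine ⟨n, ?_, hnp, fun m hm j => ?_, ?_⟩
  · rintro rfl
    refine hk ?_
    have h1 : φ = fun _ => 0 := by
      rw [← hnφ]
      funext i
      simp [floors_ratPoint]
    simp [h1, harmonicOf]
  · have hmφ : floors c (ratPoint m p) < φ := by
      refine lt_of_le_of_ne ?_ fun h => hnmin m ⟨hm.le.trans hna, h⟩ hm
      rw [← hnφ]
      exact floors_mono c (ratPoint_mono hm.le p)
    have hm1 : ∀ i, ratPoint m p i < 1 := ratPoint_lt_one fun i => (hm.le i).trans_lt (hnp i)
    refine padicDvd_ratio_mul_harmonicOf hbal j (fun i => (hmφ.le i).trans_lt (hφp i))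
      (hL _ ⟨ratPoint_nonneg _ _, fun i => (hm1 i).le⟩) fun h0 => ?_
    by_contra hj
    exact hmin _ ⟨_, ratPoint_nonneg _ _, hm1, rfl, h0, j, hj⟩ hmφ
  · refine not_padicDvd_ratio_mul_harmonicOf hbal k ?_ ?_ ?_
    all_goals rw [hnφ]
    · exact hφp
    · exact hφ0
    · exact not_padicDvd_one_of_num_lt hk (by omega)

open MvPowerSeries

/-- The series `∑ₙ Q(n) zⁿ`. -/
noncomputable def ratioSeries (c : ι → Fin d → ℕ) (ε : ι → ℤ) : MvPowerSeries (Fin d) ℚ :=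
  fun n => ratio c ε n

/-- The series `∑ₙ Q(n) (∑ᵢ εᵢ cᵢ⁽ᵏ⁾ H_{cᵢ · n}) zⁿ`. -/
noncomputable def harmonicSeries (c : ι → Fin d → ℕ) (ε : ι → ℤ) (k : Fin d) :
    MvPowerSeries (Fin d) ℚ :=
  fun n => ratio c ε n * harmonicOf c ε k fun i => c i ⬝ᵥ ⇑n

theorem coeff_ratioSeries (n : Fin d →₀ ℕ) : coeff n (ratioSeries c ε) = ratio c ε n := rfl

theorem coeff_harmonicSeries (k : Fin d) (n : Fin d →₀ ℕ) :
    coeff n (harmonicSeries c ε k) = ratio c ε n * harmonicOf c ε k fun i => c i ⬝ᵥ ⇑n := rfl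

theorem constantCoeff_ratioSeries : constantCoeff (ratioSeries c ε) = 1 := by
  rw [← coeff_zero_eq_constantCoeff_apply, coeff_ratioSeries]
  exact ratio_zero

theorem constantCoeff_harmonicSeries (k : Fin d) : constantCoeff (harmonicSeries c ε k) = 0 := by
  rw [← coeff_zero_eq_constantCoeff_apply, coeff_harmonicSeries]
  simp [harmonicOf]

theorem constantCoeff_eq_zero_of_ratioSeries_mul {h : MvPowerSeries (Fin d) ℚ} {k : Fin d}
    (hh : ratioSeries c ε * h = harmonicSeries c ε k) : constantCoeff h = 0 := by
  have h1 := congrArg constantCoeff hh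
  rwa [map_mul, constantCoeff_ratioSeries, one_mul, constantCoeff_harmonicSeries] at h1

/-- Failure of integrality for `exp h_k`, where `h_k` is the quotient of the two series above, and
for the solution `v` of the fixed point equation `v = exp(-h)(z v)`. -/
theorem exists_not_padicDvd_coeff_mvExp (hbal : ∀ k, ∑ i, ε i * (c i k : ℤ) = 0)
    (hε : ∀ i, ε i ≠ 0) (hdis : ∀ i j, ε i ≠ ε j → c i ≠ c j)
    (hL : ∀ x ∈ Set.Icc (0 : Fin d → ℝ) 1, 0 ≤ landauOf ε (floors c x)) {x : Fin d → ℝ}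
    (hx : 0 ≤ x) (hx1 : ∀ k, x k < 1) (hzero : landauOf ε (floors c x) = 0)
    (hone : ∃ i, 1 ≤ dotReal (c i) x) {h v : Fin d → MvPowerSeries (Fin d) ℚ}
    (hh : ∀ k, ratioSeries c ε * h k = harmonicSeries c ε k)
    (hv : ∀ k, v k = (mvExp (-h k)).subst fun j => X j * v j) :
    ∃ (k : Fin d) (p₀ : ℕ), ∀ p ≥ p₀, p.Prime → ∃ n : Fin d →₀ ℕ,
      ¬ PadicDvd p 0 (coeff n (mvExp (h k))) ∧ ¬ PadicDvd p 0 (coeff n (v k)) := by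
  obtain ⟨k, p₀, hp₀⟩ :=
    exists_not_padicDvd_ratio_mul_harmonicOf hbal hε hdis hL hx hx1 hzero hone
  refine ⟨k, p₀, fun p hpge hp => ?_⟩
  have : Fact p.Prime := ⟨hp⟩
  obtain ⟨n, hn0, hnp, hlow, hnot⟩ := hp₀ p hpge hp
  have h0 : ∀ j, constantCoeff (h j) = 0 := fun j =>
    constantCoeff_eq_zero_of_ratioSeries_mul (hh j)
  have hF : ∀ l, coeff l (ratioSeries c ε) ∈ padicIntegral p := fun l => by
    obtain ⟨m, hm⟩ := exists_int_eq_ratio hbal hL l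
    rw [coeff_ratioSeries, hm]
    exact intCast_mem _ _
  have hquot := fun j => coeff_sub_coeff_mem_of_mul_eq (padicIntegral p) constantCoeff_ratioSeries
    hF (hh j) (n := n) fun l hl => mem_padicIntegral.mpr (hlow l hl j)
  have hhn : coeff n (h k) ∉ padicIntegral p := fun h1 => hnot <| by
    rw [← coeff_harmonicSeries, ← mem_padicIntegral]
    have h2 := Subring.sub_mem _ h1 (hquot k).2
    rwa [sub_sub_cancel] at h2
  have hexp := coeff_mvExp_sub_coeff_mem (h0 k) hn0 hnp (hquot k).1
  have hexp' := fun j => coeff_mvExp_sub_coeff_mem (g := -h j) (by rw [map_neg, h0, neg_zero]) hn0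
    hnp fun l hl => by
      rw [map_neg]
      exact Subring.neg_mem _ ((hquot j).1 l hl)
  have hE : ∀ j, constantCoeff (mvExp (-h j)) = 1 := fun j =>
    constantCoeff_mvExp (by rw [map_neg, h0, neg_zero])
  refine ⟨n, fun h1 => hhn ?_, fun h1 => hhn ?_⟩
  · have h2 := Subring.sub_mem _ (mem_padicIntegral.mpr h1) hexp.2
    rwa [sub_sub_cancel] at h2
  · have h2 := coeff_sub_coeff_mem hE hv (padicIntegral p) (n := n)
      (fun j l hl => coeff_mem_of_eq_subst hE hv _ l
        (fun i m hm => (hexp' i).1 m (hm.trans_lt hl)) j)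
      (fun j l hl => (hexp' j).1 l hl) k
    have h3 := Subring.sub_mem _ (Subring.sub_mem _ (mem_padicIntegral.mpr h1) h2) (hexp' k).2
    rw [sub_sub_cancel, sub_sub_cancel, map_neg] at h3
    exact neg_mem_iff.mp h3

end NonIntegrality

/-! ### Integrality, canonical coordinates and mirror maps -/

section Integrality

open MvPowerSeries

variable {d : ℕ} {ι : Type*} [Fintype ι] {c : ι → Fin d → ℕ} {ε : ι → ℤ}

theorem sum_Iic_coe {M : Type*} [AddCommMonoid M] (l : Fin d →₀ ℕ) (f : (Fin d → ℕ) → M) :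
    ∑ x ∈ Finset.Iic (⇑l), f x = ∑ x ∈ Finset.Iic l, f ⇑x := by
  refine Finset.sum_nbij' Finsupp.equivFunOnFinite.symm (fun x => ⇑x) ?_ ?_ ?_ ?_ ?_
  · intro x hx
    rw [Finset.mem_Iic] at hx ⊢
    exact hx
  · intro x hx
    rw [Finset.mem_Iic] at hx ⊢
    exact hx
  · intro x _
    rfl
  · intro x _
    exact Finsupp.ext fun _ => rfl
  · intro x _
    rfl

theorem coeff_smul_sub_expand {p : ℕ} (hp : p ≠ 0) (h : MvPowerSeries (Fin d) ℚ)
    (l : Fin d →₀ ℕ) :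
    coeff l (p • h - expand p hp h) =
      dworkDefect p (fun m => coeff (Finsupp.equivFunOnFinite.symm m) h) l := by
  have hl : Finsupp.equivFunOnFinite.symm (⇑l) = l := Finsupp.ext fun _ => rfl
  rw [map_sub, map_nsmul, nsmul_eq_mul, dworkDefect, hl]
  congr 1
  split_ifs with h0
  · have h1 : l = p • Finsupp.equivFunOnFinite.symm (vdiv l p) := by
      ext k
      exact (Nat.mul_div_cancel' (Nat.dvd_of_mod_eq_zero (congrFun h0 k))).symm
    conv_lhs => rw [h1]
    rw [coeff_expand_smul]
  · obtain ⟨k, hk⟩ : ∃ k, ¬ p ∣ l k := by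
      by_contra! hall
      exact h0 (funext fun k => Nat.mod_eq_zero_of_dvd (hall k))
    exact coeff_expand_of_not_dvd p hp h hk

/-- Integrality of `exp (± h_k)`, under the conditions on the Landau function. -/
theorem padicDvd_coeff_mvExp_of_one_le (hbal : ∀ k, ∑ i, ε i * (c i k : ℤ) = 0)
    (hpos : ∀ q n, 0 < q → 0 ≤ floorSum c ε q n)
    (hwrap : ∀ q n, 0 < q → Wraps c q n → 1 ≤ floorSum c ε q n) {k : Fin d}
    {h : MvPowerSeries (Fin d) ℚ} (hh : ratioSeries c ε * h = harmonicSeries c ε k)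
    (p : ℕ) [hp : Fact p.Prime] (n : Fin d →₀ ℕ) :
    PadicDvd p 0 (coeff n (mvExp h)) ∧ PadicDvd p 0 (coeff n (mvExp (-h))) := by
  classical
  have h0 := constantCoeff_eq_zero_of_ratioSeries_mul hh
  have hdef : ∀ m, defect (fun m => harmonicOf c ε k fun i => c i ⬝ᵥ m)
      (fun m => coeff (Finsupp.equivFunOnFinite.symm m) h) (ratio c ε) m = 0 := by
    intro m
    have h1 := congrArg (coeff (Finsupp.equivFunOnFinite.symm m)) hh
    rw [coeff_mul_eq_sum_Iic, coeff_harmonicSeries] at h1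
    have h2 := sum_Iic_coe (Finsupp.equivFunOnFinite.symm m) fun x =>
      ratio c ε x * coeff (Finsupp.equivFunOnFinite.symm (m - x)) h
    rw [Finsupp.coe_equivFunOnFinite_symm] at h1 h2
    rw [defect, h2, ← h1, sub_eq_zero]
    refine Finset.sum_congr rfl fun x _ => ?_
    rw [coeff_ratioSeries]
    congr 2
    exact congrArg coeff (Finsupp.ext fun _ => rfl)
  have hH : ∀ (s : ℕ) n, PadicDvd p (1 - s + levelSum c ε p (s + 1) n)
      (ratio c ε n * (p * (harmonicOf c ε k fun i => c i ⬝ᵥ n) -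
        harmonicOf c ε k fun i => c i ⬝ᵥ vdiv n p)) := by
    intro s n
    simp only [harmonicOf, Finset.mul_sum, ← Finset.sum_sub_distrib]
    refine PadicDvd.sum fun i _ => ?_
    have h1 := ((PadicDvd.intCast (p := p) (ε i)).mul_left (PadicDvd.natCast (c i k))).mul_left
      (padicDvd_ratio_mul_harmonic_sub hbal hpos hwrap s n i)
    convert h1 using 1
    ring
  have hdw : ∀ l, PadicDvd p 1 (coeff l (p • h - expand p hp.out.ne_zero h)) := fun l => by
    rw [coeff_smul_sub_expand]
    exact (padicDvd_defect_and_dworkDefect hbal hpos hwrap hdef (by simp [harmonicOf]) hH l).2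
  refine ⟨padicDvd_coeff_mvExp h0 hdw n,
    padicDvd_coeff_mvExp (by rw [map_neg, h0, neg_zero]) (fun l => ?_) n⟩
  rw [smul_neg, map_neg, ← neg_sub', map_neg]
  exact (hdw l).neg

end Integrality

section Ratios

open MvPowerSeries

variable {d q₁ q₂ : ℕ} (e : Fin q₁ → Fin d → ℕ) (f : Fin q₂ → Fin d → ℕ)

/-- The linear forms in the numerator and in the denominator of a ratio of factorials, as one
family. -/
abbrev forms : Fin q₁ ⊕ Fin q₂ → Fin d → ℕ := Sum.elim e f

/-- The exponents of the factorials: `1` in the numerator and `-1` in the denominator. -/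
abbrev signs (q₁ q₂ : ℕ) : Fin q₁ ⊕ Fin q₂ → ℤ := Sum.elim (fun _ => 1) fun _ => -1

theorem Q_eq_ratio (n : Fin d → ℕ) : Q e f n = ratio (forms e f) (signs q₁ q₂) n := by
  simp [Q, ratio, Fintype.prod_sum_type, div_eq_mul_inv]

theorem landau_eq_landauOf {x : Fin d → ℝ} (hx : 0 ≤ x) :
    landau e f x = landauOf (signs q₁ q₂) (floors (forms e f) x) := by
  simp [landau, landauOf, floors, Fintype.sum_sum_type, sub_eq_add_neg,
    Int.natCast_floor_eq_floor, dotReal_nonneg _ hx]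

theorem F_eq_ratioSeries : F e f = ratioSeries (forms e f) (signs q₁ q₂) :=
  funext fun n => Q_eq_ratio e f n

theorem G_eq_harmonicSeries (k : Fin d) :
    G e f k = harmonicSeries (forms e f) (signs q₁ q₂) k := by
  funext n
  simp [G, harmonicSeries, harmonicOf, Q_eq_ratio, Fintype.sum_sum_type, sub_eq_add_neg]

theorem signs_mul_forms_eq_zero (hsum : ∑ i, e i = ∑ j, f j) (k : Fin d) :
    ∑ i, signs q₁ q₂ i * (forms e f i k : ℤ) = 0 := by
  have h1 := congrFun hsum k
  rw [Finset.sum_apply, Finset.sum_apply] at h1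
  have h2 : (∑ i, (e i k : ℤ)) = ∑ j, (f j k : ℤ) := by exact_mod_cast h1
  simp [Fintype.sum_sum_type, h2]

theorem mem_D_iff {x : Fin d → ℝ} :
    x ∈ D e f ↔ (∀ k, 0 ≤ x k ∧ x k < 1) ∧ ∃ i, 1 ≤ dotReal (forms e f i) x := by
  rw [Sum.exists]
  rfl

theorem memXMulInt_X_mul {k : Fin d} {g : MvPowerSeries (Fin d) ℚ}
    (hg : ∀ n, ∃ m : ℤ, coeff n g = m) : MemXMulInt k (X k * g) := by
  choose u hu using hg
  let U : MvPowerSeries (Fin d) ℤ := u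
  refine ⟨U, ?_⟩
  congr 1
  ext n
  rw [hu, coeff_map]
  rfl

theorem padicDvd_coeff_of_memXMulPadicInt {p : ℕ} [Fact p.Prime] {k : Fin d}
    {g : MvPowerSeries (Fin d) ℚ} (hg : MemXMulPadicInt p k (X k * g)) (n : Fin d →₀ ℕ) :
    PadicDvd p 0 (coeff n g) := by
  obtain ⟨u, hu⟩ := hg
  have h1 := congrArg (coeff (Finsupp.single k 1 + n)) hu
  rw [map_mul, map_X, X_def, coeff_add_monomial_mul, coeff_add_monomial_mul, one_mul, one_mul,
    coeff_map, coeff_map] at h1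
  rw [PadicDvd.iff_norm_cast_le, neg_zero, zpow_zero]
  have h2 : ((coeff n g : ℚ) : ℚ_[p]) = (coeff n u : ℤ_[p]) := h1
  rw [h2]
  exact (coeff n u).2

theorem finite_memXMulPadicInt {k : Fin d} {g : MvPowerSeries (Fin d) ℚ} {p₀ : ℕ}
    (hg : ∀ p ≥ p₀, p.Prime → ∃ n, ¬ PadicDvd p 0 (coeff n g)) :
    {p : ℕ | ∃ _ : Fact p.Prime, MemXMulPadicInt p k (X k * g)}.Finite := by
  refine (Set.finite_lt_nat p₀).subset ?_
  rintro p ⟨hp, hmem⟩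
  by_contra hlt
  obtain ⟨n, hn⟩ := hg p (not_lt.mp hlt) hp.out
  exact hn (padicDvd_coeff_of_memXMulPadicInt hmem n)

end Ratios

end FactorialRatio

theorem theorem1 {d q₁ q₂ : ℕ} (e : Fin q₁ → Fin d → ℕ) (f : Fin q₂ → Fin d → ℕ)
    (he : ∀ i, e i ≠ 0) (hf : ∀ j, f j ≠ 0) (hdisj : ∀ i j, e i ≠ f j)
    (hsum : ∑ i, e i = ∑ j, f j) :
    ((∀ n : Fin d → ℕ, ∃ m : ℤ, Q e f n = m) ↔
      ∀ x ∈ Set.Icc (0 : Fin d → ℝ) 1, 0 ≤ landau e f x) ∧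
    ((∀ n : Fin d → ℕ, ∃ m : ℤ, Q e f n = m) →
      ((∀ x ∈ D e f, 1 ≤ landau e f x) →
        ∀ k, MemXMulInt k (canonicalCoord e f k)) ∧
      ((∃ x ∈ D e f, landau e f x = 0) →
        ∃ k, {p : ℕ | ∃ _ : Fact p.Prime, MemXMulPadicInt p k (canonicalCoord e f k)}.Finite) ∧
      ∃ z : Fin d → MvPowerSeries (Fin d) ℚ,
        IsCompInverse (canonicalCoord e f) z ∧
        ((∀ x ∈ D e f, 1 ≤ landau e f x) → ∀ k, MemXMulInt k (z k)) ∧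
        ((∃ x ∈ D e f, landau e f x = 0) →
          ∃ k, {p : ℕ | ∃ _ : Fact p.Prime, MemXMulPadicInt p k (z k)}.Finite)) := by
  have hbal := signs_mul_forms_eq_zero e f hsum
  have hiff : (∀ n : Fin d → ℕ, ∃ m : ℤ, Q e f n = m) ↔
      ∀ x ∈ Set.Icc (0 : Fin d → ℝ) 1, 0 ≤ landau e f x := by
    constructor
    · intro hQ x hx
      rw [landau_eq_landauOf e f hx.1]
      exact landauOf_nonneg_of_ratio_int hbal (fun n => Q_eq_ratio e f n ▸ hQ n) hx.1
    · intro hL n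
      rw [Q_eq_ratio]
      exact exists_int_eq_ratio hbal (fun x hx => landau_eq_landauOf e f hx.1 ▸ hL x hx) n
  refine ⟨hiff, fun hQ => ?_⟩
  have hL : ∀ x ∈ Set.Icc (0 : Fin d → ℝ) 1,
      0 ≤ landauOf (signs q₁ q₂) (floors (forms e f) x) := fun x hx =>
    landau_eq_landauOf e f hx.1 ▸ hiff.mp hQ x hx
  let h : Fin d → MvPowerSeries (Fin d) ℚ := fun k => G e f k * (F e f)⁻¹
  have hh : ∀ k, ratioSeries (forms e f) (signs q₁ q₂) * h k =
      harmonicSeries (forms e f) (signs q₁ q₂) k := fun k => by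
    rw [← F_eq_ratioSeries, ← G_eq_harmonicSeries, mul_left_comm, MvPowerSeries.mul_inv_cancel,
      mul_one]
    rw [constantCoeff_F]
    exact one_ne_zero
  have h0 : ∀ k, MvPowerSeries.constantCoeff (h k) = 0 := fun k =>
    constantCoeff_eq_zero_of_ratioSeries_mul (hh k)
  have hE' : ∀ k, MvPowerSeries.constantCoeff (mvExp (-h k)) = 1 := fun k =>
    constantCoeff_mvExp (by rw [map_neg, h0, neg_zero])
  obtain ⟨v, hv, hinv⟩ := exists_isCompInverse (fun k => mvExp_mul_mvExp_neg (h0 k)) hE'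
  have hpadic : (∀ x ∈ D e f, 1 ≤ landau e f x) → ∀ k (p : ℕ) [Fact p.Prime] n,
      PadicDvd p 0 (MvPowerSeries.coeff n (mvExp (h k))) ∧
        PadicDvd p 0 (MvPowerSeries.coeff n (mvExp (-h k))) := by
    intro hD k p _ n
    refine padicDvd_coeff_mvExp_of_one_le hbal (fun q n hq => floorSum_nonneg hbal hL hq n)
      (fun q n hq hw => ?_) (hh k) p n
    rw [← floorSum_vmod hbal, floorSum_eq_landauOf, ← landau_eq_landauOf _ _ (ratPoint_nonneg _ _)]
    refine hD _ ((mem_D_iff e f).mpr ⟨fun i => ⟨ratPoint_nonneg _ _ i,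
      ratPoint_lt_one (fun i => Nat.mod_lt _ hq) i⟩, ?_⟩)
    obtain ⟨i, hi⟩ := hw
    refine ⟨i, ?_⟩
    rw [dotReal_ratPoint, one_le_div (by exact_mod_cast hq)]
    exact_mod_cast hi
  have hnot : (∃ x ∈ D e f, landau e f x = 0) → ∃ (k : Fin d) (p₀ : ℕ), ∀ p ≥ p₀, p.Prime →
      ∃ n : Fin d →₀ ℕ, ¬ PadicDvd p 0 (MvPowerSeries.coeff n (mvExp (h k))) ∧
        ¬ PadicDvd p 0 (MvPowerSeries.coeff n (v k)) := by
    rintro ⟨x, hxD, hx0⟩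
    obtain ⟨hx, hone⟩ := (mem_D_iff e f).mp hxD
    have hx' : 0 ≤ x := fun k => (hx k).1
    rw [landau_eq_landauOf e f hx'] at hx0
    refine exists_not_padicDvd_coeff_mvExp hbal ?_ ?_ hL hx' (fun k => (hx k).2) hx0 hone hh hv
    · rintro (i | j) <;> simp
    · rintro (i | i) (j | j) hij
      · exact absurd rfl hij
      · exact hdisj i j
      · exact (hdisj j i).symm
      · exact absurd rfl hij
  refine ⟨fun hD k => ?_, fun hD => ?_, fun k => MvPowerSeries.X k * v k, hinv, fun hD k => ?_,
    fun hD => ?_⟩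
  · exact memXMulInt_X_mul fun n =>
      exists_int_eq_of_forall_padicDvd fun p _ => (hpadic hD k p n).1
  · obtain ⟨k, p₀, hk⟩ := hnot hD
    exact ⟨k, finite_memXMulPadicInt fun p hp hpp => (hk p hp hpp).imp fun n hn => hn.1⟩
  · exact memXMulInt_X_mul fun n => exists_int_eq_of_forall_padicDvd fun p _ =>
      coeff_mem_of_eq_subst hE' hv (padicIntegral p) n (fun j m _ => (hpadic hD j p m).2) k
  · obtain ⟨k, p₀, hk⟩ := hnot hD
    exact ⟨k, finite_memXMulPadicInt fun p hp hpp => (hk p hp hpp).imp fun n hn => hn.2⟩
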